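/- Consider the real RAM with unit-cost operations: it has integer and real memory cells with indirect addressing, the operations $+,-,\times,/$ and comparisons on reals, and addition, subtraction, halving and comparisons on integers. There are two fixed programs, one for preprocessing and one for queries, with the following property. Let $t\in\mathbb R^2$ be a point and let $P$ be a set of $n$ line segments in the plane, each given by its two endpoints, that are pairwise non-crossing (no point lies in the relative interior of two of them; they may touch at endpoints). From $P$ and $t$, the preprocessing program builds a data structure of size (number of memory cells) $O(n)$ in $O(n\log n)$ time. Given only this data structure and a point $b\neq t$, the query program correctly determines in $O(\log n)$ time whether the closed segment $tb$, that is, the radius ending at $b$ of the circle of radius $r=|tb|$ centred at $t$, intersects at least one segment of $P$. The $O(\cdot)$ bounds hold for all $n\ge 2$ with one absolute constant, independent of $P$, $t$ and $b$; the programs halt and the answers are correct for every $n\geq 0$. -/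

import Mathlib

/-!
A uniform real RAM, as a structured language with unit-cost operations.

The machine has integer registers, real registers, integer arrays and real arrays, all indexed by
natural numbers.  A program is a finite piece of text, so it mentions only finitely many registers
and arrays; array cells are addressed by integer expressions (indirect addressing).
Real numbers can be added, subtracted, multiplied, divided and compared, and nothing else: there is
no rounding, no trigonometric function, no root, and no conversion between reals and integers.
Integers can be added, subtracted (truncated at zero), halved (rounded down) and compared.
-/

namespace RealRAM

/-- A memory configuration. -/
structure State where
  /-- integer registers -/
  ireg : ℕ → ℕ
  /-- real registers -/
  rreg : ℕ → ℝ
  /-- integer arrays: array name, then index -/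
  iarr : ℕ → ℕ → ℕ
  /-- real arrays: array name, then index -/
  rarr : ℕ → ℕ → ℝ

/-- Integer expressions. -/
inductive IExpr where
  | const (k : ℕ)
  | reg (x : ℕ)
  | get (a : ℕ) (i : IExpr)
  | add (e f : IExpr)
  | sub (e f : IExpr)
  | half (e : IExpr)

/-- Real expressions; the only literals are rational. -/
inductive RExpr where
  | const (q : ℚ)
  | reg (x : ℕ)
  | get (a : ℕ) (i : IExpr)
  | add (e f : RExpr)
  | sub (e f : RExpr)
  | mul (e f : RExpr)
  | div (e f : RExpr)

/-- Tests. -/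
inductive BExpr where
  | ilt (e f : IExpr)
  | ieq (e f : IExpr)
  | rlt (e f : RExpr)
  | req (e f : RExpr)
  | neg (p : BExpr)
  | conj (p q : BExpr)
  | disj (p q : BExpr)

/-- Programs. -/
inductive Prog where
  | skip
  | iset (x : ℕ) (e : IExpr)
  | rset (x : ℕ) (e : RExpr)
  | istore (a : ℕ) (i : IExpr) (e : IExpr)
  | rstore (a : ℕ) (i : IExpr) (e : RExpr)
  | seq (c d : Prog)
  | cond (p : BExpr) (c d : Prog)
  | loop (p : BExpr) (c : Prog)

/-- The value of an integer expression. -/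
def IExpr.eval (s : State) : IExpr → ℕ
  | const k => k
  | reg x => s.ireg x
  | get a i => s.iarr a (i.eval s)
  | add e f => e.eval s + f.eval s
  | sub e f => e.eval s - f.eval s
  | half e => e.eval s / 2

/-- The number of elementary operations used to evaluate an integer expression. -/
def IExpr.cost : IExpr → ℕ
  | const _ => 1
  | reg _ => 1
  | get _ i => i.cost + 1
  | add e f => e.cost + f.cost + 1
  | sub e f => e.cost + f.cost + 1
  | half e => e.cost + 1

/-- The value of a real expression.  A division by zero yields `0`; this gives no extra power, as
a program can test a divisor itself. -/
noncomputable def RExpr.eval (s : State) : RExpr → ℝ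
  | const q => (q : ℝ)
  | reg x => s.rreg x
  | get a i => s.rarr a (i.eval s)
  | add e f => e.eval s + f.eval s
  | sub e f => e.eval s - f.eval s
  | mul e f => e.eval s * f.eval s
  | div e f => e.eval s / f.eval s

/-- The number of elementary operations used to evaluate a real expression. -/
def RExpr.cost : RExpr → ℕ
  | const _ => 1
  | reg _ => 1
  | get _ i => i.cost + 1
  | add e f => e.cost + f.cost + 1
  | sub e f => e.cost + f.cost + 1
  | mul e f => e.cost + f.cost + 1
  | div e f => e.cost + f.cost + 1

/-- The truth value of a test. -/
def BExpr.eval (s : State) : BExpr → Prop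
  | ilt e f => e.eval s < f.eval s
  | ieq e f => e.eval s = f.eval s
  | rlt e f => e.eval s < f.eval s
  | req e f => e.eval s = f.eval s
  | neg p => ¬ p.eval s
  | conj p q => p.eval s ∧ q.eval s
  | disj p q => p.eval s ∨ q.eval s

/-- The number of elementary operations used to evaluate a test. -/
def BExpr.cost : BExpr → ℕ
  | ilt e f => e.cost + f.cost + 1
  | ieq e f => e.cost + f.cost + 1
  | rlt e f => e.cost + f.cost + 1
  | req e f => e.cost + f.cost + 1
  | neg p => p.cost + 1
  | conj p q => p.cost + q.cost + 1
  | disj p q => p.cost + q.cost + 1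

/-- Overwrite one integer register. -/
def State.setIReg (s : State) (x v : ℕ) : State :=
  { s with ireg := Function.update s.ireg x v }

/-- Overwrite one real register. -/
def State.setRReg (s : State) (x : ℕ) (v : ℝ) : State :=
  { s with rreg := Function.update s.rreg x v }

/-- Overwrite one cell of an integer array. -/
def State.setIArr (s : State) (a i v : ℕ) : State :=
  { s with iarr := Function.update s.iarr a (Function.update (s.iarr a) i v) }

/-- Overwrite one cell of a real array. -/
def State.setRArr (s : State) (a i : ℕ) (v : ℝ) : State :=
  { s with rarr := Function.update s.rarr a (Function.update (s.rarr a) i v) }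

/-- `Run c s T s'`: started in `s`, the program `c` halts in `s'` after exactly `T` elementary
steps. -/
inductive Run : Prog → State → ℕ → State → Prop where
  | skip (s : State) : Run .skip s 1 s
  | iset (s : State) (x : ℕ) (e : IExpr) :
      Run (.iset x e) s (e.cost + 1) (s.setIReg x (e.eval s))
  | rset (s : State) (x : ℕ) (e : RExpr) :
      Run (.rset x e) s (e.cost + 1) (s.setRReg x (e.eval s))
  | istore (s : State) (a : ℕ) (i e : IExpr) :
      Run (.istore a i e) s (i.cost + e.cost + 1) (s.setIArr a (i.eval s) (e.eval s))
  | rstore (s : State) (a : ℕ) (i : IExpr) (e : RExpr) :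
      Run (.rstore a i e) s (i.cost + e.cost + 1) (s.setRArr a (i.eval s) (e.eval s))
  | seq {c d : Prog} {s s' s'' : State} {T T' : ℕ} :
      Run c s T s' → Run d s' T' s'' → Run (.seq c d) s (T + T') s''
  | cond_true {p : BExpr} {c d : Prog} {s s' : State} {T : ℕ} :
      p.eval s → Run c s T s' → Run (.cond p c d) s (p.cost + 1 + T) s'
  | cond_false {p : BExpr} {c d : Prog} {s s' : State} {T : ℕ} :
      ¬ p.eval s → Run d s T s' → Run (.cond p c d) s (p.cost + 1 + T) s'
  | loop_stop {p : BExpr} {c : Prog} {s : State} :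
      ¬ p.eval s → Run (.loop p c) s (p.cost + 1) s
  | loop_step {p : BExpr} {c : Prog} {s s' s'' : State} {T T' : ℕ} :
      p.eval s → Run c s T s' → Run (.loop p c) s' T' s'' →
        Run (.loop p c) s (p.cost + 1 + T + T') s''

/-- What remains of a memory when only the cells with index below `m` of the integer arrays and of
the real arrays with name below `k` are kept.  Everything else, all registers included, is erased.
So this is a record of `k * m` integer cells and `k * m` real cells. -/
noncomputable def State.keep (k m : ℕ) (s : State) : State where
  ireg := fun _ => 0
  rreg := fun _ => 0
  iarr := fun a i => if a < k ∧ i < m then s.iarr a i else 0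
  rarr := fun a i => if a < k ∧ i < m then s.rarr a i else 0

end RealRAM

/-- The Euclidean plane. -/
abbrev Plane : Type := EuclideanSpace ℝ (Fin 2)

/-- A finite family of line segments, given by their endpoints, is non-crossing if no two of its
members have a point in common that is interior to both. -/
def NonCrossing {n : ℕ} (P : Fin n → Plane × Plane) : Prop :=
  Pairwise fun i j =>
    Disjoint (openSegment ℝ (P i).1 (P i).2) (openSegment ℝ (P j).1 (P j).2)

/-- The query radius from the centre `t` to the point `b` meets some segment of the family. -/
def RadiusMeets {n : ℕ} (t b : Plane) (P : Fin n → Plane × Plane) : Prop :=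
  ∃ i : Fin n, (segment ℝ t b ∩ segment ℝ (P i).1 (P i).2).Nonempty


/-- The initial memory of the preprocessing program: integer register `0` holds `n`, real registers
`0` and `1` hold the coordinates of `t`, and the real arrays `0`, `1`, `2`, `3` hold, at index `i`,
the coordinates of the first and of the second endpoint of the `i`-th segment.  The rest is `0`. -/
noncomputable def inputState {n : ℕ} (t : Plane) (P : Fin n → Plane × Plane) :
    RealRAM.State where
  ireg := fun x => if x = 0 then n else 0
  rreg := fun x => if x = 0 then t 0 else if x = 1 then t 1 else 0
  iarr := fun _ _ => 0
  rarr := fun a i =>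
    if h : i < n then
      if a = 0 then (P ⟨i, h⟩).1 0
      else if a = 1 then (P ⟨i, h⟩).1 1
      else if a = 2 then (P ⟨i, h⟩).2 0
      else if a = 3 then (P ⟨i, h⟩).2 1
      else 0
    else 0

/-- The initial memory of the query program: the stored data structure `D`, and the coordinates of
the query point `b` in the real registers `0` and `1`. -/
noncomputable def queryState (D : RealRAM.State) (b : Plane) : RealRAM.State :=
  (D.setRReg 0 (b 0)).setRReg 1 (b 1)

/-! Cut the plane about `t` into four closed cones, each a quarter turn of `|x| ≤ y`. In a cone the
projective coordinates `(x / y, 1 / y)` send rays from `t` to vertical lines, points nearer to `t`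
to higher points, and segments to segments. The radius ending at `b` becomes the vertical half-line
upwards from the image of `b`. A segment that avoids `t` therefore meets the radius exactly when its
piece in the cone of `b` has height at least `1 / y` above the abscissa `x / y`. A segment through
`t` meets every radius, and one flag records whether there is such a segment. A segment on a ray
that avoids `t` becomes a piece over a single abscissa, and only its highest point, the endpoint
nearest to `t`, matters (`isPiece_of_pos`, `isPiece_radial`). Shifting cone `c` by `4 * c` keeps the
abscissae of different cones apart, so one structure serves all four (`segMeets_iff`).

It remains to decide whether some piece over a given abscissa reaches a given height. A segment tree
over the sorted endpoint abscissae does this. Normally its nodes carry lists of total length of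
order `n * log n`. Here the pieces do not cross, so two pieces that span a common interval are
ordered over all of it (`Uncrossed.height_le`), and only the highest piece offered to a node has to
be kept. This gives linear size. Inserting a piece treats at most two nodes per level, and a query
climbs from one leaf to the root (`levelProg_spec`, `climb_spec`).

All comparisons use rational operations: there are no angles and no distances. The two orders of
pieces are compared at the midpoint of their common projection, and the tree is addressed by halving
node numbers. Sorting by merging, the `2 ^ κ` keys and the insertion of `4 * n` pieces each cost at
most order `2 ^ κ * (κ + 2)`, and `2 ^ κ` is of order `n`. -/

namespace RealRAM

/-! ### Memory updates and a calculus for running times. -/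

@[simp] theorem ireg_setIReg (s : State) (x v y : ℕ) :
    (s.setIReg x v).ireg y = if y = x then v else s.ireg y := by
  simp [State.setIReg, Function.update_apply]
@[simp] theorem rreg_setIReg (s : State) (x v : ℕ) : (s.setIReg x v).rreg = s.rreg := rfl
@[simp] theorem iarr_setIReg (s : State) (x v : ℕ) : (s.setIReg x v).iarr = s.iarr := rfl
@[simp] theorem rarr_setIReg (s : State) (x v : ℕ) : (s.setIReg x v).rarr = s.rarr := rfl

@[simp] theorem ireg_setRReg (s : State) (x : ℕ) (v : ℝ) : (s.setRReg x v).ireg = s.ireg := rfl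
@[simp] theorem rreg_setRReg (s : State) (x : ℕ) (v : ℝ) (y : ℕ) :
    (s.setRReg x v).rreg y = if y = x then v else s.rreg y := by
  simp [State.setRReg, Function.update_apply]
@[simp] theorem iarr_setRReg (s : State) (x : ℕ) (v : ℝ) : (s.setRReg x v).iarr = s.iarr := rfl
@[simp] theorem rarr_setRReg (s : State) (x : ℕ) (v : ℝ) : (s.setRReg x v).rarr = s.rarr := rfl

@[simp] theorem ireg_setIArr (s : State) (a i v : ℕ) : (s.setIArr a i v).ireg = s.ireg := rfl
@[simp] theorem rreg_setIArr (s : State) (a i v : ℕ) : (s.setIArr a i v).rreg = s.rreg := rfl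
@[simp] theorem rarr_setIArr (s : State) (a i v : ℕ) : (s.setIArr a i v).rarr = s.rarr := rfl
@[simp] theorem iarr_setIArr (s : State) (a i v b : ℕ) :
    (s.setIArr a i v).iarr b = if b = a then Function.update (s.iarr a) i v else s.iarr b := by
  by_cases h : b = a
  · subst h; simp [State.setIArr]
  · simp [State.setIArr, h]

@[simp] theorem ireg_setRArr (s : State) (a i : ℕ) (v : ℝ) : (s.setRArr a i v).ireg = s.ireg := rfl
@[simp] theorem rreg_setRArr (s : State) (a i : ℕ) (v : ℝ) : (s.setRArr a i v).rreg = s.rreg := rfl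
@[simp] theorem iarr_setRArr (s : State) (a i : ℕ) (v : ℝ) : (s.setRArr a i v).iarr = s.iarr := rfl
@[simp] theorem rarr_setRArr (s : State) (a i : ℕ) (v : ℝ) (b : ℕ) :
    (s.setRArr a i v).rarr b = if b = a then Function.update (s.rarr a) i v else s.rarr b := by
  by_cases h : b = a
  · subst h; simp [State.setRArr]
  · simp [State.setRArr, h]

/-- Started in `s`, the program `c` halts within `T` steps in a state that satisfies `Q`. -/
def Tri (c : Prog) (s : State) (T : ℕ) (Q : State → Prop) : Prop :=
  ∃ T' s', Run c s T' s' ∧ T' ≤ T ∧ Q s'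

theorem Tri.mono {c : Prog} {s : State} {T T' : ℕ} {Q Q' : State → Prop} (h : Tri c s T Q)
    (hT : T ≤ T') (hQ : ∀ s', Q s' → Q' s') : Tri c s T' Q' := by
  obtain ⟨t, s', h1, h2, h3⟩ := h
  exact ⟨t, s', h1, h2.trans hT, hQ _ h3⟩

theorem Tri.seq {c d : Prog} {s : State} {T'' : ℕ} {Q : State → Prop} (T T' : ℕ)
    (hT : T + T' ≤ T'') (h : Tri c s T fun s' => Tri d s' T' Q) : Tri (c.seq d) s T'' Q := by
  obtain ⟨t, s', h1, h2, t', s'', h3, h4, h5⟩ := h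
  exact ⟨_, s'', h1.seq h3, by omega, h5⟩

theorem Tri.cond {p : BExpr} {c d : Prog} {s : State} {T : ℕ} {Q : State → Prop}
    (hc : p.eval s → Tri c s T Q) (hd : ¬ p.eval s → Tri d s T Q) :
    Tri (.cond p c d) s (p.cost + 1 + T) Q := by
  by_cases hp : p.eval s
  · obtain ⟨t, s', h1, h2, h3⟩ := hc hp
    exact ⟨_, s', Run.cond_true hp h1, by omega, h3⟩
  · obtain ⟨t, s', h1, h2, h3⟩ := hd hp
    exact ⟨_, s', Run.cond_false hp h1, by omega, h3⟩

/-- An upper bound for the running time of a program without loops. -/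
def Prog.bound : Prog → ℕ
  | skip => 1
  | iset _ e => e.cost + 1
  | rset _ e => e.cost + 1
  | istore _ i e => i.cost + e.cost + 1
  | rstore _ i e => i.cost + e.cost + 1
  | seq c d => c.bound + d.bound
  | cond p c d => p.cost + 1 + (c.bound + d.bound)
  | loop _ _ => 0

/-- The weakest precondition of a program without loops. -/
def wp : Prog → (State → Prop) → State → Prop
  | .skip, Q, s => Q s
  | .iset x e, Q, s => Q (s.setIReg x (e.eval s))
  | .rset x e, Q, s => Q (s.setRReg x (e.eval s))
  | .istore a i e, Q, s => Q (s.setIArr a (i.eval s) (e.eval s))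
  | .rstore a i e, Q, s => Q (s.setRArr a (i.eval s) (e.eval s))
  | .seq c d, Q, s => wp c (wp d Q) s
  | .cond p c d, Q, s => (p.eval s → wp c Q s) ∧ (¬ p.eval s → wp d Q s)
  | .loop _ _, _, _ => False

/-- Reduces loop-free code to symbolic execution, with a time bound read off from the program text.
A loop has `wp` equal to `False`, so the value `0` of `bound` on loops does no harm. -/
theorem Tri.of_wp {c : Prog} {s : State} {Q : State → Prop} (h : wp c Q s) :
    Tri c s c.bound Q := by
  induction c generalizing s Q with
  | skip => exact ⟨_, _, Run.skip s, le_rfl, h⟩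
  | iset x e => exact ⟨_, _, Run.iset s x e, le_rfl, h⟩
  | rset x e => exact ⟨_, _, Run.rset s x e, le_rfl, h⟩
  | istore a i e => exact ⟨_, _, Run.istore s a i e, le_rfl, h⟩
  | rstore a i e => exact ⟨_, _, Run.rstore s a i e, le_rfl, h⟩
  | seq c d hc hd => exact Tri.seq _ _ le_rfl ((hc h).mono le_rfl fun s' h' => hd h')
  | cond p c d hc hd =>
    exact Tri.cond (fun hp => (hc (h.1 hp)).mono (Nat.le_add_right _ _) fun _ h => h)
      (fun hp => (hd (h.2 hp)).mono (Nat.le_add_left _ _) fun _ h => h)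
  | loop p c => exact h.elim

theorem Tri.wp_seq {c d : Prog} {s : State} {T' : ℕ} {Q : State → Prop} (T : ℕ)
    (hT : c.bound + T ≤ T') (h : wp c (fun s' => Tri d s' T Q) s) : Tri (c.seq d) s T' Q :=
  Tri.seq _ _ hT (Tri.of_wp h)

theorem Tri.of_wp_le {c : Prog} {s : State} {T : ℕ} {Q : State → Prop} (hT : c.bound ≤ T)
    (h : wp c Q s) : Tri c s T Q :=
  (Tri.of_wp h).mono hT fun _ h => h

/-- The loop rule: the invariant `I` carries a potential that pays for the remaining steps. -/
theorem Tri.loop {p : BExpr} {c : Prog} (I : ℕ → State → Prop)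
    (hstep : ∀ φ s, I φ s → p.eval s →
      ∃ T, Tri c s T fun s' => ∃ φ', I φ' s' ∧ T + p.cost + 1 + φ' ≤ φ)
    {φ : ℕ} {s : State} (h : I φ s) :
    Tri (.loop p c) s (φ + p.cost + 1) fun s' => (∃ φ', I φ' s') ∧ ¬ p.eval s' := by
  induction φ using Nat.strong_induction_on generalizing s with
  | _ φ ih =>
    by_cases hp : p.eval s
    · obtain ⟨T, t, s', h1, h2, φ', h3, h4⟩ := hstep φ s h hp
      obtain ⟨t', s'', h5, h6, h7⟩ := ih φ' (by omega) h3
      exact ⟨_, s'', Run.loop_step hp h1 h5, by omega, h7⟩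
    · exact ⟨_, s, Run.loop_stop hp, by omega, ⟨φ, h⟩, hp⟩

/-- The loop rule for a body that runs in bounded time. -/
theorem Tri.loop_bounded {p : BExpr} {c : Prog} (B : ℕ) (I : ℕ → State → Prop)
    (hstep : ∀ k s, I k s → p.eval s → Tri c s B fun s' => ∃ k', k' < k ∧ I k' s')
    {k : ℕ} {s : State} (h : I k s) :
    Tri (.loop p c) s ((B + p.cost + 1) * (k + 1)) fun s' => (∃ k', I k' s') ∧ ¬ p.eval s' := by
  have := Tri.loop (p := p) (c := c) (fun φ s => ∃ k, φ = (B + p.cost + 1) * k ∧ I k s)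
    (fun φ s ⟨k, hφ, hI⟩ hp => ⟨B, (hstep k s hI hp).mono le_rfl fun s' ⟨k', hk, hI'⟩ =>
      ⟨_, ⟨k', rfl, hI'⟩, by subst hφ; nlinarith⟩⟩) (s := s) ⟨k, rfl, h⟩
  refine this.mono (by rw [mul_add]; omega) ?_
  rintro s' ⟨⟨_, k', _, h'⟩, hp⟩
  exact ⟨⟨k', h'⟩, hp⟩

infixr:60 " ;; " => Prog.seq

/-! ### Binary search and the position of a number among the keys. -/

/-- Binary search in `[0, K)`, `K` the content of integer register `10`, for the end of the initial
segment in which the test `p` on the index in register `3` holds; the result is left in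
register `1`. -/
def bsearch (p : BExpr) : Prog :=
  (.iset 1 (.const 0) ;; .iset 2 (.reg 10)) ;;
  .loop (.ilt (.reg 1) (.reg 2))
    (.iset 3 (.half (.add (.reg 1) (.reg 2))) ;;
      .cond p (.iset 1 (.add (.reg 3) (.const 1))) (.iset 2 (.reg 3)))

/-- Two states that differ only in integer registers below `k`. -/
structure SameAbove (k : ℕ) (s s' : State) : Prop where
  rreg : s'.rreg = s.rreg
  iarr : s'.iarr = s.iarr
  rarr : s'.rarr = s.rarr
  ireg : ∀ x, k ≤ x → s'.ireg x = s.ireg x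

/-- The threshold always lies between registers `1` and `2`, and their distance halves in each
round. The test is assumed correct in every state that differs only in the working registers,
because it is evaluated in the middle of the search. -/
theorem bsearch_spec (p : BExpr) (s : State) (φ : ℕ → Prop) (κ : ℕ) (hK : s.ireg 10 ≤ 2 ^ κ)
    (hφ : ∀ i j, i ≤ j → j < s.ireg 10 → φ j → φ i)
    (hp : ∀ s', SameAbove 4 s s' → (p.eval s' ↔ φ (s'.ireg 3))) :
    Tri (bsearch p) s ((p.cost + 30) * (κ + 2)) fun s' => SameAbove 4 s s' ∧
      s'.ireg 1 ≤ s.ireg 10 ∧ ∀ j, j < s.ireg 10 → (φ j ↔ j < s'.ireg 1) := by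
  have main := fun k s₀ => Tri.loop_bounded (k := k) (s := s₀) (p := .ilt (.reg 1) (.reg 2))
    (c := .iset 3 (.half (.add (.reg 1) (.reg 2))) ;;
      .cond p (.iset 1 (.add (.reg 3) (.const 1))) (.iset 2 (.reg 3))) (p.cost + 12)
    (fun k s' => SameAbove 4 s s' ∧ s'.ireg 1 ≤ s'.ireg 2 ∧ s'.ireg 2 ≤ s.ireg 10 ∧
      s'.ireg 2 - s'.ireg 1 < 2 ^ k ∧ (∀ j, j < s'.ireg 1 → φ j) ∧
      (∀ j, s'.ireg 2 ≤ j → j < s.ireg 10 → ¬ φ j))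
    (by
      rintro k s' ⟨h0, h1, h2, h3, h4, h5⟩ hlt
      simp only [BExpr.eval, IExpr.eval] at hlt
      obtain ⟨k, rfl⟩ : ∃ k', k = k' + 1 := by
        cases k with
        | zero => simp at h3; omega
        | succ k => exact ⟨k, rfl⟩
      rw [pow_succ] at h3
      refine Tri.mono (Tri.of_wp_le (T := p.cost + 12)
        (by simp [Prog.bound, IExpr.cost]; omega) ?_) le_rfl (fun s' h => ⟨k, Nat.lt_succ_self k, h⟩)
      have hS : SameAbove 4 s (s'.setIReg 3 ((s'.ireg 1 + s'.ireg 2) / 2)) :=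
        ⟨h0.rreg, h0.iarr, h0.rarr, fun x hx => by simp [h0.ireg x hx]; omega⟩
      have hpe := hp _ hS
      simp only [wp, IExpr.eval, hpe]
      constructor
      · intro hm
        simp at hm
        refine ⟨⟨h0.rreg, h0.iarr, h0.rarr, fun x hx => ?_⟩, ?_⟩
        · have : x ≠ 1 := by omega
          have : x ≠ 3 := by omega
          simp [*, h0.ireg x hx]
        · simp
          refine ⟨by omega, h2, by omega, fun j hj => hφ j _ (by omega) (by omega) hm, h5⟩
      · intro hm
        simp at hm
        refine ⟨⟨h0.rreg, h0.iarr, h0.rarr, fun x hx => ?_⟩, ?_⟩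
        · have : x ≠ 2 := by omega
          have : x ≠ 3 := by omega
          simp [*, h0.ireg x hx]
        · simp
          refine ⟨by omega, by omega, by omega, h4, fun j hj hjK hφj => hm (hφ _ j (by omega) hjK hφj)⟩)
  refine Tri.wp_seq ((p.cost + 16) * (κ + 2)) ?_ ?_
  rotate_left
  · simp only [wp, IExpr.eval]
    -- The invariant bounds the length strictly and the initial length may equal `2 ^ κ`, hence one
    -- extra round.
    refine (main (κ + 1) _ ?_).mono ?_ ?_
    refine ⟨⟨rfl, rfl, rfl, fun x hx => ?_⟩, ?_⟩
    · have : x ≠ 1 := by omega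
      have : x ≠ 2 := by omega
      simp [*]
    · simp
      refine ⟨?_, fun j h1 h2 => by omega⟩
      rw [pow_succ]
      have : 0 < 2 ^ κ := by positivity
      omega
    · simp only [BExpr.cost, IExpr.cost]
      rfl
    · rintro s' ⟨⟨k, h0, h1, h2, h3, h4, h5⟩, hn⟩
      simp only [BExpr.eval, IExpr.eval] at hn
      refine ⟨h0, by omega, fun j hj => ⟨fun h => ?_, h4 j⟩⟩
      by_contra hc
      exact h5 j (by omega) hj h
  · simp only [Prog.bound, IExpr.cost]
    nlinarith

open Classical in
/-- The position of `q` among the keys `A 0, …, A (K - 1)`: even positions stand for the gaps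
between keys when the keys are distinct, odd ones for the keys. -/
noncomputable def leaf (A : ℕ → ℝ) (K : ℕ) (q : ℝ) : ℕ :=
  ((Finset.range K).filter fun j => A j < q).card +
    ((Finset.range K).filter fun j => A j ≤ q).card

theorem leaf_congr {A A' : ℕ → ℝ} {K : ℕ} (h : ∀ j, j < K → A j = A' j) (q : ℝ) :
    leaf A K q = leaf A' K q := by
  unfold leaf
  congr 2 <;> refine Finset.filter_congr fun j hj => ?_ <;> rw [h j (Finset.mem_range.1 hj)]

theorem leaf_le (A : ℕ → ℝ) (K : ℕ) (q : ℝ) : leaf A K q ≤ 2 * K := by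
  unfold leaf
  have h1 := Finset.card_filter_le (Finset.range K) fun j => A j < q
  have h2 := Finset.card_filter_le (Finset.range K) fun j => A j ≤ q
  rw [Finset.card_range] at h1 h2
  classical
  convert (add_le_add h1 h2) using 1
  · congr
  · ring

theorem leaf_mono (A : ℕ → ℝ) (K : ℕ) : Monotone (leaf A K) := by
  intro a b hab
  unfold leaf
  gcongr

/-- Moving up from a key `a` increases the count of keys `< ·`, and moving up to a key `b` increases
the count of keys `≤ ·`. A single count would not separate a key from both neighbouring gaps. -/
theorem leaf_lt {A : ℕ → ℝ} {K : ℕ} {a b : ℝ} (hab : a < b)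
    (h : (∃ j, j < K ∧ A j = a) ∨ ∃ j, j < K ∧ A j = b) : leaf A K a < leaf A K b := by
  classical
  unfold leaf
  rcases h with ⟨j, hj, rfl⟩ | ⟨j, hj, rfl⟩
  · refine add_lt_add_of_lt_of_le (Finset.card_lt_card ?_) (Finset.card_le_card ?_)
    · refine ⟨fun i hi => ?_, fun hs => ?_⟩
      · simp at hi ⊢; exact ⟨hi.1, hi.2.trans hab⟩
      · have := hs (show j ∈ _ by simp [hj, hab])
        simp at this
    · intro i hi
      simp at hi ⊢; exact ⟨hi.1, hi.2.trans hab.le⟩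
  · refine add_lt_add_of_le_of_lt (Finset.card_le_card ?_) (Finset.card_lt_card ?_)
    · intro i hi
      simp at hi ⊢; exact ⟨hi.1, hi.2.trans hab⟩
    · refine ⟨fun i hi => ?_, fun hs => ?_⟩
      · simp at hi ⊢; exact ⟨hi.1, hi.2.trans hab.le⟩
      · have := hs (show j ∈ _ by simp [hj])
        simp at this
        linarith

/-- Comparison with a key loses nothing when reals are replaced by positions. Hence a closed
interval between two keys corresponds to an exact range of leaves. -/
theorem leaf_le_iff {A : ℕ → ℝ} {K : ℕ} {a b : ℝ}
    (h : (∃ j, j < K ∧ A j = a) ∨ ∃ j, j < K ∧ A j = b) :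
    leaf A K a ≤ leaf A K b ↔ a ≤ b := by
  refine ⟨fun hl => ?_, fun hab => leaf_mono A K hab⟩
  by_contra hc
  exact absurd (leaf_lt (not_le.1 hc) h.symm) (by omega)

theorem card_filter_of_iff {K m : ℕ} {φ : ℕ → Prop} [DecidablePred φ] (hm : m ≤ K)
    (h : ∀ j, j < K → (φ j ↔ j < m)) : ((Finset.range K).filter φ).card = m := by
  have : (Finset.range K).filter φ = Finset.range m := by
    ext j
    simp only [Finset.mem_filter, Finset.mem_range]
    exact ⟨fun ⟨h1, h2⟩ => (h j h1).1 h2, fun hj => ⟨by omega, (h j (by omega)).2 hj⟩⟩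
  rw [this, Finset.card_range]

/-- Computes the position of real register `20` among the keys in real array `8`, into integer
register `5`. -/
def leafProg : Prog :=
  bsearch (.rlt (.get 8 (.reg 3)) (.reg 20)) ;;
  .iset 4 (.reg 1) ;;
  bsearch (.neg (.rlt (.reg 20) (.get 8 (.reg 3)))) ;;
  .iset 5 (.add (.reg 4) (.reg 1))

/-- In a sorted array the keys below `q`, and those at most `q`, form initial segments, so two
binary searches find both counts. -/
theorem leafProg_spec (s : State) (κ : ℕ) (hK : s.ireg 10 ≤ 2 ^ κ)
    (hA : ∀ i j, i ≤ j → j < s.ireg 10 → s.rarr 8 i ≤ s.rarr 8 j) :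
    Tri leafProg s (100 * (κ + 2)) fun s' => SameAbove 6 s s' ∧
      s'.ireg 5 = leaf (s.rarr 8) (s.ireg 10) (s.rreg 20) := by
  have b1 := bsearch_spec (.rlt (.get 8 (.reg 3)) (.reg 20)) s (fun j => s.rarr 8 j < s.rreg 20) κ hK
    (fun i j hij hj h => (hA i j hij hj).trans_lt h)
    (fun s' hs => by simp [BExpr.eval, RExpr.eval, IExpr.eval, hs.rreg, hs.rarr])
  refine Tri.seq _ (60 * (κ + 2)) ?_ (b1.mono le_rfl fun s1 h1 => ?_)
  · simp only [BExpr.cost, RExpr.cost, IExpr.cost]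
    omega
  refine Tri.wp_seq (50 * (κ + 2)) ?_ ?_
  · simp only [IExpr.cost, Prog.bound]
    omega
  simp only [wp, IExpr.eval]
  obtain ⟨hs1, hle1, hr1⟩ := h1
  set s2 := s1.setIReg 4 (s1.ireg 1) with hs2
  have e10 : s2.ireg 10 = s.ireg 10 := by simp [hs2, hs1.ireg]
  have e8 : s2.rarr = s.rarr := by simp [hs2, hs1.rarr]
  have er : s2.rreg = s.rreg := by simp [hs2, hs1.rreg]
  have b2 := bsearch_spec (.neg (.rlt (.reg 20) (.get 8 (.reg 3)))) s2
    (fun j => s.rarr 8 j ≤ s.rreg 20) κ (by rwa [e10])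
    (fun i j hij hj h => (hA i j hij (by rwa [e10] at hj)).trans h)
    (fun s' hs => by simp [BExpr.eval, RExpr.eval, IExpr.eval, hs.rreg, hs.rarr, e8, er])
  refine Tri.seq _ 4 ?_ (b2.mono le_rfl fun s3 h3 => Tri.of_wp_le (by simp [Prog.bound, IExpr.cost]) ?_)
  · simp only [BExpr.cost, RExpr.cost, IExpr.cost]
    omega
  obtain ⟨hs3, hle3, hr3⟩ := h3
  simp only [wp, IExpr.eval]
  refine ⟨⟨?_, ?_, ?_, fun x hx => ?_⟩, ?_⟩
  · simp [hs3.rreg, er]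
  · simp [hs3.iarr, hs2, hs1.iarr]
  · simp [hs3.rarr, e8]
  · have : x ≠ 4 := by omega
    have : x ≠ 5 := by omega
    simp [*, hs3.ireg x (by omega), hs1.ireg x (by omega)]
  · classical
    rw [e10] at hle3 hr3
    simp only [ireg_setIReg, if_true, hs3.ireg 4 le_rfl, hs2, leaf]
    congr 1
    · exact (card_filter_of_iff hle1 hr1).symm
    · exact (card_filter_of_iff hle3 hr3).symm

/-! ### Bottom-up merge sort. -/

/-- The state of a merge of the sorted blocks `[a, a + w)` and `[a + w, a + 2 * w)` of `A` into `B`,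
whose cells below `a` are those of `B₀`: the elements before `i` and before `j` have been moved to
the cells before `o`. -/
structure MergeInv (A B₀ B : ℕ → ℝ) (a w i j o : ℕ) : Prop where
  le_i : a ≤ i
  i_le : i ≤ a + w
  le_j : a + w ≤ j
  j_le : j ≤ a + w + w
  sum : i + j = o + (a + w)
  sorted : ∀ x y, a ≤ x → x ≤ y → y < o → B x ≤ B y
  le_left : ∀ x, a ≤ x → x < o → i < a + w → B x ≤ A i
  le_right : ∀ x, a ≤ x → x < o → j < a + w + w → B x ≤ A j
  covers : ∀ x, (a ≤ x ∧ x < i) ∨ (a + w ≤ x ∧ x < j) → ∃ y, a ≤ y ∧ y < o ∧ B y = A x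
  below : ∀ x, x < a → B x = B₀ x

theorem MergeInv.start (A B : ℕ → ℝ) (a w : ℕ) : MergeInv A B B a w a (a + w) a where
  le_i := le_rfl
  i_le := by omega
  le_j := le_rfl
  j_le := by omega
  sum := rfl
  sorted := by intros; omega
  le_left := by intros; omega
  le_right := by intros; omega
  covers := by intros; omega
  below := fun _ _ => rfl

/-- Everything moved so far is at most `A i` by `le_left`, so appending `A i` keeps the output
sorted. The head of the right block is at least `A i` and the left block is sorted, so the output
stays below both heads. -/
theorem MergeInv.left {A B₀ B : ℕ → ℝ} {a w i j o : ℕ} (h : MergeInv A B₀ B a w i j o)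
    (hs : ∀ x y, a ≤ x → x ≤ y → y < a + w → A x ≤ A y)
    (hi : i < a + w) (hij : j < a + w + w → A i ≤ A j) :
    MergeInv A B₀ (Function.update B o (A i)) a w (i + 1) j (o + 1) := by
  have hne : ∀ x, x < o → Function.update B o (A i) x = B x := fun x hx =>
    Function.update_of_ne (by omega) _ _
  have hle : ∀ x, a ≤ x → x < o + 1 → Function.update B o (A i) x ≤ A i := fun x h1 h2 => by
    rcases Nat.lt_succ_iff_lt_or_eq.1 h2 with h3 | rfl
    · rw [hne x h3]; exact h.le_left x h1 h3 hi
    · simp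
  have := h.sum
  have := h.le_i
  have := h.le_j
  refine ⟨by omega, by omega, by omega, h.j_le, by omega, ?_, ?_, ?_, ?_, ?_⟩
  · intro x y h1 h2 h3
    rcases Nat.lt_succ_iff_lt_or_eq.1 h3 with h4 | rfl
    · rw [hne x (by omega), hne y h4]; exact h.sorted x y h1 h2 h4
    · simpa using hle x h1 (by omega)
  · intro x h1 h2 h3
    exact (hle x h1 h2).trans (hs _ _ h.le_i (by omega) h3)
  · intro x h1 h2 h3
    exact (hle x h1 h2).trans (hij h3)
  · intro x hx
    by_cases hxi : x = i
    · exact ⟨o, by omega, by omega, by simp [hxi]⟩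
    · obtain ⟨y, h1, h2, h3⟩ := h.covers x (by omega)
      exact ⟨y, h1, by omega, by rw [hne y h2, h3]⟩
  · intro x hx
    rw [hne x (by omega)]; exact h.below x hx

theorem MergeInv.right {A B₀ B : ℕ → ℝ} {a w i j o : ℕ} (h : MergeInv A B₀ B a w i j o)
    (hs : ∀ x y, a + w ≤ x → x ≤ y → y < a + w + w → A x ≤ A y)
    (hj : j < a + w + w) (hij : i < a + w → A j ≤ A i) :
    MergeInv A B₀ (Function.update B o (A j)) a w i (j + 1) (o + 1) := by
  have hne : ∀ x, x < o → Function.update B o (A j) x = B x := fun x hx =>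
    Function.update_of_ne (by omega) _ _
  have hle : ∀ x, a ≤ x → x < o + 1 → Function.update B o (A j) x ≤ A j := fun x h1 h2 => by
    rcases Nat.lt_succ_iff_lt_or_eq.1 h2 with h3 | rfl
    · rw [hne x h3]; exact h.le_right x h1 h3 hj
    · simp
  have := h.sum
  have := h.le_i
  have := h.le_j
  refine ⟨by omega, h.i_le, by omega, by omega, by omega, ?_, ?_, ?_, ?_, ?_⟩
  · intro x y h1 h2 h3
    rcases Nat.lt_succ_iff_lt_or_eq.1 h3 with h4 | rfl
    · rw [hne x (by omega), hne y h4]; exact h.sorted x y h1 h2 h4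
    · simpa using hle x h1 (by omega)
  · intro x h1 h2 h3
    exact (hle x h1 h2).trans (hij h3)
  · intro x h1 h2 h3
    exact (hle x h1 h2).trans (hs _ _ h.le_j (by omega) h3)
  · intro x hx
    by_cases hxj : x = j
    · exact ⟨o, by omega, by omega, by simp [hxj]⟩
    · obtain ⟨y, h1, h2, h3⟩ := h.covers x (by omega)
      exact ⟨y, h1, by omega, by rw [hne y h2, h3]⟩
  · intro x hx
    rw [hne x (by omega)]; exact h.below x hx

/-- Moves one element in a merge: registers `13`, `14` point to the two sources in array `8`, which
end at registers `15` and `16`; register `17` points to the target in array `10`. -/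
def mergeStep : Prog :=
  .cond (.conj (.ilt (.reg 13) (.reg 15)) (.disj (.ieq (.reg 14) (.reg 16))
      (.neg (.rlt (.get 8 (.reg 14)) (.get 8 (.reg 13))))))
    (.rstore 10 (.reg 17) (.get 8 (.reg 13)) ;; .iset 13 (.add (.reg 13) (.const 1)))
    (.rstore 10 (.reg 17) (.get 8 (.reg 14)) ;; .iset 14 (.add (.reg 14) (.const 1))) ;;
  .iset 17 (.add (.reg 17) (.const 1))

/-- Merges two adjacent blocks, of length register `11`, that start at register `12`. -/
def mergeBlock : Prog :=
  (.iset 13 (.reg 12) ;; .iset 15 (.add (.reg 12) (.reg 11)) ;; .iset 14 (.reg 15) ;;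
    .iset 16 (.add (.reg 15) (.reg 11)) ;; .iset 17 (.reg 12)) ;;
  .loop (.ilt (.reg 17) (.reg 16)) mergeStep ;;
  .iset 12 (.reg 16)

/-- Merges all pairs of adjacent blocks of array `8`. -/
def mergePass : Prog :=
  .iset 12 (.const 0) ;;
  .loop (.ilt (.reg 12) (.reg 10)) mergeBlock ;;
  .iset 17 (.const 0) ;;
  .loop (.ilt (.reg 17) (.reg 10))
    (.rstore 8 (.reg 17) (.get 10 (.reg 17)) ;; .iset 17 (.add (.reg 17) (.const 1)))

/-- Sorts the first `K` cells of real array `8`, where `K` is the content of register `10`. -/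
def mergeSort : Prog :=
  .iset 11 (.const 1) ;;
  .loop (.ilt (.reg 11) (.reg 10)) (mergePass ;; .iset 11 (.add (.reg 11) (.reg 11)))

/-- Two states that differ only in the working memory of the sorting program. -/
structure SortFrame (s s' : State) : Prop where
  rreg : s'.rreg = s.rreg
  iarr : s'.iarr = s.iarr
  rarr : ∀ b, b ≠ 8 → b ≠ 10 → s'.rarr b = s.rarr b
  ireg : ∀ x, x ≤ 10 ∨ 18 ≤ x → s'.ireg x = s.ireg x

theorem SortFrame.refl (s : State) : SortFrame s s := ⟨rfl, rfl, fun _ _ _ => rfl, fun _ _ => rfl⟩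

theorem SortFrame.trans {s s' s'' : State} (h : SortFrame s s') (h' : SortFrame s' s'') :
    SortFrame s s'' where
  rreg := h'.rreg.trans h.rreg
  iarr := h'.iarr.trans h.iarr
  rarr b h1 h2 := (h'.rarr b h1 h2).trans (h.rarr b h1 h2)
  ireg x hx := (h'.ireg x hx).trans (h.ireg x hx)

theorem SortFrame.setIReg {s s' : State} (h : SortFrame s s') {x v : ℕ} (h1 : 11 ≤ x)
    (h2 : x ≤ 17) : SortFrame s (s'.setIReg x v) where
  rreg := h.rreg
  iarr := h.iarr
  rarr := h.rarr
  ireg y hy := by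
    have : y ≠ x := by omega
    simp [this, h.ireg y hy]

theorem SortFrame.setRArr {s s' : State} (h : SortFrame s s') {a i : ℕ} {v : ℝ}
    (ha : a = 8 ∨ a = 10) : SortFrame s (s'.setRArr a i v) where
  rreg := h.rreg
  iarr := h.iarr
  rarr b h1 h2 := by
    have : b ≠ a := by omega
    simp [this, h.rarr b h1 h2]
  ireg := h.ireg

theorem mergeBlock_spec (s : State) (a w : ℕ) (ha : s.ireg 12 = a) (hw : s.ireg 11 = w)
    (h1 : ∀ x y, a ≤ x → x ≤ y → y < a + w → s.rarr 8 x ≤ s.rarr 8 y)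
    (h2 : ∀ x y, a + w ≤ x → x ≤ y → y < a + w + w → s.rarr 8 x ≤ s.rarr 8 y) :
    Tri mergeBlock s (140 * (w + 1)) fun s' => SortFrame s s' ∧ s'.ireg 11 = w ∧
      s'.ireg 12 = a + w + w ∧ s'.rarr 8 = s.rarr 8 ∧
      MergeInv (s.rarr 8) (s.rarr 10) (s'.rarr 10) a w (a + w) (a + w + w) (a + w + w) := by
  refine Tri.wp_seq (120 * (w + 1)) (by simp [Prog.bound, IExpr.cost]; omega) ?_
  simp only [wp, IExpr.eval]
  set s₁ := ((((s.setIReg 13 (s.ireg 12)).setIReg 15 _).setIReg 14 _).setIReg 16 _).setIReg 17 _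
    with hs₁
  have main := Tri.loop_bounded (p := .ilt (.reg 17) (.reg 16)) (c := mergeStep) 45
    (fun k s' => SortFrame s s' ∧ s'.ireg 11 = w ∧ s'.ireg 15 = a + w ∧ s'.ireg 16 = a + w + w ∧
      s'.rarr 8 = s.rarr 8 ∧ k = a + w + w - s'.ireg 17 ∧
      MergeInv (s.rarr 8) (s.rarr 10) (s'.rarr 10) a w (s'.ireg 13) (s'.ireg 14) (s'.ireg 17))
    (by
      rintro k s' ⟨hf, h11, h15, h16, h8, hk, hm⟩ hlt
      simp only [BExpr.eval, IExpr.eval] at hlt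
      refine Tri.of_wp_le (by simp [Prog.bound, mergeStep, BExpr.cost, IExpr.cost, RExpr.cost]) ?_
      have hsum := hm.sum
      have hile := hm.i_le
      have hjle := hm.j_le
      simp only [wp, mergeStep, IExpr.eval, RExpr.eval, BExpr.eval, h8, h15, h16, not_lt]
      constructor
      · rintro ⟨hi, hij⟩
        refine ⟨a + w + w - (s'.ireg 17 + 1), by omega,
          ((hf.setRArr (.inr rfl)).setIReg (by norm_num) (by norm_num)).setIReg (by norm_num)
          (by norm_num), ?_⟩
        simp [h11, h15, h16, h8]
        exact hm.left h1 hi (fun hj => hij.resolve_left (by omega))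
      · intro hc
        refine ⟨a + w + w - (s'.ireg 17 + 1), by omega,
          ((hf.setRArr (.inr rfl)).setIReg (by norm_num) (by norm_num)).setIReg (by norm_num)
          (by norm_num), ?_⟩
        simp [h11, h15, h16, h8]
        -- If the right block were exhausted, `sum` and the free target cell would leave an element
        -- on the left, and the first branch would have been taken.
        have hj : s'.ireg 14 < a + w + w := by
          by_contra hj
          exact hc ⟨by omega, .inl (by omega)⟩
        refine hm.right h2 hj (fun hi => ?_)
        by_contra hlt'
        exact hc ⟨hi, .inr (not_le.1 hlt').le⟩)
    (k := w + w) (s := s₁)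
    (by
      refine ⟨?_, ?_⟩
      · rw [hs₁]
        refine SortFrame.setIReg (SortFrame.setIReg (SortFrame.setIReg (SortFrame.setIReg
          (SortFrame.setIReg (SortFrame.refl s) ?_ ?_) ?_ ?_) ?_ ?_) ?_ ?_) ?_ ?_ <;> norm_num
      · simp [hs₁, ha, hw]
        exact ⟨by omega, MergeInv.start _ _ _ _⟩)
  refine Tri.seq _ 10 ?_ (main.mono le_rfl fun s' h => ?_)
  · simp only [BExpr.cost, IExpr.cost]
    omega
  · obtain ⟨⟨k, hf, h11, h15, h16, h8, hk, hm⟩, hn⟩ := h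
    simp only [BExpr.eval, IExpr.eval] at hn
    have hsum := hm.sum
    have hile := hm.i_le
    have hjle := hm.j_le
    have e13 : s'.ireg 13 = a + w := by omega
    have e14 : s'.ireg 14 = a + w + w := by omega
    have e17 : s'.ireg 17 = a + w + w := by omega
    refine Tri.of_wp_le (by simp [Prog.bound, IExpr.cost]) ?_
    simp only [wp, IExpr.eval]
    refine ⟨hf.setIReg (by norm_num) (by norm_num), ?_⟩
    simp [h11, h16, h8]
    rwa [e13, e14, e17] at hm

/-- Every block of length `w` of the first `K` cells is sorted. -/
def BlockSorted (A : ℕ → ℝ) (w K : ℕ) : Prop :=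
  ∀ q x y, q * w ≤ x → x ≤ y → y < q * w + w → y < K → A x ≤ A y

/-- Since `w + w` divides `K`, there is no incomplete pair of blocks at the end. -/
theorem mergePass_spec (s : State) (w K : ℕ) (hw : s.ireg 11 = w) (hK : s.ireg 10 = K)
    (hpos : 0 < w) (hdvd : w + w ∣ K) (hA : BlockSorted (s.rarr 8) w K) :
    Tri mergePass s (500 * (K + 1)) fun s' => SortFrame s s' ∧ s'.ireg 11 = w ∧
      BlockSorted (s'.rarr 8) (w + w) K ∧
      ∀ x, x < K → ∃ y, y < K ∧ s'.rarr 8 y = s.rarr 8 x := by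
  refine Tri.wp_seq (450 * (K + 1)) (by simp [Prog.bound, IExpr.cost]; omega) ?_
  simp only [wp, IExpr.eval]
  -- A potential of `300` for each cell not yet merged pays for a pair of blocks: since `w ≥ 1`, the
  -- cost `140 * (w + 1)` and the test fit into `300 * (w + w)`. The total is linear in `K`,
  -- whatever `w` is.
  have main := Tri.loop (p := .ilt (.reg 12) (.reg 10)) (c := mergeBlock)
    (fun φ s' => SortFrame s s' ∧ s'.ireg 11 = w ∧ s'.rarr 8 = s.rarr 8 ∧
      ∃ q, s'.ireg 12 = q * (w + w) ∧ q * (w + w) ≤ K ∧ φ = 300 * (K - q * (w + w)) ∧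
      (∀ p x y, p * (w + w) ≤ x → x ≤ y → y < p * (w + w) + (w + w) → y < q * (w + w) →
        s'.rarr 10 x ≤ s'.rarr 10 y) ∧
      ∀ x, x < q * (w + w) → ∃ y, y < q * (w + w) ∧ s'.rarr 10 y = s.rarr 8 x)
    (by
      rintro φ s' ⟨hf, h11, h8, q, h12, hq, hφ, hsort, hcov⟩ hlt
      simp only [BExpr.eval, IExpr.eval, h12, hf.ireg 10 (.inl le_rfl), hK] at hlt
      obtain ⟨r, hr⟩ := hdvd
      have hqr : q + 1 ≤ r := by
        by_contra hc
        have : r ≤ q := by omega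
        have := Nat.mul_le_mul_left (w + w) this
        rw [mul_comm (w + w) q] at this
        omega
      have hle : q * (w + w) + (w + w) ≤ K := by
        have := Nat.mul_le_mul_left (w + w) hqr
        rw [mul_add, mul_comm (w + w) q] at this
        omega
      have e1 : (2 * q) * w = q * (w + w) := by ring
      have e2 : (2 * q + 1) * w = q * (w + w) + w := by ring
      have e3 : (q + 1) * (w + w) = q * (w + w) + (w + w) := by ring
      refine ⟨_, (mergeBlock_spec s' (q * (w + w)) w h12 h11 ?_ ?_).mono le_rfl ?_⟩
      · intro x y hx hxy hy
        rw [h8]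
        exact hA (2 * q) x y (by omega) hxy (by omega) (by omega)
      · intro x y hx hxy hy
        rw [h8]
        exact hA (2 * q + 1) x y (by omega) hxy (by omega) (by omega)
      · rintro s'' ⟨hf', h11', h12', h8', hm⟩
        rw [h8] at hm
        refine ⟨300 * (K - (q + 1) * (w + w)), ⟨hf.trans hf', h11', h8'.trans h8, q + 1, by omega,
          by omega, rfl, ?_, ?_⟩, ?_⟩
        · intro p x y hx hxy hy hyq
          by_cases hyq' : y < q * (w + w)
          · rw [hm.below x (by omega), hm.below y hyq']
            exact hsort p x y hx hxy hy hyq'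
          · refine hm.sorted x y ?_ hxy (by omega)
            by_contra hxq
            have h1 : p < q := by
              by_contra hc
              have := Nat.mul_le_mul_right (w + w) (not_lt.1 hc)
              omega
            have := Nat.mul_le_mul_right (w + w) (show p + 1 ≤ q from h1)
            rw [add_mul] at this
            omega
        · intro x hx
          by_cases hxq : x < q * (w + w)
          · obtain ⟨y, hy, hy'⟩ := hcov x hxq
            exact ⟨y, by omega, by rw [hm.below y hy, hy']⟩
          · obtain ⟨y, hy, hy', hy''⟩ := hm.covers x (by omega)
            exact ⟨y, by omega, hy''⟩
        · simp only [BExpr.cost, IExpr.cost]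
          omega)
    (φ := 300 * K) (s := s.setIReg 12 0)
    ⟨(SortFrame.refl s).setIReg (by norm_num) (by norm_num), by simp [hw], rfl, 0, by simp, by simp,
      by simp, by intros; omega, by intros; omega⟩
  refine Tri.seq _ (100 * (K + 1)) ?_ (main.mono le_rfl fun s' h => ?_)
  · simp only [BExpr.cost, IExpr.cost]
    omega
  · obtain ⟨⟨φ, hf, h11, h8, q, h12, hq, hφ, hsort, hcov⟩, hn⟩ := h
    simp only [BExpr.eval, IExpr.eval, h12, hf.ireg 10 (.inl le_rfl), hK] at hn
    have hqK : q * (w + w) = K := by omega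
    rw [hqK] at hsort hcov
    refine Tri.wp_seq (90 * (K + 1)) (by simp [Prog.bound, IExpr.cost]; omega) ?_
    simp only [wp, IExpr.eval]
    have copy := Tri.loop_bounded (p := .ilt (.reg 17) (.reg 10))
      (c := .rstore 8 (.reg 17) (.get 10 (.reg 17)) ;; .iset 17 (.add (.reg 17) (.const 1))) 10
      (fun k s'' => SortFrame s s'' ∧ s''.ireg 11 = w ∧ s''.rarr 10 = s'.rarr 10 ∧
        k = K - s''.ireg 17 ∧ ∀ x, x < s''.ireg 17 → s''.rarr 8 x = s'.rarr 10 x)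
      (by
        rintro k s'' ⟨hf', h11', h10, hk, heq⟩ hlt
        simp only [BExpr.eval, IExpr.eval, hf'.ireg 10 (.inl le_rfl), hK] at hlt
        refine Tri.of_wp_le (by simp [Prog.bound, IExpr.cost, RExpr.cost]) ?_
        simp only [wp, IExpr.eval, RExpr.eval]
        refine ⟨K - (s''.ireg 17 + 1), by omega,
          (hf'.setRArr (.inl rfl)).setIReg (by norm_num) (by norm_num), ?_⟩
        simp [h11', h10]
        intro x hx
        by_cases hx' : x = s''.ireg 17
        · subst hx'; simp
        · rw [Function.update_of_ne hx']
          exact heq x (by omega))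
      (k := K) (s := s'.setIReg 17 0)
      ⟨hf.setIReg (by norm_num) (by norm_num), by simp [h11], rfl, by simp, by simp⟩
    refine copy.mono ?_ ?_
    · simp only [BExpr.cost, IExpr.cost]
      omega
    · rintro s'' ⟨⟨k, hf', h11', h10, hk, heq⟩, hn'⟩
      simp only [BExpr.eval, IExpr.eval, hf'.ireg 10 (.inl le_rfl), hK] at hn'
      refine ⟨hf', h11', ?_, ?_⟩
      · intro p x y hx hxy hy hyK
        rw [heq x (by omega), heq y (by omega)]
        exact hsort p x y hx hxy hy hyK
      · intro x hx
        obtain ⟨y, hy, hy'⟩ := hcov x hx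
        exact ⟨y, hy, by rw [heq y (by omega), hy']⟩

/-- The length of the sorted blocks doubles in each of the `κ` passes. Besides order, only the
survival of every old value is recorded: the tree needs the endpoints to be keys, not their
multiplicities. -/
theorem mergeSort_spec (s : State) (κ : ℕ) (hK : s.ireg 10 = 2 ^ κ) :
    Tri mergeSort s (1500 * (2 ^ κ * (κ + 1))) fun s' => SortFrame s s' ∧
      (∀ x y, x ≤ y → y < 2 ^ κ → s'.rarr 8 x ≤ s'.rarr 8 y) ∧
      ∀ x, x < 2 ^ κ → ∃ y, y < 2 ^ κ ∧ s'.rarr 8 y = s.rarr 8 x := by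
  have hpos : 0 < 2 ^ κ := by positivity
  refine Tri.wp_seq (1100 * (2 ^ κ * (κ + 1))) ?_ ?_
  · simp only [Prog.bound, IExpr.cost]
    nlinarith
  simp only [wp, IExpr.eval]
  have main := Tri.loop_bounded (p := .ilt (.reg 11) (.reg 10))
    (c := mergePass ;; .iset 11 (.add (.reg 11) (.reg 11))) (500 * (2 ^ κ + 1) + 4)
    (fun k s' => SortFrame s s' ∧ k ≤ κ ∧ s'.ireg 11 = 2 ^ (κ - k) ∧
      BlockSorted (s'.rarr 8) (2 ^ (κ - k)) (2 ^ κ) ∧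
      ∀ x, x < 2 ^ κ → ∃ y, y < 2 ^ κ ∧ s'.rarr 8 y = s.rarr 8 x)
    (by
      rintro k s' ⟨hf, hk, h11, hs, hc⟩ hlt
      simp only [BExpr.eval, IExpr.eval, hf.ireg 10 (.inl le_rfl), hK, h11] at hlt
      have hk0 : k ≠ 0 := by
        rintro rfl
        simp at hlt
      have e : 2 ^ (κ - (k - 1)) = 2 ^ (κ - k) + 2 ^ (κ - k) := by
        rw [show κ - (k - 1) = κ - k + 1 by omega, pow_succ]
        ring
      refine Tri.seq _ 4 le_rfl ((mergePass_spec s' (2 ^ (κ - k)) (2 ^ κ) h11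
        ((hf.ireg 10 (.inl le_rfl)).trans hK) (by positivity)
        (e ▸ pow_dvd_pow 2 (Nat.sub_le _ _)) hs).mono le_rfl ?_)
      rintro s'' ⟨hf', h11', hs', hc'⟩
      refine Tri.of_wp_le (by simp [Prog.bound, IExpr.cost]) ?_
      simp only [wp, IExpr.eval]
      refine ⟨k - 1, by omega, (hf.trans hf').setIReg (by norm_num) (by norm_num), by omega, ?_⟩
      simp [h11', e]
      refine ⟨hs', fun x hx => ?_⟩
      obtain ⟨y, hy, hy'⟩ := hc x hx
      obtain ⟨z, hz, hz'⟩ := hc' y hy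
      exact ⟨z, hz, hz'.trans hy'⟩)
    (k := κ) (s := s.setIReg 11 1)
    ⟨(SortFrame.refl s).setIReg (by norm_num) (by norm_num), le_rfl, by simp, by
      intro q x y hx hxy hy _
      simp at hx hy
      obtain rfl : x = y := by omega
      exact le_rfl, fun x hx => ⟨x, hx, rfl⟩⟩
  refine main.mono ?_ ?_
  · simp only [BExpr.cost, IExpr.cost]
    nlinarith
  · rintro s' ⟨⟨k, hf, hk, h11, hs, hc⟩, hn⟩
    simp only [BExpr.eval, IExpr.eval, hf.ireg 10 (.inl le_rfl), hK, h11] at hn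
    have hle : 2 ^ κ ≤ 2 ^ (κ - k) := not_lt.1 hn
    exact ⟨hf, fun x y hxy hy => hs 0 x y (by simp) hxy (by omega) hy, hc⟩

/-! ### Uncrossed pieces and the segment tree with one piece per node. -/

/-- The height at abscissa `x` of the line that supports piece `j`. -/
def height (R : ℕ → ℕ → ℝ) (j : ℕ) (x : ℝ) : ℝ := R 6 j * x + R 7 j

/-- The abscissa `x` belongs to the projection of piece `j`. -/
def Spans (R : ℕ → ℕ → ℝ) (j : ℕ) (x : ℝ) : Prop := R 4 j ≤ x ∧ x ≤ R 5 j

/-- No two of the pieces `1, …, m` cross. -/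
def Uncrossed (R : ℕ → ℕ → ℝ) (m : ℕ) : Prop :=
  ∀ i j, 1 ≤ i → i ≤ m → 1 ≤ j → j ≤ m → i ≠ j → ∀ x, R 4 i < x → x < R 5 i → R 4 j < x →
    x < R 5 j → height R i x ≠ height R j x

/-- If a piece is not above another one in the middle of their common projection, then it is
nowhere above it. -/
theorem Uncrossed.height_le {R : ℕ → ℕ → ℝ} {m : ℕ} (h : Uncrossed R m) {i j : ℕ} (hi : 1 ≤ i)
    (hi' : i ≤ m) (hj : 1 ≤ j) (hj' : j ≤ m) {M : ℝ}
    (hM : M = max (R 4 i) (R 4 j) + min (R 5 i) (R 5 j))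
    (hle : R 6 i * M + (R 7 i + R 7 i) ≤ R 6 j * M + (R 7 j + R 7 j)) {x : ℝ}
    (hxi : Spans R i x) (hxj : Spans R j x) : height R i x ≤ height R j x := by
  by_cases hij : i = j
  · rw [hij]
  by_contra hlt
  rw [not_le] at hlt
  set a := max (R 4 i) (R 4 j)
  set b := min (R 5 i) (R 5 j)
  have hax : a ≤ x := max_le hxi.1 hxj.1
  have hxb : x ≤ b := le_min hxi.2 hxj.2
  unfold height at hlt
  set p := R 6 j - R 6 i with hp
  set q := R 7 j - R 7 i with hq
  -- `M` is twice the midpoint of the common projection, which avoids a division. The affine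
  -- difference `p * z + q` is nonnegative at `M / 2` and negative at `x`, so its zero lies between
  -- them, possibly at `M / 2` but not at `x`. In either case it is interior to the common
  -- projection.
  have h1 : 0 ≤ p * M + 2 * q := by rw [hp, hq]; linarith
  have h2 : p * x + q < 0 := by rw [hp, hq]; linarith
  have hp0 : p ≠ 0 := by
    intro h0
    rw [h0] at h1 h2
    linarith
  -- the crossing point
  have key : a < -q / p ∧ -q / p < b := by
    rcases lt_or_gt_of_ne hp0 with hneg | hpos
    · have e1 : M / 2 ≤ x := by nlinarith
      have hz1 : -q / p < x := by rw [div_lt_iff_of_neg hneg]; linarith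
      have hz2 : M / 2 ≤ -q / p := by rw [le_div_iff_of_neg hneg]; linarith
      have : M / 2 < x := hz2.trans_lt hz1
      constructor <;> linarith
    · have hz1 : x < -q / p := by rw [lt_div_iff₀ hpos]; linarith
      have hz2 : -q / p ≤ M / 2 := by rw [div_le_iff₀ hpos]; linarith
      constructor <;> linarith
  have e : p * (-q / p) = -q := by field_simp
  refine h i j hi hi' hj hj' hij (-q / p) ((le_max_left _ _).trans_lt key.1)
    (key.2.trans_le (min_le_left _ _)) ((le_max_right _ _).trans_lt key.1)
    (key.2.trans_le (min_le_right _ _)) ?_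
  unfold height
  have e2 : (R 6 j - R 6 i) * (-q / p) = -q := e
  linarith

/-- The node of the tree at height `k` over the leaf of `x`; the leaves start at node `N`. -/
noncomputable def node (R : ℕ → ℕ → ℝ) (K N : ℕ) (x : ℝ) (k : ℕ) : ℕ :=
  (leaf (R 8) K x + N) / 2 ^ k

theorem node_succ (R : ℕ → ℕ → ℝ) (K N : ℕ) (x : ℝ) (k : ℕ) :
    node R K N x (k + 1) = node R K N x k / 2 := by
  rw [node, node, pow_succ, Nat.div_div_eq_div_mul]

theorem node_zero (R : ℕ → ℕ → ℝ) (K N : ℕ) (x : ℝ) : node R K N x 0 = leaf (R 8) K x + N := by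
  simp [node]

/-- All abscissae below node `v` belong to the projection of piece `i`. -/
def Fills (R : ℕ → ℕ → ℝ) (K N i v : ℕ) : Prop := ∀ x k, node R K N x k = v → Spans R i x

/-- The tree contains only pieces below `b`, and every piece spans the nodes where it is stored. -/
def TreeValid (R : ℕ → ℕ → ℝ) (K N : ℕ) (T : ℕ → ℕ) (b : ℕ) : Prop :=
  ∀ v, T v ≠ 0 → T v < b ∧ Fills R K N (T v) v

/-- Some piece stored on the path from the leaf of `x` to the root has height at least `y`. -/
def Sees (R : ℕ → ℕ → ℝ) (K N : ℕ) (T : ℕ → ℕ) (x y : ℝ) : Prop :=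
  ∃ k, T (node R K N x k) ≠ 0 ∧ y ≤ height R (T (node R K N x k)) x

/-- Offering piece `i` to node `v` turns the tree `T` into `T'`. -/
def Offer (R : ℕ → ℕ → ℝ) (i v : ℕ) (T T' : ℕ → ℕ) : Prop :=
  (T' = Function.update T v i ∧
    (T v ≠ 0 → ∀ x, Spans R i x → Spans R (T v) x → height R (T v) x ≤ height R i x)) ∨
  (T' = T ∧ T v ≠ 0 ∧ ∀ x, Spans R i x → Spans R (T v) x → height R i x ≤ height R (T v) x)

section Offer

variable {R : ℕ → ℕ → ℝ} {K N i v b : ℕ} {T T' : ℕ → ℕ}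

theorem Offer.valid (h : Offer R i v T T') (hT : TreeValid R K N T b) (hib : i < b)
    (hv : Fills R K N i v) : TreeValid R K N T' b := by
  rcases h with ⟨rfl, -⟩ | ⟨rfl, -⟩
  · intro u hu
    by_cases huv : u = v
    · subst huv
      simpa using ⟨hib, hv⟩
    · rw [Function.update_of_ne huv] at hu ⊢
      exact hT u hu
  · exact hT

/-- A piece is displaced only by one that is at least as high over every abscissa below the node,
since both span the node. So no query loses a positive answer. -/
theorem Offer.sees (h : Offer R i v T T') (hT : TreeValid R K N T b) (hi : i ≠ 0)
    (hv : Fills R K N i v) {x y : ℝ} (hs : Sees R K N T x y) : Sees R K N T' x y := by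
  rcases h with ⟨rfl, h⟩ | ⟨rfl, -⟩
  · obtain ⟨k, hk, hy⟩ := hs
    by_cases hkv : node R K N x k = v
    · refine ⟨k, by simpa [hkv] using hi, hy.trans ?_⟩
      rw [hkv] at hk ⊢
      rw [Function.update_self]
      exact h hk x (hv x k hkv) ((hT v hk).2 x k hkv)
    · exact ⟨k, by rwa [Function.update_of_ne hkv], by rwa [Function.update_of_ne hkv]⟩
  · exact hs

/-- Even a rejected piece is accounted for: the piece that stays is at least as high over all
abscissae of the node. -/
theorem Offer.sees_self (h : Offer R i v T T') (hT : TreeValid R K N T b) (hi : i ≠ 0)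
    (hv : Fills R K N i v) {x : ℝ} {k : ℕ} (hk : node R K N x k = v) :
    Sees R K N T' x (height R i x) := by
  refine ⟨k, ?_⟩
  rw [hk]
  rcases h with ⟨rfl, h⟩ | ⟨rfl, h0, h⟩
  · simpa using hi
  · exact ⟨h0, h x (hv x k hk) ((hT v h0).2 x k hk)⟩

end Offer

/-- The state of the insertion of piece `i` into the tree `T₀`: the nodes `[l, r)` at height `k` are
still to be treated. -/
structure InsertInv (R : ℕ → ℕ → ℝ) (K N i : ℕ) (T₀ T : ℕ → ℕ) (k l r : ℕ) : Prop where
  valid : TreeValid R K N T (i + 1)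
  mono : ∀ x y, Sees R K N T₀ x y → Sees R K N T x y
  covers : ∀ x, Spans R i x →
    (l ≤ node R K N x k ∧ node R K N x k < r) ∨ Sees R K N T x (height R i x)
  fills : ∀ v, l ≤ v → v < r → Fills R K N i v
  pos : 1 ≤ l
  le : r ≤ 2 * N

/-- The endpoints of the piece are keys, so `leaf_le_iff` turns its projection into exactly the
leaves between those of its endpoints. -/
theorem InsertInv.start {R : ℕ → ℕ → ℝ} {K N i : ℕ} {T : ℕ → ℕ} (hT : TreeValid R K N T i)
    (hlo : ∃ j, j < K ∧ R 8 j = R 4 i) (hhi : ∃ j, j < K ∧ R 8 j = R 5 i) (hN : 2 * K < N) :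
    InsertInv R K N i T T 0 (leaf (R 8) K (R 4 i) + N) (leaf (R 8) K (R 5 i) + N + 1) where
  valid v hv := ⟨(hT v hv).1.trans (Nat.lt_succ_self i), (hT v hv).2⟩
  mono _ _ h := h
  covers x hx := by
    left
    have h1 := leaf_mono (R 8) K hx.1
    have h2 := leaf_mono (R 8) K hx.2
    rw [node_zero]
    omega
  fills v hl hr x k hk := by
    have hle := leaf_le (R 8) K x
    cases k with
    | zero =>
      rw [node_zero] at hk
      exact ⟨(leaf_le_iff (.inl hlo)).1 (by omega), (leaf_le_iff (.inr hhi)).1 (by omega)⟩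
    -- Inner nodes have numbers below `N` because `2 * K < N`, so none of them is mistaken for a
    -- leaf.
    | succ k =>
      have h1 : node R K N x (k + 1) ≤ (leaf (R 8) K x + N) / 2 := by
        rw [node_succ]
        exact Nat.div_le_div_right (Nat.div_le_self _ _)
      omega
  pos := by omega
  le := by
    have := leaf_le (R 8) K (R 5 i)
    omega

theorem InsertInv.offer_left {R : ℕ → ℕ → ℝ} {K N i k l r : ℕ} {T₀ T T' : ℕ → ℕ}
    (h : InsertInv R K N i T₀ T k l r) (hi : i ≠ 0) (hlr : l < r) (ho : Offer R i l T T') :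
    InsertInv R K N i T₀ T' k (l + 1) r where
  valid := ho.valid h.valid (Nat.lt_succ_self i) (h.fills l le_rfl hlr)
  mono x y hs := ho.sees h.valid hi (h.fills l le_rfl hlr) (h.mono x y hs)
  covers x hx := by
    rcases h.covers x hx with ⟨h1, h2⟩ | h1
    · by_cases he : node R K N x k = l
      · exact .inr (ho.sees_self h.valid hi (h.fills l le_rfl hlr) he)
      · exact .inl ⟨by omega, h2⟩
    · exact .inr (ho.sees h.valid hi (h.fills l le_rfl hlr) h1)
  fills v hl hr := h.fills v (by omega) hr
  pos := by omega
  le := h.le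

theorem InsertInv.offer_right {R : ℕ → ℕ → ℝ} {K N i k l r : ℕ} {T₀ T T' : ℕ → ℕ}
    (h : InsertInv R K N i T₀ T k l r) (hi : i ≠ 0) (hlr : l < r) (ho : Offer R i (r - 1) T T') :
    InsertInv R K N i T₀ T' k l (r - 1) where
  valid := ho.valid h.valid (Nat.lt_succ_self i) (h.fills _ (by omega) (by omega))
  mono x y hs := ho.sees h.valid hi (h.fills _ (by omega) (by omega)) (h.mono x y hs)
  covers x hx := by
    rcases h.covers x hx with ⟨h1, h2⟩ | h1
    · by_cases he : node R K N x k = r - 1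
      · exact .inr (ho.sees_self h.valid hi (h.fills _ (by omega) (by omega)) he)
      · exact .inl ⟨h1, by omega⟩
    · exact .inr (ho.sees h.valid hi (h.fills _ (by omega) (by omega)) h1)
  fills v hl hr := h.fills v hl (by omega)
  pos := h.pos
  le := by have := h.le; omega

/-- With both ends even, the range consists of complete pairs of siblings, so their parents cover
the same abscissae. The bound `r ≤ 2 * N` puts the parents below `N`, away from the leaves. -/
theorem InsertInv.up {R : ℕ → ℕ → ℝ} {K N i k l r : ℕ} {T₀ T : ℕ → ℕ}
    (h : InsertInv R K N i T₀ T k l r) (hl : l / 2 + l / 2 = l) (hr : r / 2 + r / 2 = r) :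
    InsertInv R K N i T₀ T (k + 1) (l / 2) (r / 2) where
  valid := h.valid
  mono := h.mono
  covers x hx := by
    refine (h.covers x hx).imp_left fun ⟨h1, h2⟩ => ?_
    rw [node_succ]
    omega
  fills v h1 h2 x k' hk := by
    have := h.le
    cases k' with
    | zero =>
      rw [node_zero] at hk
      omega
    | succ k' =>
      rw [node_succ] at hk
      exact h.fills _ (by omega) (by omega) x k' rfl
  pos := by have := h.pos; omega
  le := by have := h.le; omega

/-! ### The program that builds the tree. -/

/-- Two states that differ only in array `0` of the integers and in the registers used while the
tree is built. -/
structure BuildFrame (s s' : State) : Prop where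
  rarr : s'.rarr = s.rarr
  iarr : ∀ b, b ≠ 0 → s'.iarr b = s.iarr b
  ireg : ∀ x, 6 ≤ x → x < 24 → x ≠ 22 → s'.ireg x = s.ireg x

theorem BuildFrame.refl (s : State) : BuildFrame s s := ⟨rfl, fun _ _ => rfl, fun _ _ _ _ => rfl⟩

theorem BuildFrame.trans {s s' s'' : State} (h : BuildFrame s s') (h' : BuildFrame s' s'') :
    BuildFrame s s'' where
  rarr := h'.rarr.trans h.rarr
  iarr b hb := (h'.iarr b hb).trans (h.iarr b hb)
  ireg x h1 h2 h3 := (h'.ireg x h1 h2 h3).trans (h.ireg x h1 h2 h3)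

theorem BuildFrame.setIReg {s s' : State} (h : BuildFrame s s') {x v : ℕ}
    (hx : x < 6 ∨ x = 22 ∨ 24 ≤ x) : BuildFrame s (s'.setIReg x v) where
  rarr := h.rarr
  iarr := h.iarr
  ireg y h1 h2 h3 := by
    have : y ≠ x := by omega
    simp [this, h.ireg y h1 h2 h3]

theorem BuildFrame.setRReg {s s' : State} (h : BuildFrame s s') {x : ℕ} {v : ℝ} :
    BuildFrame s (s'.setRReg x v) := ⟨h.rarr, h.iarr, h.ireg⟩

theorem BuildFrame.setIArr {s s' : State} (h : BuildFrame s s') {i v : ℕ} :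
    BuildFrame s (s'.setIArr 0 i v) where
  rarr := h.rarr
  iarr b hb := by simp [hb, h.iarr b hb]
  ireg := h.ireg

theorem SameAbove.buildFrame {s s' : State} (h : SameAbove 6 s s') : BuildFrame s s' where
  rarr := h.rarr
  iarr b _ := by rw [h.iarr]
  ireg x hx _ _ := h.ireg x hx

/-- Offers the piece in register `22` to the node in register `26`. -/
def offerProg : Prog :=
  .iset 27 (.get 0 (.reg 26)) ;;
  .cond (.ieq (.reg 27) (.const 0)) (.istore 0 (.reg 26) (.reg 22))
    (.cond (.rlt (.get 4 (.reg 22)) (.get 4 (.reg 27))) (.rset 21 (.get 4 (.reg 27)))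
        (.rset 21 (.get 4 (.reg 22))) ;;
      .cond (.rlt (.get 5 (.reg 22)) (.get 5 (.reg 27))) (.rset 22 (.get 5 (.reg 22)))
        (.rset 22 (.get 5 (.reg 27))) ;;
      .rset 21 (.add (.reg 21) (.reg 22)) ;;
      .cond (.rlt (.add (.mul (.get 6 (.reg 27)) (.reg 21)) (.add (.get 7 (.reg 27)) (.get 7 (.reg 27))))
          (.add (.mul (.get 6 (.reg 22)) (.reg 21)) (.add (.get 7 (.reg 22)) (.get 7 (.reg 22)))))
        (.istore 0 (.reg 26) (.reg 22)) .skip)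

/-- One comparison at the midpoint of the common projection decides the order of two uncrossed
pieces wherever both are defined. -/
theorem offerProg_spec (s : State) {i v m : ℕ} (hR : Uncrossed s.rarr m) (hi : 1 ≤ i) (him : i ≤ m)
    (h22 : s.ireg 22 = i) (h26 : s.ireg 26 = v) (hv : s.iarr 0 v ≤ m) :
    Tri offerProg s 120 fun s' => BuildFrame s s' ∧ s'.ireg 22 = i ∧ s'.ireg 24 = s.ireg 24 ∧
      s'.ireg 25 = s.ireg 25 ∧ Offer s.rarr i v (s.iarr 0) (s'.iarr 0) := by
  refine Tri.of_wp_le (by simp [Prog.bound, offerProg, BExpr.cost, IExpr.cost, RExpr.cost]) ?_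
  simp only [wp, offerProg, IExpr.eval, RExpr.eval, BExpr.eval]
  have hf := (BuildFrame.refl s).setIReg (x := 27) (v := s.iarr 0 (s.ireg 26)) (by norm_num)
  simp [h22, h26]
  refine ⟨fun h0 => ⟨(h26 ▸ hf).setIArr, .inl ⟨rfl, fun h => absurd h0 h⟩⟩, fun h0 => ?_⟩
  have hj : 1 ≤ s.iarr 0 v := Nat.one_le_iff_ne_zero.2 h0
  -- The four outcomes of the two endpoint comparisons differ only in how the maximum and the
  -- minimum in `M` are obtained.
  have final : ∀ M, M = max (s.rarr 4 i) (s.rarr 4 (s.iarr 0 v)) +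
      min (s.rarr 5 i) (s.rarr 5 (s.iarr 0 v)) → ∀ s₁, BuildFrame s s₁ →
      (s.rarr 6 (s.iarr 0 v) * M + (s.rarr 7 (s.iarr 0 v) + s.rarr 7 (s.iarr 0 v)) <
        s.rarr 6 i * M + (s.rarr 7 i + s.rarr 7 i) →
        BuildFrame s (s₁.setIArr 0 v i) ∧
          Offer s.rarr i v (s.iarr 0) (Function.update (s.iarr 0) v i)) ∧
      (s.rarr 6 i * M + (s.rarr 7 i + s.rarr 7 i) ≤
        s.rarr 6 (s.iarr 0 v) * M + (s.rarr 7 (s.iarr 0 v) + s.rarr 7 (s.iarr 0 v)) →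
        BuildFrame s s₁ ∧ Offer s.rarr i v (s.iarr 0) (s.iarr 0)) := by
    intro M hM s₁ hs₁
    refine ⟨fun hlt => ⟨hs₁.setIArr, .inl ⟨rfl, fun _ x h1 h2 => ?_⟩⟩,
      fun hle => ⟨hs₁, .inr ⟨rfl, h0, fun x h1 h2 => ?_⟩⟩⟩
    · exact hR.height_le hj hv hi him (by rw [max_comm, min_comm]; exact hM) hlt.le h2 h1
    · exact hR.height_le hi him hj hv hM hle h1 h2
  rw [h26] at hf
  refine ⟨fun h4 => ⟨fun h5 => ?_, fun h5 => ?_⟩, fun h4 => ⟨fun h5 => ?_, fun h5 => ?_⟩⟩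
  · exact final _ (by rw [max_eq_right h4.le, min_eq_left h5.le]) _ hf.setRReg.setRReg.setRReg
  · exact final _ (by rw [max_eq_right h4.le, min_eq_right h5]) _ hf.setRReg.setRReg.setRReg
  · exact final _ (by rw [max_eq_left h4, min_eq_left h5.le]) _ hf.setRReg.setRReg.setRReg
  · exact final _ (by rw [max_eq_left h4, min_eq_right h5]) _ hf.setRReg.setRReg.setRReg

/-- Treats one level of the tree during the insertion of the piece in register `22` into the nodes
from register `24` to register `25`. -/
def levelProg : Prog :=
  .cond (.ieq (.add (.half (.reg 24)) (.half (.reg 24))) (.reg 24)) .skip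
    (.iset 26 (.reg 24) ;; offerProg ;; .iset 24 (.add (.reg 24) (.const 1))) ;;
  .cond (.ieq (.add (.half (.reg 25)) (.half (.reg 25))) (.reg 25)) .skip
    (.iset 25 (.sub (.reg 25) (.const 1)) ;; .iset 26 (.reg 25) ;; offerProg) ;;
  .iset 24 (.half (.reg 24)) ;; .iset 25 (.half (.reg 25))

theorem InsertInv.le_of_valid {R : ℕ → ℕ → ℝ} {K N i k l r m : ℕ} {T₀ T : ℕ → ℕ}
    (h : InsertInv R K N i T₀ T k l r) (him : i ≤ m) (v : ℕ) : T v ≤ m := by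
  by_cases h0 : T v = 0
  · omega
  · have := (h.valid v h0).1
    omega

/-- An odd left end is a right child and an odd right end leaves a left child without its sibling.
These at most two nodes receive the piece now, and the rest of the range passes to the parents. -/
theorem levelProg_spec (s : State) {K N i k m : ℕ} {T₀ : ℕ → ℕ} (hR : Uncrossed s.rarr m)
    (hi : 1 ≤ i) (him : i ≤ m) (h22 : s.ireg 22 = i) (hlt : s.ireg 24 < s.ireg 25)
    (h : InsertInv s.rarr K N i T₀ (s.iarr 0) k (s.ireg 24) (s.ireg 25)) :
    Tri levelProg s 400 fun s' => BuildFrame s s' ∧ s'.ireg 22 = i ∧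
      s'.ireg 25 ≤ s.ireg 25 / 2 ∧
      InsertInv s.rarr K N i T₀ (s'.iarr 0) (k + 1) (s'.ireg 24) (s'.ireg 25) := by
  have hi0 : i ≠ 0 := by omega
  refine Tri.seq 180 220 le_rfl (Tri.mono (T := 180) (Q := fun s' => BuildFrame s s' ∧
    s'.ireg 22 = i ∧ s'.ireg 25 = s.ireg 25 ∧ s'.ireg 24 / 2 + s'.ireg 24 / 2 = s'.ireg 24 ∧
    s'.ireg 24 ≤ s'.ireg 25 ∧
    InsertInv s.rarr K N i T₀ (s'.iarr 0) k (s'.ireg 24) (s'.ireg 25)) ?_ le_rfl ?_)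
  · refine (Tri.cond (T := 150) (fun hp => Tri.of_wp_le (by simp [Prog.bound]) ?_)
      (fun hp => ?_)).mono (by simp [BExpr.cost, IExpr.cost]) fun _ h => h
    · exact ⟨BuildFrame.refl s, h22, rfl, hp, hlt.le, h⟩
    · simp only [BExpr.eval, IExpr.eval] at hp
      refine Tri.wp_seq 130 (by simp [Prog.bound, IExpr.cost]) ?_
      simp only [wp, IExpr.eval]
      have ho := offerProg_spec (s.setIReg 26 (s.ireg 24)) (i := i) (v := s.ireg 24) hR hi him
        (by simp [h22]) (by simp) (h.le_of_valid him _)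
      refine Tri.seq _ 10 (by norm_num) (ho.mono le_rfl ?_)
      rintro s' ⟨hf, e22, e24, e25, ho⟩
      refine Tri.of_wp_le (by simp [Prog.bound, IExpr.cost]) ?_
      simp at e24 e25 ho
      simp only [wp, IExpr.eval]
      refine ⟨(((BuildFrame.refl s).setIReg (by norm_num)).trans hf).setIReg (by norm_num), ?_⟩
      simp [e22, e24, e25]
      exact ⟨by omega, by omega, h.offer_left hi0 hlt ho⟩
  · rintro s₁ ⟨hf₁, h22₁, h25₁, heven, hle₁, hI₁⟩
    refine Tri.seq 180 30 (by norm_num) (Tri.mono (T := 180) (Q := fun s' => BuildFrame s s' ∧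
      s'.ireg 22 = i ∧ s'.ireg 25 ≤ s.ireg 25 ∧ s'.ireg 24 / 2 + s'.ireg 24 / 2 = s'.ireg 24 ∧
      s'.ireg 25 / 2 + s'.ireg 25 / 2 = s'.ireg 25 ∧
      InsertInv s.rarr K N i T₀ (s'.iarr 0) k (s'.ireg 24) (s'.ireg 25)) ?_ le_rfl ?_)
    · refine (Tri.cond (T := 150) (fun hp => Tri.of_wp_le (by simp [Prog.bound]) ?_)
        (fun hp => ?_)).mono (by simp [BExpr.cost, IExpr.cost]) fun _ h => h
      · exact ⟨hf₁, h22₁, h25₁.le, heven, hp, hI₁⟩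
      · simp only [BExpr.eval, IExpr.eval] at hp
        refine Tri.wp_seq 145 (by simp [Prog.bound, IExpr.cost]) ?_
        refine Tri.wp_seq 130 (by simp [Prog.bound, IExpr.cost]) ?_
        simp only [wp, IExpr.eval]
        set s₂ := (s₁.setIReg 25 (s₁.ireg 25 - 1)).setIReg 26
          ((s₁.setIReg 25 (s₁.ireg 25 - 1)).ireg 25) with hs₂
        have hf₂ : BuildFrame s s₂ := (hf₁.setIReg (by norm_num)).setIReg (by norm_num)
        have ho := offerProg_spec s₂ (i := i) (v := s₁.ireg 25 - 1)
          (by rw [hf₂.rarr]; exact hR) hi him (by simp [hs₂, h22₁]) (by simp [hs₂])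
          (hI₁.le_of_valid him _)
        refine ho.mono (by norm_num) ?_
        rintro s' ⟨hf, e22, e24, e25, ho⟩
        rw [hf₂.rarr] at ho
        have e24' : s'.ireg 24 = s₁.ireg 24 := by rw [e24]; simp [hs₂]
        have e25' : s'.ireg 25 = s₁.ireg 25 - 1 := by rw [e25]; simp [hs₂]
        refine ⟨hf₂.trans hf, e22, by omega, by rw [e24']; exact heven, by omega, ?_⟩
        rw [e24', e25']
        -- The left end is even, the right end is odd and `l ≤ r`; hence `l < r`, and node `r - 1`
        -- is still pending.
        exact hI₁.offer_right hi0 (by omega) ho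
    · rintro s₂ ⟨hf₂, h22₂, h25₂, heven₂, heven₂', hI₂⟩
      refine Tri.of_wp_le (by simp [Prog.bound, IExpr.cost]) ?_
      simp only [wp, IExpr.eval]
      refine ⟨(hf₂.setIReg (by norm_num)).setIReg (by norm_num), ?_⟩
      simp [h22₂]
      exact ⟨by omega, hI₂.up heven₂ heven₂'⟩

/-- Inserts the piece in register `22` into the tree. -/
def insertProg : Prog :=
  .cond (.rlt (.get 5 (.reg 22)) (.get 4 (.reg 22))) .skip
    (.rset 20 (.get 4 (.reg 22)) ;; leafProg ;; .iset 24 (.add (.reg 5) (.reg 23)) ;;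
      .rset 20 (.get 5 (.reg 22)) ;; leafProg ;;
      .iset 25 (.add (.add (.reg 5) (.reg 23)) (.const 1)) ;;
      .loop (.ilt (.reg 24) (.reg 25)) levelProg) ;;
  .iset 22 (.add (.reg 22) (.const 1))

/-- The tree contains the pieces below `b`. -/
structure TreeOf (R : ℕ → ℕ → ℝ) (K N : ℕ) (T : ℕ → ℕ) (b : ℕ) : Prop where
  valid : TreeValid R K N T b
  sees : ∀ j, 1 ≤ j → j < b → ∀ x, Spans R j x → Sees R K N T x (height R j x)

/-- Soundness comes from `valid`, as a stored piece spans its node. Completeness comes from `sees`,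
as every piece is matched by one at least as high on the path. -/
theorem TreeOf.sees_iff {R : ℕ → ℕ → ℝ} {K N b : ℕ} {T : ℕ → ℕ} (h : TreeOf R K N T b) (x y : ℝ) :
    Sees R K N T x y ↔ ∃ j, 1 ≤ j ∧ j < b ∧ Spans R j x ∧ y ≤ height R j x := by
  constructor
  · rintro ⟨k, hk, hy⟩
    exact ⟨_, Nat.one_le_iff_ne_zero.2 hk, (h.valid _ hk).1, (h.valid _ hk).2 x k rfl, hy⟩
  · rintro ⟨j, h1, h2, h3, h4⟩
    obtain ⟨k, hk, hy⟩ := h.sees j h1 h2 x h3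
    exact ⟨k, hk, h4.trans hy⟩

/-- When the pending range is empty, `covers` leaves only the alternative that the new piece is
accounted for. Earlier pieces stay accounted for by `mono`. An empty piece spans nothing and may be
skipped. -/
theorem insertProg_spec (s : State) {κ N i m : ℕ} (hR : Uncrossed s.rarr m)
    (h10 : s.ireg 10 = 2 ^ κ) (h23 : s.ireg 23 = N) (hN : N = 2 ^ (κ + 2))
    (hA : ∀ i j, i ≤ j → j < 2 ^ κ → s.rarr 8 i ≤ s.rarr 8 j)
    (hkey : ∀ j, 1 ≤ j → j ≤ m → (∃ x, x < 2 ^ κ ∧ s.rarr 8 x = s.rarr 4 j) ∧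
      ∃ x, x < 2 ^ κ ∧ s.rarr 8 x = s.rarr 5 j)
    (h22 : s.ireg 22 = i) (hi : 1 ≤ i) (him : i ≤ m)
    (h : TreeOf s.rarr (2 ^ κ) N (s.iarr 0) i) :
    Tri insertProg s (2000 * (κ + 2)) fun s' => BuildFrame s s' ∧ s'.ireg 22 = i + 1 ∧
      TreeOf s.rarr (2 ^ κ) N (s'.iarr 0) (i + 1) := by
  have hpos : 0 < 2 ^ κ := by positivity
  have hN' : N = 4 * 2 ^ κ := by rw [hN, pow_add]; ring
  refine Tri.seq (1990 * (κ + 2)) 4 (by omega) ?_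
  refine Tri.mono (T := 1990 * (κ + 2)) (Q := fun s' => BuildFrame s s' ∧ s'.ireg 22 = i ∧
      TreeOf s.rarr (2 ^ κ) N (s'.iarr 0) (i + 1)) ?_ le_rfl ?_
  · refine (Tri.cond (T := 1980 * (κ + 2)) (fun hp => Tri.of_wp_le (by simp [Prog.bound]; omega) ?_)
      (fun hp => ?_)).mono (by simp [BExpr.cost, IExpr.cost, RExpr.cost]; omega) fun _ h => h
    · simp only [BExpr.eval, IExpr.eval, RExpr.eval, h22] at hp
      refine ⟨BuildFrame.refl s, h22,
        fun v hv => ⟨(h.valid v hv).1.trans (Nat.lt_succ_self i), (h.valid v hv).2⟩, ?_⟩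
      intro j h1 h2 x hx
      rcases Nat.lt_succ_iff_lt_or_eq.1 h2 with h3 | rfl
      · exact h.sees j h1 h3 x hx
      · exact absurd (hx.1.trans hx.2) (not_le.2 hp)
    · refine Tri.wp_seq (1900 * (κ + 2)) (by simp [Prog.bound, IExpr.cost, RExpr.cost]; omega) ?_
      simp only [wp, IExpr.eval, RExpr.eval, h22]
      have l1 := leafProg_spec (s.setRReg 20 (s.rarr 4 i)) κ h10.le (by simpa [h10] using hA)
      refine Tri.seq _ (1800 * (κ + 2)) (by omega) (l1.mono le_rfl ?_)
      rintro s₁ ⟨hf₁, e₁⟩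
      simp [h10] at e₁
      have hf₁' : BuildFrame s s₁ := (BuildFrame.refl s).setRReg.trans hf₁.buildFrame
      refine Tri.wp_seq (1780 * (κ + 2)) (by simp [Prog.bound, IExpr.cost]; omega) ?_
      refine Tri.wp_seq (1760 * (κ + 2)) (by simp [Prog.bound, IExpr.cost, RExpr.cost]; omega) ?_
      simp only [wp, IExpr.eval, RExpr.eval]
      have g22 : s₁.ireg 22 = i := by rw [hf₁.ireg 22 (by norm_num)]; exact h22
      have g23 : s₁.ireg 23 = N := by rw [hf₁.ireg 23 (by norm_num)]; exact h23
      have g10 : s₁.ireg 10 = 2 ^ κ := by rw [hf₁.ireg 10 (by norm_num)]; exact h10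
      have gr : s₁.rarr = s.rarr := hf₁.rarr
      set s₂ := (s₁.setIReg 24 (s₁.ireg 5 + s₁.ireg 23)).setRReg 20 _ with hs₂
      have q10 : s₂.ireg 10 = 2 ^ κ := by simp [hs₂, g10]
      have qr : s₂.rarr = s.rarr := by simp [hs₂, gr]
      have l2 := leafProg_spec s₂ κ q10.le (by rw [q10, qr]; exact hA)
      refine Tri.seq _ (1600 * (κ + 2)) (by omega) (l2.mono le_rfl ?_)
      rintro s₃ ⟨hf₃, e₃⟩
      simp [qr, q10] at e₃
      refine Tri.wp_seq (1500 * (κ + 2)) (by simp [Prog.bound, IExpr.cost]; omega) ?_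
      simp only [wp, IExpr.eval]
      set s₄ := s₃.setIReg 25 (s₃.ireg 5 + s₃.ireg 23 + 1) with hs₄
      have hf₄ : BuildFrame s s₄ := by
        refine BuildFrame.setIReg (BuildFrame.trans ?_ hf₃.buildFrame) (by norm_num)
        exact (hf₁'.setIReg (by norm_num)).setRReg
      have w22 : s₄.ireg 22 = i := by simp [hs₄, hf₃.ireg, hs₂, g22]
      have w24 : s₄.ireg 24 = leaf (s.rarr 8) (2 ^ κ) (s.rarr 4 i) + N := by
        simp [hs₄, hf₃.ireg, hs₂, e₁, g23]
      have w25 : s₄.ireg 25 = leaf (s.rarr 8) (2 ^ κ) (s.rarr 5 i) + N + 1 := by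
        simp [hs₄, hf₃.ireg, e₃, hs₂, g23, g22, gr]
      have w0 : s₄.iarr 0 = s.iarr 0 := by simp [hs₄, hf₃.iarr, hs₂, hf₁.iarr]
      have start := InsertInv.start h.valid (hkey i hi him).1 (hkey i hi him).2
        (by omega : 2 * 2 ^ κ < N)
      have main := Tri.loop_bounded (p := .ilt (.reg 24) (.reg 25)) (c := levelProg) 400
        (fun d s' => BuildFrame s s' ∧ s'.ireg 22 = i ∧ s'.ireg 25 ≤ 2 ^ d ∧
          ∃ k, InsertInv s.rarr (2 ^ κ) N i (s.iarr 0) (s'.iarr 0) k (s'.ireg 24) (s'.ireg 25))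
        (by
          rintro d s' ⟨hf, h22', h25, k, hI⟩ hlt
          simp only [BExpr.eval, IExpr.eval] at hlt
          have := hI.pos
          obtain ⟨d, rfl⟩ : ∃ d', d = d' + 1 := by
            cases d with
            | zero => simp at h25; omega
            | succ d => exact ⟨d, rfl⟩
          rw [pow_succ] at h25
          refine (levelProg_spec s' (K := 2 ^ κ) (N := N) (k := k) (T₀ := s.iarr 0)
            (by rw [hf.rarr]; exact hR) hi him h22' hlt (by rw [hf.rarr]; exact hI)).mono le_rfl ?_
          rintro s'' ⟨hf', h22'', h25', hI'⟩
          rw [hf.rarr] at hI'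
          exact ⟨d, Nat.lt_succ_self d, hf.trans hf', h22'', by omega, k + 1, hI'⟩)
        -- The right end is at most `2 * N = 2 ^ (κ + 3)` and halves on each level, while the left
        -- end stays at least `1`, which bounds the number of levels.
        (k := κ + 3) (s := s₄)
        ⟨hf₄, w22, by
          have := start.le
          rw [w25, show κ + 3 = κ + 2 + 1 from rfl, pow_succ, ← hN]
          omega, 0, by rw [w0, w24, w25]; exact start⟩
      refine main.mono ?_ ?_
      · simp only [BExpr.cost, IExpr.cost]
        omega
      · rintro s' ⟨⟨d, hf, h22', -, k, hI⟩, hn⟩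
        simp only [BExpr.eval, IExpr.eval] at hn
        refine ⟨hf, h22', hI.valid, ?_⟩
        intro j h1 h2 x hx
        rcases Nat.lt_succ_iff_lt_or_eq.1 h2 with h3 | rfl
        · exact hI.mono _ _ (h.sees j h1 h3 x hx)
        · exact (hI.covers x hx).resolve_left (by omega)
  · rintro s' ⟨hf, h22', hT⟩
    refine Tri.of_wp_le (by simp [Prog.bound, IExpr.cost]) ?_
    simp only [wp, IExpr.eval]
    refine ⟨hf.setIReg (by norm_num), ?_⟩
    simp [h22']
    exact hT

/-- Builds the tree of all pieces below register `21`. -/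
def buildProg : Prog :=
  (.iset 23 (.add (.add (.reg 10) (.reg 10)) (.add (.reg 10) (.reg 10))) ;; .iset 22 (.const 1)) ;;
  .loop (.ilt (.reg 22) (.reg 21)) insertProg

theorem buildProg_spec (s : State) {κ m : ℕ} (hR : Uncrossed s.rarr m)
    (h10 : s.ireg 10 = 2 ^ κ) (h21 : s.ireg 21 = m + 1)
    (hA : ∀ i j, i ≤ j → j < 2 ^ κ → s.rarr 8 i ≤ s.rarr 8 j)
    (hkey : ∀ j, 1 ≤ j → j ≤ m → (∃ x, x < 2 ^ κ ∧ s.rarr 8 x = s.rarr 4 j) ∧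
      ∃ x, x < 2 ^ κ ∧ s.rarr 8 x = s.rarr 5 j)
    (h0 : s.iarr 0 = fun _ => 0) :
    Tri buildProg s (2100 * (κ + 2) * (m + 2)) fun s' => s'.rarr = s.rarr ∧
      (∀ b, b ≠ 0 → s'.iarr b = s.iarr b) ∧ s'.ireg 10 = s.ireg 10 ∧ s'.ireg 20 = s.ireg 20 ∧
      TreeOf s.rarr (2 ^ κ) (2 ^ (κ + 2)) (s'.iarr 0) (m + 1) := by
  refine Tri.wp_seq ((2000 * (κ + 2) + 4) * (m + 1)) ?_ ?_
  · simp only [Prog.bound, IExpr.cost]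
    nlinarith
  simp only [wp, IExpr.eval]
  set s₁ := (s.setIReg 23 _).setIReg 22 1 with hs₁
  have main := Tri.loop_bounded (p := .ilt (.reg 22) (.reg 21)) (c := insertProg)
    (2000 * (κ + 2))
    (fun d s' => BuildFrame s₁ s' ∧ ∃ i, s'.ireg 22 = i ∧ 1 ≤ i ∧ i + d = m + 1 ∧
      TreeOf s.rarr (2 ^ κ) (2 ^ (κ + 2)) (s'.iarr 0) i)
    (by
      rintro d s' ⟨hf, i, h22, hi, hd, hT⟩ hlt
      have e21 : s'.ireg 21 = m + 1 := by
        rw [hf.ireg 21 (by norm_num) (by norm_num) (by norm_num)]; simp [hs₁, h21]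
      have e10 : s'.ireg 10 = 2 ^ κ := by
        rw [hf.ireg 10 (by norm_num) (by norm_num) (by norm_num)]; simp [hs₁, h10]
      have e23 : s'.ireg 23 = 2 ^ (κ + 2) := by
        rw [hf.ireg 23 (by norm_num) (by norm_num) (by norm_num)]
        simp [hs₁, h10, pow_add]
        ring
      have er : s'.rarr = s.rarr := hf.rarr
      simp only [BExpr.eval, IExpr.eval, e21, h22] at hlt
      refine (insertProg_spec s' (by rw [er]; exact hR) e10 e23 rfl (by rw [er]; exact hA)
        (by rw [er]; exact hkey) h22 hi (by omega) (by rw [er]; exact hT)).mono le_rfl ?_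
      rintro s'' ⟨hf', h22', hT'⟩
      rw [er] at hT'
      exact ⟨d - 1, by omega, hf.trans hf', i + 1, h22', by omega, by omega, hT'⟩)
    (k := m) (s := s₁)
    ⟨BuildFrame.refl _, 1, by simp [hs₁], le_rfl, by omega, by simp [hs₁, h0, TreeValid], by
      intro j h1 h2
      omega⟩
  refine main.mono ?_ ?_
  · simp only [BExpr.cost, IExpr.cost]
    exact le_rfl
  · rintro s' ⟨⟨d, hf, i, h22, hi, hd, hT⟩, hn⟩
    have e21 : s'.ireg 21 = m + 1 := by
      rw [hf.ireg 21 (by norm_num) (by norm_num) (by norm_num)]; simp [hs₁, h21]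
    simp only [BExpr.eval, IExpr.eval, e21, h22] at hn
    obtain rfl : i = m + 1 := by omega
    refine ⟨hf.rarr, hf.iarr, ?_, ?_, hT⟩
    · rw [hf.ireg 10 (by norm_num) (by norm_num) (by norm_num)]; simp [hs₁]
    · rw [hf.ireg 20 (by norm_num) (by norm_num) (by norm_num)]; simp [hs₁]

/-! ### Quarter turns, cones and the query program. -/

/-- The first coordinate after `c` quarter turns. -/
def turnX (c : ℕ) (x y : ℝ) : ℝ :=
  match c with
  | 0 => x
  | 1 => y
  | 2 => -x
  | _ => -y

/-- The second coordinate after `c` quarter turns. -/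
def turnY (c : ℕ) (x y : ℝ) : ℝ :=
  match c with
  | 0 => y
  | 1 => -x
  | 2 => -y
  | _ => x

/-- The negative of an expression. -/
def RExpr.opp (e : RExpr) : RExpr := .sub (.const 0) e

@[simp] theorem RExpr.eval_opp (s : State) (e : RExpr) : e.opp.eval s = -e.eval s := by
  simp [RExpr.opp, RExpr.eval]

/-- An expression for `turnX`. -/
def RExpr.turnX (c : ℕ) (e f : RExpr) : RExpr :=
  match c with
  | 0 => e
  | 1 => f
  | 2 => e.opp
  | _ => f.opp

/-- An expression for `turnY`. -/
def RExpr.turnY (c : ℕ) (e f : RExpr) : RExpr :=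
  match c with
  | 0 => f
  | 1 => e.opp
  | 2 => f.opp
  | _ => e

@[simp] theorem RExpr.eval_turnX (s : State) (c : ℕ) (e f : RExpr) :
    (RExpr.turnX c e f).eval s = RealRAM.turnX c (e.eval s) (f.eval s) := by
  unfold RExpr.turnX RealRAM.turnX
  split <;> simp

@[simp] theorem RExpr.eval_turnY (s : State) (c : ℕ) (e f : RExpr) :
    (RExpr.turnY c e f).eval s = RealRAM.turnY c (e.eval s) (f.eval s) := by
  unfold RExpr.turnY RealRAM.turnY
  split <;> simp

/-- After `c` quarter turns the vector lies in the cone around the second axis. -/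
def InCone (c : ℕ) (x y : ℝ) : Prop := |turnX c x y| ≤ turnY c x y ∧ 0 < turnY c x y

/-- If the second coordinate vanished, the two inequalities would make the vector zero, which is
excluded because `b ≠ t`. -/
theorem inCone_of_le {c : ℕ} {x y : ℝ} (h : x ≠ 0 ∨ y ≠ 0) (h1 : turnX c x y ≤ turnY c x y)
    (h2 : -turnX c x y ≤ turnY c x y) : InCone c x y := by
  have habs := abs_le.2 ⟨by linarith, h1⟩
  refine ⟨habs, lt_of_le_of_ne ((abs_nonneg _).trans habs) fun h0 => ?_⟩
  have hX : turnX c x y = 0 := by rw [← h0] at h1 h2; linarith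
  revert h0 hX
  unfold turnX turnY
  rcases h with h | h <;> split <;> intro h0 hX <;> apply h <;> linarith

/-- The test whether the vector in registers `2`, `3` is in cone `c`. -/
def coneTest (c : ℕ) : BExpr :=
  .conj (.neg (.rlt (.turnY c (.reg 2) (.reg 3)) (.turnX c (.reg 2) (.reg 3))))
    (.neg (.rlt (.turnY c (.reg 2) (.reg 3)) (RExpr.turnX c (.reg 2) (.reg 3)).opp))

theorem coneTest_eval (s : State) (c : ℕ) : (coneTest c).eval s ↔
    turnX c (s.rreg 2) (s.rreg 3) ≤ turnY c (s.rreg 2) (s.rreg 3) ∧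
      -turnX c (s.rreg 2) (s.rreg 3) ≤ turnY c (s.rreg 2) (s.rreg 3) := by
  simp [coneTest, BExpr.eval, RExpr.eval]

/-- Computes the abscissa and the height of the query point in cone `c`. -/
def coneCoords (c : ℕ) : Prog :=
  .rset 20 (.add (.div (.turnX c (.reg 2) (.reg 3)) (.turnY c (.reg 2) (.reg 3))) (.const (4 * c))) ;;
  .rset 21 (.div (.const 1) (.turnY c (.reg 2) (.reg 3)))

/-- Tests the piece stored at the node in register `26`. -/
def testProg : Prog :=
  .cond (.conj (.neg (.ieq (.get 0 (.reg 26)) (.const 0)))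
      (.neg (.rlt (.add (.mul (.get 6 (.get 0 (.reg 26))) (.reg 20)) (.get 7 (.get 0 (.reg 26))))
        (.reg 21))))
    (.iset 0 (.const 1)) .skip

/-- The query program. -/
def query : Prog :=
  (.iset 10 (.get 1 (.const 0)) ;;
    .rset 2 (.sub (.reg 0) (.get 9 (.const 0))) ;;
    .rset 3 (.sub (.reg 1) (.get 9 (.const 1))) ;;
    .cond (coneTest 0) (coneCoords 0) (.cond (coneTest 1) (coneCoords 1)
      (.cond (coneTest 2) (coneCoords 2) (coneCoords 3)))) ;;
  leafProg ;;
  (.iset 0 (.get 1 (.const 1)) ;;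
    .iset 26 (.add (.reg 5) (.add (.add (.reg 10) (.reg 10)) (.add (.reg 10) (.reg 10))))) ;;
  .loop (.ilt (.const 0) (.reg 26)) (testProg ;; .iset 26 (.half (.reg 26))) ;;
  testProg

/-- The piece stored at node `v` is met. -/
def Hit (R : ℕ → ℕ → ℝ) (T : ℕ → ℕ) (x y : ℝ) (v : ℕ) : Prop :=
  T v ≠ 0 ∧ y ≤ height R (T v) x

/-- Halving the node number follows the path to the root, and the answer register accumulates the
hits met so far. The incoming value of that register is the flag for segments through the centre. -/
theorem climb_spec (s : State) {R : ℕ → ℕ → ℝ} {T : ℕ → ℕ} {κ : ℕ} {x y : ℝ} (hR : s.rarr = R)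
    (hT : s.iarr 0 = T) (hx : s.rreg 20 = x) (hy : s.rreg 21 = y)
    (h26 : s.ireg 26 = node R (2 ^ κ) (2 ^ (κ + 2)) x 0) :
    Tri (.loop (.ilt (.const 0) (.reg 26)) (testProg ;; .iset 26 (.half (.reg 26))) ;; testProg) s
      (100 * (κ + 2)) fun s' => (s'.ireg 0 ≠ 0 ↔ s.ireg 0 ≠ 0 ∨ Sees R (2 ^ κ) (2 ^ (κ + 2)) T x y) := by
  have main := Tri.loop_bounded (p := .ilt (.const 0) (.reg 26))
    (c := testProg ;; .iset 26 (.half (.reg 26))) 30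
    (fun d s' => s'.rarr = R ∧ s'.iarr 0 = T ∧ s'.rreg 20 = x ∧ s'.rreg 21 = y ∧
      s'.ireg 26 < 2 ^ d ∧ ∃ k, s'.ireg 26 = node R (2 ^ κ) (2 ^ (κ + 2)) x k ∧
      (s'.ireg 0 ≠ 0 ↔ s.ireg 0 ≠ 0 ∨
        ∃ k', k' < k ∧ Hit R T x y (node R (2 ^ κ) (2 ^ (κ + 2)) x k')))
    (by
      rintro d s' ⟨hR', hT', hx', hy', hd, k, h26', h0⟩ hlt
      simp only [BExpr.eval, IExpr.eval] at hlt
      obtain ⟨d, rfl⟩ : ∃ d', d = d' + 1 := by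
        cases d with
        | zero => simp at hd; omega
        | succ d => exact ⟨d, rfl⟩
      rw [pow_succ] at hd
      refine Tri.of_wp_le (by simp [Prog.bound, testProg, BExpr.cost, IExpr.cost, RExpr.cost]) ?_
      have hex : ∀ P : ℕ → Prop, (∃ k', k' < k + 1 ∧ P k') ↔ (∃ k', k' < k ∧ P k') ∨ P k := by
        intro P
        constructor
        · rintro ⟨k', h1, h2⟩
          rcases Nat.lt_succ_iff_lt_or_eq.1 h1 with h3 | rfl
          · exact .inl ⟨k', h3, h2⟩
          · exact .inr h2
        · rintro (⟨k', h1, h2⟩ | h)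
          · exact ⟨k', by omega, h2⟩
          · exact ⟨k, by omega, h⟩
      simp only [wp, testProg, IExpr.eval, RExpr.eval, BExpr.eval, hR', hT', hx', hy', h26', not_lt]
      refine ⟨fun hh => ⟨d, Nat.lt_succ_self d, ?_⟩, fun hh => ⟨d, Nat.lt_succ_self d, ?_⟩⟩
      · simp [hR', hT', hx', hy']
        refine ⟨by omega, k + 1, by rw [node_succ, h26'], .inr ?_⟩
        exact ⟨k, Nat.lt_succ_self k, hh⟩
      · simp [hR', hT', hx', hy']
        refine ⟨by omega, k + 1, by rw [node_succ], ?_⟩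
        rw [hex, ← or_assoc]
        exact h0.trans (or_iff_left hh).symm)
    (k := κ + 3) (s := s)
    ⟨hR, hT, hx, hy, by
      rw [h26, node_zero]
      have := leaf_le (R 8) (2 ^ κ) x
      have : 0 < 2 ^ κ := by positivity
      rw [pow_add, pow_add]
      omega, 0, h26, by simp⟩
  refine Tri.seq _ 30 ?_ (main.mono le_rfl ?_)
  · simp only [BExpr.cost, IExpr.cost]
    omega
  · rintro s' ⟨⟨d, hR', hT', hx', hy', hd, k, h26', h0⟩, hn⟩
    simp only [BExpr.eval, IExpr.eval, not_lt, Nat.le_zero] at hn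
    refine Tri.of_wp_le (by simp [Prog.bound, testProg, BExpr.cost, IExpr.cost, RExpr.cost]) ?_
    have hk : node R (2 ^ κ) (2 ^ (κ + 2)) x k = 0 := h26' ▸ hn
    -- `Sees` ranges over all heights, and beyond the root the node number stays `0`. The final test
    -- of cell `0`, after the loop, settles all of them at once.
    have hz : ∀ k', k ≤ k' → node R (2 ^ κ) (2 ^ (κ + 2)) x k' = 0 := fun k' h => by
      induction k', h using Nat.le_induction with
      | base => exact hk
      | succ k' _ ih => rw [node_succ, ih]
    have hs : Sees R (2 ^ κ) (2 ^ (κ + 2)) T x y ↔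
        (∃ k', k' < k ∧ Hit R T x y (node R (2 ^ κ) (2 ^ (κ + 2)) x k')) ∨ Hit R T x y 0 := by
      constructor
      · rintro ⟨k', h⟩
        by_cases hkk : k' < k
        · exact .inl ⟨k', hkk, h⟩
        · rw [hz k' (by omega)] at h
          exact .inr h
      · rintro (⟨k', -, h⟩ | h)
        · exact ⟨k', h⟩
        · exact ⟨k, by rw [hk]; exact h⟩
    simp only [wp, testProg, IExpr.eval, RExpr.eval, BExpr.eval, hR', hT', hx', hy', hn, not_lt]
    rw [hs, ← or_assoc]
    refine ⟨fun hh => ?_, fun hh => ?_⟩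
    · simp
      exact .inr hh
    · exact h0.trans (or_iff_left hh).symm

theorem query_spec (s : State) {κ : ℕ} (hK : s.iarr 1 0 = 2 ^ κ)
    (hA : ∀ i j, i ≤ j → j < 2 ^ κ → s.rarr 8 i ≤ s.rarr 8 j) {x y : ℝ}
    (hx : x = s.rreg 0 - s.rarr 9 0) (hy : y = s.rreg 1 - s.rarr 9 1) (hxy : x ≠ 0 ∨ y ≠ 0) :
    Tri query s (300 * (κ + 2)) fun s' => ∃ c, c < 4 ∧ InCone c x y ∧
      (s'.ireg 0 ≠ 0 ↔ s.iarr 1 1 ≠ 0 ∨ Sees s.rarr (2 ^ κ) (2 ^ (κ + 2)) (s.iarr 0)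
        (turnX c x y / turnY c x y + 4 * c) (1 / turnY c x y)) := by
  refine Tri.seq 180 (300 * (κ + 2) - 180) (by omega) (Tri.mono (T := 180) (Q := fun s' =>
    s'.rarr = s.rarr ∧ s'.iarr = s.iarr ∧ s'.ireg 10 = 2 ^ κ ∧ ∃ c, c < 4 ∧
      InCone c x y ∧ s'.rreg 20 = turnX c x y / turnY c x y + 4 * c ∧
      s'.rreg 21 = 1 / turnY c x y) ?_ le_rfl ?_)
  · refine Tri.of_wp_le (by simp [Prog.bound, coneTest, coneCoords, RExpr.turnX, RExpr.turnY,
      RExpr.opp, BExpr.cost, IExpr.cost, RExpr.cost]) ?_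
    simp only [wp, coneCoords, coneTest_eval, IExpr.eval, RExpr.eval]
    simp [hK, ← hx, ← hy, RExpr.eval]
    refine ⟨fun h1 h2 => ⟨0, by norm_num, inCone_of_le hxy h1 h2, by norm_num, rfl⟩, fun h0 =>
      ⟨fun h1 h2 => ⟨1, by norm_num, inCone_of_le hxy h1 h2, by norm_num, rfl⟩, fun h1 =>
      ⟨fun h1 h2 => ⟨2, by norm_num, inCone_of_le hxy h1 h2, by norm_num, rfl⟩, fun h2 =>
      ⟨3, by norm_num, ?_, by norm_num, rfl⟩⟩⟩⟩
    -- Cone `3` is never tested: a vector that fails the other three tests must lie in it.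
    simp only [turnX, turnY] at h0 h1 h2
    refine inCone_of_le hxy ?_ ?_ <;> simp only [turnX, turnY] <;> by_contra hc <;> rw [not_le] at hc
    · by_cases h : x ≤ y
      · have := h0 h
        by_cases h' : y ≤ -x
        · have := h1 h'; linarith
        · linarith
      · by_cases h' : y ≤ -x
        · have := h1 h'
          by_cases h'' : -x ≤ -y
          · have := h2 h''; linarith
          · linarith
        · by_cases h'' : -x ≤ -y
          · have := h2 h''; linarith
          · linarith
    · by_cases h : x ≤ y
      · have := h0 h
        by_cases h' : y ≤ -x
        · have := h1 h'; linarith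
        · linarith
      · by_cases h' : y ≤ -x
        · have := h1 h'
          by_cases h'' : -x ≤ -y
          · have := h2 h''; linarith
          · linarith
        · linarith
  · rintro s₁ ⟨hR, hI, h10, c, hc, hcone, h20, h21⟩
    refine Tri.seq (100 * (κ + 2)) (110 * (κ + 2)) (by omega)
      ((leafProg_spec s₁ κ h10.le (by rw [h10, hR]; exact hA)).mono le_rfl ?_)
    rintro s₂ ⟨hf, h5⟩
    refine Tri.wp_seq (100 * (κ + 2)) (by simp [Prog.bound, IExpr.cost]; omega) ?_
    simp only [wp, IExpr.eval]
    refine (climb_spec _ (R := s.rarr) (T := s.iarr 0) (κ := κ)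
      (x := turnX c x y / turnY c x y + 4 * c) (y := 1 / turnY c x y) ?_ ?_ ?_ ?_ ?_).mono le_rfl ?_
    · simp [hf.rarr, hR]
    · simp [hf.iarr, hI]
    · simp [hf.rreg, h20]
    · simp [hf.rreg, h21]
    · simp [hf.ireg 10, h10, h5, node_zero, hR, h20, pow_add]
      ring
    · intro s₃ h
      refine ⟨c, hc, hcone, h.trans ?_⟩
      simp [hf.iarr, hI]

/-- A query reads only keys below `K`, nodes below `2 * N` and lines of pieces below `b`, so it
cannot notice that the rest of the memory has been erased. -/
theorem sees_congr {R R' : ℕ → ℕ → ℝ} {T T' : ℕ → ℕ} {K N b : ℕ} (hN : 2 * K < N)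
    (h8 : ∀ j, j < K → R 8 j = R' 8 j) (hT : ∀ v, v < 2 * N → T v = T' v) (hb : ∀ v, T v < b)
    (h6 : ∀ j, j < b → R 6 j = R' 6 j) (h7 : ∀ j, j < b → R 7 j = R' 7 j) (x y : ℝ) :
    Sees R K N T x y ↔ Sees R' K N T' x y := by
  have hn : ∀ k, node R' K N x k = node R K N x k := fun k => by
    rw [node, node, leaf_congr h8]
  have ht : ∀ k, T' (node R K N x k) = T (node R K N x k) := fun k => by
    refine (hT _ ((Nat.div_le_self _ _).trans_lt ?_)).symm
    have := leaf_le (R 8) K x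
    omega
  unfold Sees
  refine exists_congr fun k => ?_
  rw [hn, ht, height, height, h6 _ (hb _), h7 _ (hb _)]

/-! ### The part of a segment in a cone, in projective coordinates. -/

/-- The segment from the origin to `(x, y)` meets the segment from `p` to `q`. -/
def Meets (px py qx qy x y : ℝ) : Prop :=
  ∃ l m : ℝ, 0 ≤ l ∧ l ≤ 1 ∧ 0 ≤ m ∧ m ≤ 1 ∧ l * x = px + m * (qx - px) ∧ l * y = py + m * (qy - py)

/-- The point `(x, y)` lies on the open segment from `p` to `q`. -/
def Inside (px py qx qy x y : ℝ) : Prop :=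
  ∃ m : ℝ, 0 < m ∧ m < 1 ∧ x = px + m * (qx - px) ∧ y = py + m * (qy - py)

theorem Meets.swap {px py qx qy x y : ℝ} (h : Meets px py qx qy x y) : Meets qx qy px py x y := by
  obtain ⟨l, m, h1, h2, h3, h4, h5, h6⟩ := h
  exact ⟨l, 1 - m, h1, h2, by linarith, by linarith, by rw [h5]; ring, by rw [h6]; ring⟩

theorem Inside.swap {px py qx qy x y : ℝ} (h : Inside px py qx qy x y) : Inside qx qy px py x y := by
  obtain ⟨m, h1, h2, h3, h4⟩ := h
  exact ⟨1 - m, by linarith, by linarith, by rw [h3]; ring, by rw [h4]; ring⟩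

/-- In the projective coordinates `(x / y, 1 / y)`, the part of the segment from `p` to `q` in the
cone `|x| ≤ y` lies above `[lo, hi]` on the line with slope `al` and intercept `be`.  A segment
through the origin has no such part. -/
structure IsPiece (px py qx qy lo hi al be : ℝ) : Prop where
  within : ∀ u, lo ≤ u → u ≤ hi → -1 ≤ u ∧ u ≤ 1
  meets : ¬ Meets px py qx qy 0 0 → ∀ u w, -1 ≤ u → u ≤ 1 → 0 < w →
    (Meets px py qx qy (u / w) (1 / w) ↔ (lo ≤ u ∧ u ≤ hi) ∧ w ≤ al * u + be)
  inside : ∀ u, lo < u → u < hi → Inside px py qx qy (u / (al * u + be)) (1 / (al * u + be))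

theorem IsPiece.swap {px py qx qy lo hi al be : ℝ} (h : IsPiece px py qx qy lo hi al be) :
    IsPiece qx qy px py lo hi al be where
  within := h.within
  meets h0 u w h1 h2 h3 := by
    rw [← h.meets (fun hm => h0 hm.swap) u w h1 h2 h3]
    exact ⟨Meets.swap, Meets.swap⟩
  inside u h1 h2 := (h.inside u h1 h2).swap

/-- Let `r = (u, 1)`. As `p × q = D > 0`, the segment meets the open ray along `r` exactly when `p ×
r ≥ 0` and `r × q ≥ 0`, which are the two linear constraints on `u`. It does so at `r / h`, where `D
* h = p × r + r × q` is affine in `u`; this gives the slope and the intercept. The parameter along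
the segment is `(p × r) / (D * h)`. -/
theorem isPiece_of_pos {px py qx qy lo hi D : ℝ} (hD : D = px * qy - py * qx) (hpos : 0 < D)
    (hlh : ∀ u, lo ≤ u ∧ u ≤ hi ↔ ((-1 ≤ u ∧ u ≤ 1) ∧ py * u ≤ px) ∧ -qy * u ≤ -qx) :
    IsPiece px py qx qy lo hi ((qy - py) / D) ((px - qx) / D) := by
  have key : ∀ u, D * ((qy - py) / D * u + (px - qx) / D) = (px - py * u) + (qy * u - qx) := by
    intro u
    field_simp
    ring
  have point : ∀ u h, 0 < h → h = (qy - py) / D * u + (px - qx) / D →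
      u / h = px + (px - py * u) / (D * h) * (qx - px) ∧
      1 / h = py + (px - py * u) / (D * h) * (qy - py) := by
    intro u h hh he
    have e : D * h = (px - py * u) + (qy * u - qx) := by rw [he, key]
    have hne : D * h ≠ 0 := (mul_pos hpos hh).ne'
    have e1 : px + (px - py * u) / (D * h) * (qx - px) =
        (px * (D * h) + (px - py * u) * (qx - px)) / (D * h) := by field_simp
    have e2 : py + (px - py * u) / (D * h) * (qy - py) =
        (py * (D * h) + (px - py * u) * (qy - py)) / (D * h) := by field_simp
    rw [e1, e2, div_eq_div_iff hh.ne' hne, div_eq_div_iff hh.ne' hne]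
    constructor
    · rw [show u * (D * h) = h * (u * D) by ring, e, hD]
      ring
    · rw [show 1 * (D * h) = h * D by ring, e, hD]
      ring
  refine ⟨fun u h1 h2 => ((hlh u).1 ⟨h1, h2⟩).1.1, ?_, ?_⟩
  · intro _ u w h1 h2 hw
    rw [hlh]
    constructor
    · rintro ⟨l, m, hl, hl', hm, hm', ex, ey⟩
      set c := l / w with hc
      have hcl : c * w = l := by rw [hc]; field_simp
      have ex' : c * u = px + m * (qx - px) := by rw [← ex, hc]; ring
      have ey' : c = py + m * (qy - py) := by rw [← ey, hc]; ring
      have f1 : c * (px - py * u) = m * D := by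
        rw [mul_sub, show c * (py * u) = py * (c * u) by ring, ex', ey', hD]; ring
      have f2 : c * (qy * u - qx) = (1 - m) * D := by
        rw [mul_sub, show c * (qy * u) = qy * (c * u) by ring, ex', ey', hD]; ring
      -- The scaling factor `c` of the common point `c * (u, 1)` is the reciprocal of the height, so
      -- `l ≤ 1` turns into `w` being at most the height.
      have f3 : c * ((qy - py) / D * u + (px - qx) / D) = 1 := by
        have : D * (c * ((qy - py) / D * u + (px - qx) / D)) = D := by
          rw [mul_left_comm, key, mul_add, f1, f2]; ring
        exact mul_left_cancel₀ hpos.ne' (by rw [this, mul_one])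
      have hc0 : 0 ≤ c := div_nonneg hl hw.le
      have hcpos : 0 < c := lt_of_le_of_ne hc0 fun h => by rw [← h] at f3; simp at f3
      refine ⟨⟨⟨⟨h1, h2⟩, ?_⟩, ?_⟩, ?_⟩
      · have : 0 ≤ c * (px - py * u) := by rw [f1]; positivity
        have := nonneg_of_mul_nonneg_right this hcpos
        linarith
      · have : 0 ≤ c * (qy * u - qx) := by
          rw [f2]; exact mul_nonneg (by linarith) hpos.le
        have := nonneg_of_mul_nonneg_right this hcpos
        linarith
      · refine le_of_mul_le_mul_left ?_ hcpos
        rw [f3, hcl]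
        exact hl'
    · rintro ⟨⟨⟨-, h3⟩, h4⟩, h5⟩
      set h := (qy - py) / D * u + (px - qx) / D with hh
      have hpos' : 0 < h := hw.trans_le h5
      obtain ⟨e1, e2⟩ := point u h hpos' hh
      have e : D * h = (px - py * u) + (qy * u - qx) := by rw [hh, key]
      refine ⟨w / h, (px - py * u) / (D * h), by positivity, (div_le_one hpos').2 h5,
        div_nonneg (by linarith) (by positivity), (div_le_one (by positivity)).2 (by linarith), ?_, ?_⟩
      · rw [← e1]; field_simp
      · rw [← e2]; field_simp
  · intro u h1 h2
    -- the two constraints are strict between `lo` and `hi`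
    have strict : ∀ a b : ℝ, (∀ v, lo ≤ v ∧ v ≤ hi → a * v ≤ b) → ¬ (a = 0 ∧ b = 0) → a * u < b := by
      intro a b hab hne
      refine lt_of_le_of_ne (hab u ⟨h1.le, h2.le⟩) fun he => hne ?_
      have g1 := hab lo ⟨le_rfl, (h1.trans h2).le⟩
      have g2 := hab hi ⟨(h1.trans h2).le, le_rfl⟩
      have a0 : a = 0 := by
        rcases lt_trichotomy a 0 with h | h | h
        · nlinarith
        · exact h
        · nlinarith
      exact ⟨a0, by rw [← he, a0, zero_mul]⟩
    have s1 := strict py px (fun v hv => ((hlh v).1 hv).1.2)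
      (by rintro ⟨h, h'⟩; rw [hD, h, h'] at hpos; simp at hpos)
    have s2 := strict (-qy) (-qx) (fun v hv => ((hlh v).1 hv).2)
      (by rintro ⟨h, h'⟩; rw [hD, neg_eq_zero.1 h, neg_eq_zero.1 h'] at hpos; simp at hpos)
    set h := (qy - py) / D * u + (px - qx) / D with hh
    have e : D * h = (px - py * u) + (qy * u - qx) := by rw [hh, key]
    have hDh : 0 < D * h := by rw [e]; linarith
    have hpos' : 0 < h := pos_of_mul_pos_right hDh hpos.le
    obtain ⟨e1, e2⟩ := point u h hpos' hh
    exact ⟨_, div_pos (by linarith) hDh, (div_lt_one hDh).2 (by linarith), e1, e2⟩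

/-- The clause `meets` demands nothing of a segment through the origin, since such a segment is
handled by the flag. -/
theorem isPiece_empty_of_meets {px py qx qy : ℝ} (h : Meets px py qx qy 0 0) :
    IsPiece px py qx qy 1 0 0 0 where
  within u h1 h2 := by linarith
  meets h' := absurd h h'
  inside u h1 h2 := by linarith

theorem meets_zero_of_dot_nonpos {px py qx qy : ℝ} (hD : px * qy - py * qx = 0)
    (hdot : px * qx + py * qy ≤ 0) : Meets px py qx qy 0 0 := by
  by_cases h0 : px ^ 2 + py ^ 2 = 0
  · have h1 : px = 0 := by nlinarith [sq_nonneg px, sq_nonneg py]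
    have h2 : py = 0 := by nlinarith [sq_nonneg px, sq_nonneg py]
    exact ⟨0, 0, le_rfl, zero_le_one, le_rfl, zero_le_one, by simp [h1], by simp [h2]⟩
  · have hpos : 0 < px ^ 2 + py ^ 2 := lt_of_le_of_ne (by positivity) (Ne.symm h0)
    have hE : 0 < px ^ 2 + py ^ 2 - (px * qx + py * qy) := by linarith
    -- The parameter at which the inner product of `p` with the point of the segment vanishes; by
    -- collinearity that point is the origin.
    refine ⟨0, (px ^ 2 + py ^ 2) / (px ^ 2 + py ^ 2 - (px * qx + py * qy)), le_rfl, zero_le_one,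
      by positivity, (div_le_one hE).2 (by linarith), ?_, ?_⟩
    · rw [div_mul_eq_mul_div, ← sub_eq_iff_eq_add', eq_div_iff hE.ne']
      linear_combination py * hD
    · rw [div_mul_eq_mul_div, ← sub_eq_iff_eq_add', eq_div_iff hE.ne']
      linear_combination -px * hD

theorem not_meets_zero_of_cross {px py qx qy : ℝ} (hD : px * qy - py * qx ≠ 0) :
    ¬ Meets px py qx qy 0 0 := by
  rintro ⟨l, m, -, -, -, -, h1, h2⟩
  apply hD
  rw [mul_zero] at h1 h2
  linear_combination (py - qy) * h1 + (qx - px) * h2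

/-- The inner product with `p` is positive at both endpoints, hence on the whole segment. -/
theorem not_meets_zero_of_dot {px py qx qy : ℝ} (hdot : 0 < px * qx + py * qy) :
    ¬ Meets px py qx qy 0 0 := by
  rintro ⟨l, m, -, -, hm, hm', h1, h2⟩
  rw [mul_zero] at h1 h2
  have h3 : (1 - m) * (px ^ 2 + py ^ 2) + m * (px * qx + py * qy) = 0 := by
    linear_combination -px * h1 - py * h2
  have h4 : 0 < px ^ 2 + py ^ 2 := by
    refine lt_of_le_of_ne (by positivity) fun h => ?_
    have h5 : px = 0 := by nlinarith [sq_nonneg px, sq_nonneg py]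
    have h6 : py = 0 := by nlinarith [sq_nonneg px, sq_nonneg py]
    simp [h5, h6] at hdot
  rcases hm.eq_or_lt with rfl | hm0
  · linarith
  · have := mul_pos hm0 hdot
    have := mul_nonneg (sub_nonneg.2 hm') h4.le
    linarith

/-- The second coordinates of two points on a common ray have the same sign. -/
theorem mul_dot_of_cross {px py qx qy : ℝ} (hD : px * qy - py * qx = 0) :
    qy * (px ^ 2 + py ^ 2) = py * (px * qx + py * qy) := by
  linear_combination px * hD

/-- The segment lies on one open ray from the origin. A common point with a radius in the cone would
put that ray, and with it `p`, into the cone. -/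
theorem isPiece_empty_of_radial {px py qx qy : ℝ} (hD : px * qy - py * qx = 0)
    (hdot : 0 < px * qx + py * qy) (hc : ¬ (px ≤ py ∧ -px ≤ py)) :
    IsPiece px py qx qy 1 0 0 0 where
  within u h1 h2 := by linarith
  meets h0 u w h1 h2 hw := by
    refine ⟨fun ⟨l, m, hl, hl', hm, hm', ex, ey⟩ => (hc ?_).elim, fun h => by linarith [h.1.1, h.1.2]⟩
    have hlw : 0 ≤ l / w := by positivity
    have ex' : l / w * u = px + m * (qx - px) := by rw [← ex]; ring
    have ey' : l / w = py + m * (qy - py) := by rw [← ey]; ring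
    have hc0 : l / w ≠ 0 := fun hz => h0 ⟨0, m, le_rfl, zero_le_one, hm, hm',
      by rw [← ex', hz]; ring, by rw [← ey', hz]; ring⟩
    have hcpos : 0 < l / w := lt_of_le_of_ne hlw (Ne.symm hc0)
    have hpu : px = py * u := by
      refine mul_left_cancel₀ hc0 ?_
      have e : l / w * (py * u) = py * (l / w * u) := by ring
      rw [e, ex', ey']
      linear_combination m * hD
    have hq := mul_dot_of_cross hD
    have hy : 0 < py := by
      by_contra hle
      rw [not_lt] at hle
      have hqy : qy ≤ 0 := by
        by_contra hqy
        rw [not_le] at hqy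
        have h3 : py * (px * qx + py * qy) ≤ 0 := mul_nonpos_of_nonpos_of_nonneg hle hdot.le
        have h4 : 0 ≤ qy * (px ^ 2 + py ^ 2) := by positivity
        have h5 : px ^ 2 + py ^ 2 = 0 := by
          rcases mul_eq_zero.1 (le_antisymm (hq ▸ h3) h4) with h | h
          · exact absurd h hqy.ne'
          · exact h
        have h6 : px = 0 := by nlinarith [sq_nonneg px, sq_nonneg py]
        have h7 : py = 0 := by nlinarith [sq_nonneg px, sq_nonneg py]
        simp [h6, h7] at hdot
      have : l / w ≤ 0 := by
        rw [ey', show py + m * (qy - py) = (1 - m) * py + m * qy by ring]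
        have := mul_nonpos_of_nonneg_of_nonpos (sub_nonneg.2 hm') hle
        have := mul_nonpos_of_nonneg_of_nonpos hm hqy
        linarith
      linarith
    rw [hpu]
    constructor <;> nlinarith
  inside u h1 h2 := by linarith

/-- All points lie over one abscissa, and the endpoint nearer to the origin, with the smaller second
coordinate, is the highest. The open interval below the piece is empty, so a radial segment never
counts as crossing another piece. -/
theorem isPiece_radial {px py qx qy be : ℝ} (hD : px * qy - py * qx = 0)
    (hdot : 0 < px * qx + py * qy) (hc : px ≤ py ∧ -px ≤ py)
    (hbe : be = if py < qy then 1 / py else 1 / qy) :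
    IsPiece px py qx qy (px / py) (px / py) 0 be := by
  have hy : 0 < py := by
    refine lt_of_le_of_ne (by linarith [hc.1, hc.2]) fun h => ?_
    have : px = 0 := by linarith [hc.1, hc.2]
    simp [this, ← h] at hdot
  have hqy : 0 < qy := by
    have hq := mul_dot_of_cross hD
    refine pos_of_mul_pos_left (b := px ^ 2 + py ^ 2) ?_ (by positivity)
    rw [hq]
    positivity
  refine ⟨fun u h1 h2 => ?_, ?_, fun u h1 h2 => by linarith⟩
  · obtain rfl : u = px / py := le_antisymm h2 h1
    rw [div_le_one hy, le_div_iff₀ hy]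
    exact ⟨by linarith [hc.2], hc.1⟩
  · intro h0 u w h1 h2 hw
    rw [zero_mul, zero_add]
    constructor
    · rintro ⟨l, m, hl, hl', hm, hm', ex, ey⟩
      have hcl : l / w * w = l := by field_simp
      have ex' : l / w * u = px + m * (qx - px) := by rw [← ex]; ring
      have ey' : l / w = py + m * (qy - py) := by rw [← ey]; ring
      have hmin : min py qy ≤ l / w := by
        rw [ey', show py + m * (qy - py) = (1 - m) * py + m * qy by ring]
        have := mul_le_mul_of_nonneg_left (min_le_left py qy) (sub_nonneg.2 hm')
        have := mul_le_mul_of_nonneg_left (min_le_right py qy) hm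
        nlinarith
      have hcpos : 0 < l / w := (lt_min hy hqy).trans_le hmin
      have hpu : px = py * u := by
        refine mul_left_cancel₀ hcpos.ne' ?_
        have e : l / w * (py * u) = py * (l / w * u) := by ring
        rw [e, ex', ey']
        linear_combination m * hD
      have hu : u = px / py := by rw [hpu]; field_simp
      refine ⟨⟨hu.ge, hu.le⟩, ?_⟩
      have hwle : min py qy * w ≤ 1 := (mul_le_mul_of_nonneg_right hmin hw.le).trans (hcl.le.trans hl')
      rw [hbe]
      split_ifs with h
      · rw [min_eq_left h.le] at hwle
        rw [le_div_iff₀ hy]; linarith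
      · rw [min_eq_right (not_lt.1 h)] at hwle
        rw [le_div_iff₀ hqy]; linarith
    · rintro ⟨⟨h3, h4⟩, h5⟩
      obtain rfl : u = px / py := le_antisymm h4 h3
      rw [hbe] at h5
      split_ifs at h5 with h
      · rw [le_div_iff₀ hy] at h5
        refine ⟨w * py, 0, by positivity, h5, le_rfl, zero_le_one, ?_, ?_⟩ <;> field_simp <;> ring
      · rw [le_div_iff₀ hqy] at h5
        refine ⟨w * qy, 1, by positivity, h5, zero_le_one, le_rfl, ?_, ?_⟩
        · field_simp
          linear_combination hD
        · field_simp
          ring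

theorem meets_turn (c : ℕ) (px py qx qy x y : ℝ) :
    Meets (turnX c px py) (turnY c px py) (turnX c qx qy) (turnY c qx qy) (turnX c x y)
      (turnY c x y) ↔ Meets px py qx qy x y := by
  unfold turnX turnY Meets
  split <;> refine exists_congr fun l => exists_congr fun m => ?_ <;>
    constructor <;> rintro ⟨h1, h2, h3, h4, h5, h6⟩ <;>
    exact ⟨h1, h2, h3, h4, by linarith, by linarith⟩

theorem meets_turn_zero (c : ℕ) (px py qx qy : ℝ) :
    Meets (turnX c px py) (turnY c px py) (turnX c qx qy) (turnY c qx qy) 0 0 ↔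
      Meets px py qx qy 0 0 := by
  rw [← meets_turn c px py qx qy 0 0]
  unfold turnX turnY
  split <;> simp

theorem exists_turn_eq (c : ℕ) (u v : ℝ) : ∃ x y, turnX c x y = u ∧ turnY c x y = v := by
  unfold turnX turnY
  split
  · exact ⟨u, v, rfl, rfl⟩
  · exact ⟨-v, u, rfl, by ring⟩
  · exact ⟨-u, -v, by ring, by ring⟩
  · exact ⟨v, -u, by ring, rfl⟩

theorem inside_turn (c : ℕ) (px py qx qy x y : ℝ) :
    Inside (turnX c px py) (turnY c px py) (turnX c qx qy) (turnY c qx qy) (turnX c x y)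
      (turnY c x y) ↔ Inside px py qx qy x y := by
  unfold turnX turnY Inside
  split <;> refine exists_congr fun m => ?_ <;>
    constructor <;> rintro ⟨h1, h2, h3, h4⟩ <;>
    exact ⟨h1, h2, by linarith, by linarith⟩

/-! ### Computing and storing the pieces. -/

/-- Intersects the interval in registers `11`, `12` with the solutions `u` of `a * u ≤ b`. -/
def clip (a b : RExpr) : Prog :=
  .cond (.rlt (.const 0) a) (.cond (.rlt (.div b a) (.reg 12)) (.rset 12 (.div b a)) .skip)
    (.cond (.rlt a (.const 0)) (.cond (.rlt (.reg 11) (.div b a)) (.rset 11 (.div b a)) .skip)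
      (.cond (.rlt b (.const 0)) (.rset 12 (.sub (.reg 11) (.const 1))) .skip))

/-- Two states that differ only in integer register `20` and in real registers above `5`. -/
structure PieceFrame (s s' : State) : Prop where
  iarr : s'.iarr = s.iarr
  rarr : s'.rarr = s.rarr
  rreg : ∀ x, x ≤ 5 → s'.rreg x = s.rreg x
  ireg : ∀ x, x ≠ 20 → s'.ireg x = s.ireg x

theorem PieceFrame.refl (s : State) : PieceFrame s s :=
  ⟨rfl, rfl, fun _ _ => rfl, fun _ _ => rfl⟩

theorem PieceFrame.trans {s s' s'' : State} (h : PieceFrame s s') (h' : PieceFrame s' s'') :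
    PieceFrame s s'' where
  iarr := h'.iarr.trans h.iarr
  rarr := h'.rarr.trans h.rarr
  rreg x hx := (h'.rreg x hx).trans (h.rreg x hx)
  ireg x hx := (h'.ireg x hx).trans (h.ireg x hx)

theorem PieceFrame.setRReg {s s' : State} (h : PieceFrame s s') {x : ℕ} {v : ℝ} (hx : 5 < x) :
    PieceFrame s (s'.setRReg x v) where
  iarr := h.iarr
  rarr := h.rarr
  rreg y hy := by
    have : y ≠ x := by omega
    simp [this, h.rreg y hy]
  ireg := h.ireg

theorem PieceFrame.setIReg {s s' : State} (h : PieceFrame s s') {v : ℕ} :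
    PieceFrame s (s'.setIReg 20 v) where
  iarr := h.iarr
  rarr := h.rarr
  rreg := h.rreg
  ireg x hx := by simp [hx, h.ireg x hx]

theorem wp_clip {a b : RExpr} {s : State} {Q : State → Prop}
    (h : ∀ s', PieceFrame s s' → s'.ireg = s.ireg →
      (∀ x, x ≠ 11 → x ≠ 12 → s'.rreg x = s.rreg x) →
      (∀ u, s'.rreg 11 ≤ u ∧ u ≤ s'.rreg 12 ↔
        (s.rreg 11 ≤ u ∧ u ≤ s.rreg 12) ∧ a.eval s * u ≤ b.eval s) → Q s') :
    wp (clip a b) Q s := by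
  have frame12 : ∀ v, PieceFrame s (s.setRReg 12 v) := fun v =>
    (PieceFrame.refl s).setRReg (by norm_num)
  have frame11 : ∀ v, PieceFrame s (s.setRReg 11 v) := fun v =>
    (PieceFrame.refl s).setRReg (by norm_num)
  have c0 : ((0 : ℚ) : ℝ) = 0 := Rat.cast_zero
  have c1 : ((1 : ℚ) : ℝ) = 1 := Rat.cast_one
  simp only [clip, wp, BExpr.eval, RExpr.eval, c0, c1]
  refine ⟨fun ha => ⟨fun hlt => ?_, fun hlt => ?_⟩, fun ha => ⟨fun ha' => ⟨fun hlt => ?_, fun hlt => ?_⟩,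
    fun ha' => ⟨fun hb => ?_, fun hb => ?_⟩⟩⟩
  · refine h _ (frame12 _) rfl (fun x _ hx => by simp [hx]) fun u => ?_
    simp
    rw [le_div_iff₀ ha] at *
    rw [div_lt_iff₀ ha] at hlt
    constructor
    · rintro ⟨h1, h2⟩
      exact ⟨⟨h1, by nlinarith⟩, by linarith⟩
    · rintro ⟨⟨h1, h2⟩, h3⟩
      exact ⟨h1, by linarith⟩
  · refine h _ (PieceFrame.refl s) rfl (fun x _ hx => rfl) fun u => ?_
    rw [not_lt, le_div_iff₀ ha] at hlt
    refine ⟨fun h1 => ⟨h1, by nlinarith [h1.2]⟩, fun h1 => h1.1⟩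
  · refine h _ (frame11 _) rfl (fun x hx _ => by simp [hx]) fun u => ?_
    simp
    rw [div_le_iff_of_neg ha']
    rw [lt_div_iff_of_neg ha'] at hlt
    constructor
    · rintro ⟨h1, h2⟩
      exact ⟨⟨by nlinarith, h2⟩, by linarith⟩
    · rintro ⟨⟨h1, h2⟩, h3⟩
      exact ⟨by linarith, h2⟩
  · refine h _ (PieceFrame.refl s) rfl (fun x _ hx => rfl) fun u => ?_
    rw [not_lt, div_le_iff_of_neg ha'] at hlt
    refine ⟨fun h1 => ⟨h1, by nlinarith [h1.1]⟩, fun h1 => h1.1⟩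
  -- Here `0 ≤ b` fails, so no `u` is a solution; setting the right end to the left end minus `1`
  -- empties the interval.
  · refine h _ (frame12 _) rfl (fun x _ hx => by simp [hx]) fun u => ?_
    have ha0 : a.eval s = 0 := le_antisymm (not_lt.1 ha) (not_lt.1 ha')
    simp [ha0]
    constructor
    · rintro ⟨h1, h2⟩
      linarith
    · rintro ⟨⟨h1, h2⟩, h3⟩
      linarith
  · refine h _ (PieceFrame.refl s) rfl (fun x _ hx => rfl) fun u => ?_
    have ha0 : a.eval s = 0 := le_antisymm (not_lt.1 ha) (not_lt.1 ha')
    rw [ha0, zero_mul]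
    exact ⟨fun h1 => ⟨h1, not_lt.1 hb⟩, fun h1 => h1.1⟩

/-- The registers `11`, …, `14` describe the part in the cone of the segment whose endpoints have the
coordinates `px`, `py`, `qx`, `qy`, and register `20` has been set if the origin is on the segment. -/
structure PieceResult (s s' : State) (px py qx qy : ℝ) : Prop where
  frame : PieceFrame s s'
  isPiece : IsPiece px py qx qy (s'.rreg 11) (s'.rreg 12) (s'.rreg 13) (s'.rreg 14)
  flag : s'.ireg 20 ≠ 0 ↔ s.ireg 20 ≠ 0 ∨ Meets px py qx qy 0 0

/-- The piece of a segment that is not collinear with the origin; its endpoints are in registers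
`6`, …, `9`, their cross product is in register `10`. -/
def slantProg : Prog :=
  .cond (.rlt (.reg 10) (.const 0))
    (.rset 15 (.reg 6) ;; .rset 6 (.reg 8) ;; .rset 8 (.reg 15) ;;
      .rset 15 (.reg 7) ;; .rset 7 (.reg 9) ;; .rset 9 (.reg 15) ;; .rset 10 (RExpr.reg 10).opp) .skip ;;
  (.rset 13 (.div (.sub (.reg 9) (.reg 7)) (.reg 10)) ;;
    .rset 14 (.div (.sub (.reg 6) (.reg 8)) (.reg 10)) ;;
    .rset 11 (.const (-1)) ;; .rset 12 (.const 1)) ;;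
  clip (.reg 7) (.reg 6) ;; clip (RExpr.reg 9).opp (RExpr.reg 8).opp

/-- Swapping the endpoints changes the sign of the cross product but not the piece (`IsPiece.swap`).
After that, clipping `[-1, 1]` by two half-lines gives the projection required by `isPiece_of_pos`.
-/
theorem wp_slantProg {s : State} {Q : State → Prop}
    (hD : s.rreg 10 = s.rreg 6 * s.rreg 9 - s.rreg 7 * s.rreg 8) (h0 : s.rreg 10 ≠ 0)
    (h : ∀ s', PieceResult s s' (s.rreg 6) (s.rreg 7) (s.rreg 8) (s.rreg 9) → Q s') :
    wp slantProg Q s := by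
  have hnot : ¬ Meets (s.rreg 6) (s.rreg 7) (s.rreg 8) (s.rreg 9) 0 0 :=
    not_meets_zero_of_cross (hD ▸ h0)
  unfold slantProg
  -- first the orientation is made positive
  have main : ∀ s₁, PieceFrame s s₁ → s₁.ireg = s.ireg →
      s₁.rreg 10 = s₁.rreg 6 * s₁.rreg 9 - s₁.rreg 7 * s₁.rreg 8 → 0 < s₁.rreg 10 →
      (∀ s', PieceFrame s s' → s'.ireg = s.ireg → IsPiece (s₁.rreg 6) (s₁.rreg 7) (s₁.rreg 8)
        (s₁.rreg 9) (s'.rreg 11) (s'.rreg 12) (s'.rreg 13) (s'.rreg 14) → Q s') →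
      wp ((.rset 13 (.div (.sub (.reg 9) (.reg 7)) (.reg 10)) ;;
        .rset 14 (.div (.sub (.reg 6) (.reg 8)) (.reg 10)) ;;
        .rset 11 (.const (-1)) ;; .rset 12 (.const 1)) ;;
        clip (.reg 7) (.reg 6) ;; clip (RExpr.reg 9).opp (RExpr.reg 8).opp) Q s₁ := by
    intro s₁ hf hi hD₁ hpos hQ
    change wp (clip (.reg 7) (.reg 6)) (wp (clip (RExpr.reg 9).opp (RExpr.reg 8).opp) Q) _
    refine wp_clip fun s₂ hf₂ hi₂ hr₂ h₂ => wp_clip fun s₃ hf₃ hi₃ hr₃ h₃ => ?_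
    have hfs : PieceFrame s s₂ := by
      refine PieceFrame.trans ?_ hf₂
      exact (((hf.setRReg (by norm_num)).setRReg (by norm_num)).setRReg (by norm_num)).setRReg
        (by norm_num)
    refine hQ s₃ (hfs.trans hf₃) ?_ ?_
    · rw [hi₃, hi₂]
      exact hi
    · have e13 : s₃.rreg 13 = (s₁.rreg 9 - s₁.rreg 7) / s₁.rreg 10 := by
        rw [hr₃ 13 (by norm_num) (by norm_num), hr₂ 13 (by norm_num) (by norm_num)]
        simp [RExpr.eval]
      have e14 : s₃.rreg 14 = (s₁.rreg 6 - s₁.rreg 8) / s₁.rreg 10 := by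
        rw [hr₃ 14 (by norm_num) (by norm_num), hr₂ 14 (by norm_num) (by norm_num)]
        simp [RExpr.eval]
      rw [e13, e14]
      refine isPiece_of_pos hD₁ hpos fun u => ?_
      rw [h₃ u, h₂ u]
      simp [RExpr.eval, hr₂ 8, hr₂ 9]
  refine ⟨fun hneg => ?_, fun hneg => ?_⟩
  · simp [BExpr.eval, RExpr.eval] at hneg
    refine main _ ?_ rfl ?_ ?_ ?_
    · exact (((((((PieceFrame.refl s).setRReg (by norm_num)).setRReg (by norm_num)).setRReg
        (by norm_num)).setRReg (by norm_num)).setRReg (by norm_num)).setRReg (by norm_num)).setRReg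
        (by norm_num)
    · simp [RExpr.eval, hD]
      ring
    · simp [RExpr.eval, hneg]
    · intro s' hf hi hp
      simp [RExpr.eval] at hp
      exact h s' ⟨hf, hp.swap, by simp [hi, hnot]⟩
  · simp [BExpr.eval, RExpr.eval] at hneg
    refine main s (PieceFrame.refl s) rfl hD (lt_of_le_of_ne hneg (Ne.symm h0)) ?_
    intro s' hf hi hp
    exact h s' ⟨hf, hp, by simp [hi, hnot]⟩

/-- The piece of a segment that is collinear with the origin. -/
def radialProg : Prog :=
  (.rset 11 (.const 1) ;; .rset 12 (.const 0) ;; .rset 13 (.const 0) ;; .rset 14 (.const 0)) ;;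
  .cond (.rlt (.const 0) (.add (.mul (.reg 6) (.reg 8)) (.mul (.reg 7) (.reg 9))))
    (.cond (.conj (.neg (.rlt (.reg 7) (.reg 6))) (.neg (.rlt (.reg 7) (RExpr.reg 6).opp)))
      (.rset 11 (.div (.reg 6) (.reg 7)) ;; .rset 12 (.reg 11) ;;
        .cond (.rlt (.reg 7) (.reg 9)) (.rset 14 (.div (.const 1) (.reg 7)))
          (.rset 14 (.div (.const 1) (.reg 9)))) .skip)
    (.iset 20 (.const 1))

theorem wp_radialProg {s : State} {Q : State → Prop}
    (hD : s.rreg 6 * s.rreg 9 - s.rreg 7 * s.rreg 8 = 0)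
    (h : ∀ s', PieceResult s s' (s.rreg 6) (s.rreg 7) (s.rreg 8) (s.rreg 9) → Q s') :
    wp radialProg Q s := by
  have hf : PieceFrame s ((((s.setRReg 11 1).setRReg 12 0).setRReg 13 0).setRReg 14 0) :=
    ((((PieceFrame.refl s).setRReg (by norm_num)).setRReg (by norm_num)).setRReg
      (by norm_num)).setRReg (by norm_num)
  simp only [radialProg, wp, RExpr.eval, BExpr.eval, IExpr.eval]
  simp
  refine ⟨fun hdot => ⟨fun h1 h2 => ⟨fun h3 => ?_, fun h3 => ?_⟩, fun hc => ?_⟩, fun hdot => ?_⟩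
  · refine h _ ⟨((hf.setRReg (by norm_num)).setRReg (by norm_num)).setRReg (by norm_num), ?_, ?_⟩
    · simp
      exact isPiece_radial hD hdot ⟨h1, h2⟩ (by simp [h3])
    · simp [not_meets_zero_of_dot hdot]
  · refine h _ ⟨((hf.setRReg (by norm_num)).setRReg (by norm_num)).setRReg (by norm_num), ?_, ?_⟩
    · simp
      exact isPiece_radial hD hdot ⟨h1, h2⟩ (by simp [not_lt.2 h3])
    · simp [not_meets_zero_of_dot hdot]
  · refine h _ ⟨hf, ?_, ?_⟩
    · simp
      exact isPiece_empty_of_radial hD hdot fun h => absurd (hc h.1) (not_lt.2 h.2)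
    · simp [not_meets_zero_of_dot hdot]
  · have hm := meets_zero_of_dot_nonpos hD hdot
    refine h _ ⟨hf.setIReg, ?_, ?_⟩
    · simp
      exact isPiece_empty_of_meets hm
    · simp [hm]

/-- Computes the piece in cone `c` of the segment in registers `2`, …, `5` and stores it at the index
in integer register `22`. -/
def pieceProg (c : ℕ) : Prog :=
  (.rset 6 (.turnX c (.reg 2) (.reg 3)) ;; .rset 7 (.turnY c (.reg 2) (.reg 3)) ;;
    .rset 8 (.turnX c (.reg 4) (.reg 5)) ;; .rset 9 (.turnY c (.reg 4) (.reg 5)) ;;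
    .rset 10 (.sub (.mul (.reg 6) (.reg 9)) (.mul (.reg 7) (.reg 8)))) ;;
  .cond (.req (.reg 10) (.const 0)) radialProg slantProg ;;
  .rstore 4 (.reg 22) (.add (.reg 11) (.const (4 * c))) ;;
  .rstore 5 (.reg 22) (.add (.reg 12) (.const (4 * c))) ;;
  .rstore 6 (.reg 22) (.reg 13) ;;
  .rstore 7 (.reg 22) (.sub (.reg 14) (.mul (.const (4 * c)) (.reg 13))) ;;
  .rstore 8 (.add (.reg 22) (.reg 22)) (.add (.reg 11) (.const (4 * c))) ;;
  .rstore 8 (.add (.add (.reg 22) (.reg 22)) (.const 1)) (.add (.reg 12) (.const (4 * c))) ;;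
  .iset 22 (.add (.reg 22) (.const 1))

/-- The piece stored at index `j` belongs to cone `c` and to the segment from `p` to `q`; the
abscissae are shifted by `4 * c`. -/
structure Stored (R : ℕ → ℕ → ℝ) (j c : ℕ) (px py qx qy : ℝ) : Prop where
  isPiece : IsPiece (turnX c px py) (turnY c px py) (turnX c qx qy) (turnY c qx qy)
    (R 4 j - 4 * c) (R 5 j - 4 * c) (R 6 j) (R 7 j + 4 * c * R 6 j)
  key_left : R 8 (j + j) = R 4 j
  key_right : R 8 (j + j + 1) = R 5 j

/-- The shift of the abscissae by `4 * c` is compensated in the intercept and leaves heights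
unchanged. All writes go to index `j` and to the key cells `2 * j` and `2 * j + 1`, so pieces with
smaller index survive. -/
theorem wp_pieceProg {c : ℕ} {s : State} {Q : State → Prop}
    (h : ∀ s', s'.iarr = s.iarr → (∀ x, x ≤ 5 → s'.rreg x = s.rreg x) →
      (∀ x, x ≠ 20 → x ≠ 22 → s'.ireg x = s.ireg x) → s'.ireg 22 = s.ireg 22 + 1 →
      (s'.ireg 20 ≠ 0 ↔ s.ireg 20 ≠ 0 ∨
        Meets (s.rreg 2) (s.rreg 3) (s.rreg 4) (s.rreg 5) 0 0) →
      Stored s'.rarr (s.ireg 22) c (s.rreg 2) (s.rreg 3) (s.rreg 4) (s.rreg 5) →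
      (∀ b, b < 4 ∨ 9 ≤ b → s'.rarr b = s.rarr b) →
      (∀ j d px py qx qy, j < s.ireg 22 → Stored s.rarr j d px py qx qy →
        Stored s'.rarr j d px py qx qy) → Q s') :
    wp (pieceProg c) Q s := by
  have main : ∀ s₁, PieceResult s s₁ (turnX c (s.rreg 2) (s.rreg 3)) (turnY c (s.rreg 2) (s.rreg 3))
      (turnX c (s.rreg 4) (s.rreg 5)) (turnY c (s.rreg 4) (s.rreg 5)) →
      wp (.rstore 4 (.reg 22) (.add (.reg 11) (.const (4 * c))) ;;
        .rstore 5 (.reg 22) (.add (.reg 12) (.const (4 * c))) ;;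
        .rstore 6 (.reg 22) (.reg 13) ;;
        .rstore 7 (.reg 22) (.sub (.reg 14) (.mul (.const (4 * c)) (.reg 13))) ;;
        .rstore 8 (.add (.reg 22) (.reg 22)) (.add (.reg 11) (.const (4 * c))) ;;
        .rstore 8 (.add (.add (.reg 22) (.reg 22)) (.const 1)) (.add (.reg 12) (.const (4 * c))) ;;
        .iset 22 (.add (.reg 22) (.const 1))) Q s₁ := by
    rintro s₁ ⟨hf, hp, hflag⟩
    have e22 : s₁.ireg 22 = s.ireg 22 := hf.ireg 22 (by norm_num)
    simp only [wp, RExpr.eval, IExpr.eval]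
    refine h _ hf.iarr hf.rreg ?_ ?_ ?_ ?_ ?_ ?_
    · intro x h1 h2
      simp [h2, hf.ireg x h1]
    · simp [e22]
    · rw [meets_turn_zero] at hflag
      simpa using hflag
    · refine ⟨?_, ?_, ?_⟩
      · simp [e22]
        convert hp using 1
      · simp [e22]
      · simp [e22]
    · intro b hb
      have h4 : b ≠ 4 := by omega
      have h5 : b ≠ 5 := by omega
      have h6 : b ≠ 6 := by omega
      have h7 : b ≠ 7 := by omega
      have h8 : b ≠ 8 := by omega
      simp [h4, h5, h6, h7, h8, hf.rarr]
    · intro j d px py qx qy hj hst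
      have n1 : j ≠ s.ireg 22 := by omega
      have n2 : j + j ≠ s.ireg 22 + s.ireg 22 := by omega
      have n3 : j + j ≠ s.ireg 22 + s.ireg 22 + 1 := by omega
      have n4 : j + j + 1 ≠ s.ireg 22 + s.ireg 22 := by omega
      refine ⟨?_, ?_, ?_⟩
      · simpa [e22, n1, hf.rarr] using hst.isPiece
      · simpa [e22, n1, n2, n3, hf.rarr] using hst.key_left
      · simpa [e22, n1, n2, n4, hf.rarr] using hst.key_right
  unfold pieceProg
  set rest := Prog.rstore 4 (.reg 22) (.add (.reg 11) (.const (4 * c))) ;;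
        .rstore 5 (.reg 22) (.add (.reg 12) (.const (4 * c))) ;;
        .rstore 6 (.reg 22) (.reg 13) ;;
        .rstore 7 (.reg 22) (.sub (.reg 14) (.mul (.const (4 * c)) (.reg 13))) ;;
        .rstore 8 (.add (.reg 22) (.reg 22)) (.add (.reg 11) (.const (4 * c))) ;;
        .rstore 8 (.add (.add (.reg 22) (.reg 22)) (.const 1)) (.add (.reg 12) (.const (4 * c))) ;;
        .iset 22 (.add (.reg 22) (.const 1))
  simp only [wp, RExpr.eval, BExpr.eval, RExpr.eval_turnX, RExpr.eval_turnY]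
  set s₀ := ((((s.setRReg 6 _).setRReg 7 _).setRReg 8 _).setRReg 9 _).setRReg 10 _ with hs₀
  have hf₀ : PieceFrame s s₀ :=
    (((((PieceFrame.refl s).setRReg (by norm_num)).setRReg (by norm_num)).setRReg
      (by norm_num)).setRReg (by norm_num)).setRReg (by norm_num)
  have e6 : s₀.rreg 6 = turnX c (s.rreg 2) (s.rreg 3) := by simp [hs₀]
  have e7 : s₀.rreg 7 = turnY c (s.rreg 2) (s.rreg 3) := by simp [hs₀]
  have e8 : s₀.rreg 8 = turnX c (s.rreg 4) (s.rreg 5) := by simp [hs₀]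
  have e9 : s₀.rreg 9 = turnY c (s.rreg 4) (s.rreg 5) := by simp [hs₀]
  have e10 : s₀.rreg 10 = s₀.rreg 6 * s₀.rreg 9 - s₀.rreg 7 * s₀.rreg 8 := by
    rw [e6, e7, e8, e9]; simp [hs₀]
  have back : ∀ s', PieceResult s₀ s' (s₀.rreg 6) (s₀.rreg 7) (s₀.rreg 8) (s₀.rreg 9) →
      wp rest Q s' := by
    rintro s' ⟨hf, hp, hflag⟩
    rw [e6, e7, e8, e9] at hp hflag
    exact main s' ⟨hf₀.trans hf, hp, hflag⟩
  refine ⟨fun h0 => ?_, fun h0 => ?_⟩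
  · rw [Rat.cast_zero] at h0
    exact wp_radialProg (by rw [← e10, h0]) back
  · rw [Rat.cast_zero] at h0
    exact wp_slantProg e10 h0 back

/-! ### From pieces back to segments. -/

/-- The segment with index `i` in the memory `R`, relative to `(x, y)`, meets the segment from the
origin to `(u, v)`. -/
def SegMeets (R : ℕ → ℕ → ℝ) (x y : ℝ) (i : ℕ) (u v : ℝ) : Prop :=
  Meets (R 0 i - x) (R 1 i - y) (R 2 i - x) (R 3 i - y) u v

/-- The point `(u, v)` is on the open segment with index `i` in the memory `R`, relative to
`(x, y)`. -/
def SegInside (R : ℕ → ℕ → ℝ) (x y : ℝ) (i : ℕ) (u v : ℝ) : Prop :=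
  Inside (R 0 i - x) (R 1 i - y) (R 2 i - x) (R 3 i - y) u v

/-- The piece in cone `c` of segment `i` of the memory `R₀` is stored in `R`. -/
def SegStored (R₀ R : ℕ → ℕ → ℝ) (x y : ℝ) (i c : ℕ) : Prop :=
  Stored R (4 * i + c + 1) c (R₀ 0 i - x) (R₀ 1 i - y) (R₀ 2 i - x) (R₀ 3 i - y)

theorem height_eq (R : ℕ → ℕ → ℝ) (j : ℕ) (a u : ℝ) :
    height R j u = R 6 j * (u - a) + (R 7 j + a * R 6 j) := by
  unfold height; ring

theorem exists_index {n j : ℕ} (h1 : 1 ≤ j) (h2 : j ≤ 4 * n) :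
    ∃ i c, i < n ∧ c < 4 ∧ j = 4 * i + c + 1 :=
  ⟨(j - 1) / 4, (j - 1) % 4, by omega, by omega, by omega⟩

/-- Intervals of radius `1` about different multiples of `4` are disjoint, so an abscissa determines
its cone. -/
theorem eq_of_near {c d : ℕ} {u : ℝ} (h1 : -1 ≤ u - 4 * c) (h2 : u - 4 * c ≤ 1)
    (h3 : -1 ≤ u - 4 * d) (h4 : u - 4 * d ≤ 1) : c = d := by
  have h5 : (c : ℝ) < d + 1 := by linarith
  have h6 : (d : ℝ) < c + 1 := by linarith
  have h7 : c < d + 1 := by exact_mod_cast h5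
  have h8 : d < c + 1 := by exact_mod_cast h6
  omega

/-- Two pieces over a common abscissa belong to the same cone, hence to different segments. A
crossing would be mapped back, by `inside`, to a common point of two open segments. -/
theorem uncrossed_of_stored {R₀ R : ℕ → ℕ → ℝ} {x y : ℝ} {n : ℕ}
    (hs : ∀ i c, i < n → c < 4 → SegStored R₀ R x y i c)
    (hP : ∀ i j, i < n → j < n → i ≠ j → ∀ u v, SegInside R₀ x y i u v → ¬ SegInside R₀ x y j u v) :
    Uncrossed R (4 * n) := by
  intro a b ha ha' hb hb' hab u h1 h2 h3 h4 heq
  obtain ⟨i, c, hi, hc, rfl⟩ := exists_index ha ha'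
  obtain ⟨j, d, hj, hd, rfl⟩ := exists_index hb hb'
  have hsi := (hs i c hi hc).isPiece
  have hsj := (hs j d hj hd).isPiece
  obtain ⟨b1, b2⟩ := hsi.within (u - 4 * c) (by linarith) (by linarith)
  obtain ⟨b3, b4⟩ := hsj.within (u - 4 * d) (by linarith) (by linarith)
  obtain rfl := eq_of_near b1 b2 b3 b4
  have hij : i ≠ j := by
    rintro rfl
    exact hab rfl
  have hI := hsi.inside (u - 4 * c) (by linarith) (by linarith)
  have hJ := hsj.inside (u - 4 * c) (by linarith) (by linarith)
  rw [← height_eq] at hI hJ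
  rw [← heq] at hJ
  obtain ⟨v, w, hv, hw⟩ := exists_turn_eq c ((u - 4 * c) / height R (4 * i + c + 1) u)
    (1 / height R (4 * i + c + 1) u)
  rw [← hv, ← hw, inside_turn] at hI hJ
  exact hP i j hi hj hij v w hI hJ

/-- The answer for segments splits into the flag and a question about pieces at one abscissa. Pieces
of other cones need no filtering, because they do not span that abscissa. -/
theorem segMeets_iff {R₀ R : ℕ → ℕ → ℝ} {x y : ℝ} {n c : ℕ}
    (hs : ∀ i c, i < n → c < 4 → SegStored R₀ R x y i c) (hc : c < 4) {u v : ℝ}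
    (hcone : InCone c u v) :
    (∃ i, i < n ∧ SegMeets R₀ x y i u v) ↔ (∃ i, i < n ∧ SegMeets R₀ x y i 0 0) ∨
      ∃ j, 1 ≤ j ∧ j < 4 * n + 1 ∧ Spans R j (turnX c u v / turnY c u v + 4 * c) ∧
        1 / turnY c u v ≤ height R j (turnX c u v / turnY c u v + 4 * c) := by
  obtain ⟨hle, hpos⟩ := hcone
  set X := turnX c u v with hX
  set Y := turnY c u v with hY
  have hX' : X / Y / (1 / Y) = X := by field_simp
  have hY' : 1 / (1 / Y) = Y := by field_simp
  have hb1 : -1 ≤ X / Y := by rw [le_div_iff₀ hpos]; linarith [(abs_le.1 hle).1]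
  have hb2 : X / Y ≤ 1 := by rw [div_le_one hpos]; exact (abs_le.1 hle).2
  have key : ∀ i, i < n → ¬ SegMeets R₀ x y i 0 0 → (SegMeets R₀ x y i u v ↔
      Spans R (4 * i + c + 1) (X / Y + 4 * c) ∧
        1 / Y ≤ height R (4 * i + c + 1) (X / Y + 4 * c)) := by
    intro i hi h0
    have := (hs i c hi hc).isPiece.meets (by rwa [meets_turn_zero]) (X / Y) (1 / Y) hb1 hb2
      (by positivity)
    rw [hX', hY', hX, hY, meets_turn, ← hX, ← hY] at this
    rw [SegMeets, this, height_eq R _ (4 * c), add_sub_cancel_right, Spans, sub_le_iff_le_add,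
      le_sub_iff_add_le]
  constructor
  · rintro ⟨i, hi, hm⟩
    by_cases h0 : SegMeets R₀ x y i 0 0
    · exact .inl ⟨i, hi, h0⟩
    · obtain ⟨h1, h2⟩ := (key i hi h0).1 hm
      exact .inr ⟨_, by omega, by omega, h1, h2⟩
  · rintro (⟨i, hi, l, m, -, -, h3, h4, h5, h6⟩ | ⟨j, hj, hj', h1, h2⟩)
    -- The origin is the start of every radius, hence `l = 0`.
    · exact ⟨i, hi, 0, m, le_rfl, zero_le_one, h3, h4, by linarith, by linarith⟩
    · obtain ⟨i, d, hi, hd, rfl⟩ := exists_index (n := n) hj (by omega)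
      have hp := (hs i d hi hd).isPiece
      obtain ⟨b3, b4⟩ := hp.within (X / Y + 4 * c - 4 * d) (by linarith [h1.1]) (by linarith [h1.2])
      obtain rfl : c = d := eq_of_near (u := X / Y + 4 * c) (by linarith) (by linarith) b3 b4
      refine ⟨i, hi, ?_⟩
      by_cases h0 : SegMeets R₀ x y i 0 0
      · obtain ⟨l, m, -, -, h3, h4, h5, h6⟩ := h0
        exact ⟨0, m, le_rfl, zero_le_one, h3, h4, by linarith, by linarith⟩
      · exact (key i hi h0).2 ⟨h1, h2⟩

/-! ### The preprocessing program and its running time. -/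

/-- Loads the segment in register `12`, relative to the origin of the query segments. -/
def loadProg : Prog :=
  .rset 2 (.sub (.get 0 (.reg 12)) (.reg 0)) ;; .rset 3 (.sub (.get 1 (.reg 12)) (.reg 1)) ;;
    .rset 4 (.sub (.get 2 (.reg 12)) (.reg 0)) ;; .rset 5 (.sub (.get 3 (.reg 12)) (.reg 1))

theorem wp_loadProg {s : State} {Q : State → Prop}
    (h : ∀ s', s'.ireg = s.ireg → s'.iarr = s.iarr → s'.rarr = s.rarr → s'.rreg 0 = s.rreg 0 →
      s'.rreg 1 = s.rreg 1 → s'.rreg 2 = s.rarr 0 (s.ireg 12) - s.rreg 0 →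
      s'.rreg 3 = s.rarr 1 (s.ireg 12) - s.rreg 1 → s'.rreg 4 = s.rarr 2 (s.ireg 12) - s.rreg 0 →
      s'.rreg 5 = s.rarr 3 (s.ireg 12) - s.rreg 1 → Q s') : wp loadProg Q s := by
  refine h _ rfl rfl rfl ?_ ?_ ?_ ?_ ?_ ?_ <;> simp [RExpr.eval, IExpr.eval]

theorem wp_seq (c d : Prog) (Q : State → Prop) : wp (.seq c d) Q = wp c (wp d Q) := rfl

/-- Computes and stores the pieces of the segment in register `12`. -/
def scanBody : Prog :=
  loadProg ;; pieceProg 0 ;; pieceProg 1 ;; pieceProg 2 ;; pieceProg 3 ;;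
  .iset 12 (.add (.reg 12) (.const 1))

/-- The first `c` pieces of the segment in registers `2`, …, `5` have been stored. -/
structure PiecesDone (s s' : State) (c : ℕ) : Prop where
  iarr : s'.iarr = s.iarr
  rreg : ∀ x, x ≤ 5 → s'.rreg x = s.rreg x
  ireg : ∀ x, x ≠ 20 → x ≠ 22 → s'.ireg x = s.ireg x
  next : s'.ireg 22 = s.ireg 22 + c
  flag : s'.ireg 20 ≠ 0 ↔ s.ireg 20 ≠ 0 ∨
    (0 < c ∧ Meets (s.rreg 2) (s.rreg 3) (s.rreg 4) (s.rreg 5) 0 0)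
  stored : ∀ d, d < c →
    Stored s'.rarr (s.ireg 22 + d) d (s.rreg 2) (s.rreg 3) (s.rreg 4) (s.rreg 5)
  rarr : ∀ b, b < 4 ∨ 9 ≤ b → s'.rarr b = s.rarr b
  keep : ∀ j d px py qx qy, j < s.ireg 22 → Stored s.rarr j d px py qx qy →
    Stored s'.rarr j d px py qx qy

theorem PiecesDone.zero (s : State) : PiecesDone s s 0 where
  iarr := rfl
  rreg _ _ := rfl
  ireg _ _ _ := rfl
  next := rfl
  flag := by simp
  stored := by intros; omega
  rarr _ _ := rfl
  keep _ _ _ _ _ _ _ h := h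

theorem PiecesDone.step {s s' : State} {c : ℕ} {Q : State → Prop} (h : PiecesDone s s' c)
    (hQ : ∀ s'', PiecesDone s s'' (c + 1) → Q s'') : wp (pieceProg c) Q s' := by
  refine wp_pieceProg fun s'' h1 h2 h3 h4 h5 h6 h7 h8 => hQ s'' ?_
  have r2 := h.rreg 2 (by norm_num)
  have r3 := h.rreg 3 (by norm_num)
  have r4 := h.rreg 4 (by norm_num)
  have r5 := h.rreg 5 (by norm_num)
  rw [r2, r3, r4, r5] at h5 h6
  refine ⟨h1.trans h.iarr, fun x hx => (h2 x hx).trans (h.rreg x hx),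
    fun x hx hx' => (h3 x hx hx').trans (h.ireg x hx hx'), by rw [h4, h.next]; ring, ?_, ?_,
    fun b hb => (h7 b hb).trans (h.rarr b hb), ?_⟩
  · rw [h5, h.flag]
    simp only [Nat.succ_pos, true_and]
    tauto
  · intro d hd
    rcases Nat.lt_succ_iff_lt_or_eq.1 hd with hd' | rfl
    · exact h8 _ _ _ _ _ _ (by rw [h.next]; omega) (h.stored d hd')
    · rwa [h.next] at h6
  · intro j d px py qx qy hj hst
    exact h8 _ _ _ _ _ _ (by rw [h.next]; omega) (h.keep _ _ _ _ _ _ hj hst)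

/-- Stores the origin of the query segments and all the pieces. -/
def scanProg : Prog :=
  (.rstore 9 (.const 0) (.reg 0) ;; .rstore 9 (.const 1) (.reg 1) ;;
    .iset 12 (.const 0) ;; .iset 22 (.const 1)) ;;
  .loop (.ilt (.reg 12) (.reg 0)) scanBody

theorem scanProg_spec : ∃ C : ℕ, ∀ (s : State) (n : ℕ), s.ireg 0 = n → s.ireg 20 = 0 →
    Tri scanProg s (C * (n + 1)) fun s' => s'.iarr = s.iarr ∧ s'.ireg 22 = 4 * n + 1 ∧
      s'.rarr 9 0 = s.rreg 0 ∧ s'.rarr 9 1 = s.rreg 1 ∧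
      (s'.ireg 20 ≠ 0 ↔ ∃ i, i < n ∧ SegMeets s.rarr (s.rreg 0) (s.rreg 1) i 0 0) ∧
      ∀ i c, i < n → c < 4 → SegStored s.rarr s'.rarr (s.rreg 0) (s.rreg 1) i c := by
  -- The body has no loops, so a bound independent of the input exists; its numerical value is never
  -- needed.
  obtain ⟨B, hB⟩ : ∃ B, ∀ s Q, wp scanBody Q s → Tri scanBody s B Q := ⟨_, fun _ _ => Tri.of_wp⟩
  refine ⟨B + 30, fun s n hn h20 => ?_⟩
  refine Tri.wp_seq ((B + 10) * (n + 1)) ?_ ?_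
  · simp only [Prog.bound, IExpr.cost, RExpr.cost]
    nlinarith
  simp only [wp, IExpr.eval, RExpr.eval]
  set s₁ := (((s.setRArr 9 0 (s.rreg 0)).setRArr 9 1 _).setIReg 12 0).setIReg 22 1 with hs₁
  have main := Tri.loop_bounded (p := .ilt (.reg 12) (.reg 0)) (c := scanBody) B
    (fun k s' => s'.ireg 0 = n ∧ s'.iarr = s.iarr ∧ s'.rreg 0 = s.rreg 0 ∧ s'.rreg 1 = s.rreg 1 ∧
      (∀ b, b < 4 → s'.rarr b = s.rarr b) ∧ s'.rarr 9 0 = s.rreg 0 ∧ s'.rarr 9 1 = s.rreg 1 ∧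
      ∃ a, s'.ireg 12 = a ∧ a + k = n ∧ s'.ireg 22 = 4 * a + 1 ∧
      (s'.ireg 20 ≠ 0 ↔ ∃ i, i < a ∧ SegMeets s.rarr (s.rreg 0) (s.rreg 1) i 0 0) ∧
      ∀ i c, i < a → c < 4 → SegStored s.rarr s'.rarr (s.rreg 0) (s.rreg 1) i c)
    (by
      rintro k s' ⟨h0, hI, hr0, hr1, hR, h90, h91, a, h12, hk, h22, hflag, hst⟩ hlt
      simp only [BExpr.eval, IExpr.eval, h12, h0] at hlt
      refine hB _ _ ?_
      rw [scanBody, wp_seq, wp_seq, wp_seq, wp_seq, wp_seq]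
      refine wp_loadProg fun s₁ li lI lR l0 l1 l2 l3 l4 l5 => ?_
      refine (PiecesDone.zero s₁).step fun s₂ h2 => h2.step fun s₃ h3 => h3.step fun s₄ h4 =>
        h4.step fun s₅ h5 => ?_
      simp only [wp, IExpr.eval]
      refine ⟨k - 1, by omega, ?_⟩
      obtain ⟨gI, gr, gi, gn, gf, gs, gR, gk⟩ := h5
      rw [h12, hr0, hR 0 (by norm_num)] at l2
      rw [h12, hr1, hR 1 (by norm_num)] at l3
      rw [h12, hr0, hR 2 (by norm_num)] at l4
      rw [h12, hr1, hR 3 (by norm_num)] at l5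
      rw [l2, l3, l4, l5, li] at gs gf
      rw [li, lR] at gk
      rw [li] at gn
      have e9 : s₅.rarr 9 = s'.rarr 9 := (gR 9 (.inr le_rfl)).trans (by rw [lR])
      have g12 : s₅.ireg 12 = a := (gi 12 (by norm_num) (by norm_num)).trans (by rw [li, h12])
      refine ⟨?_, ?_, ?_, ?_, ?_, ?_, ?_, a + 1, ?_, by omega, ?_, ?_, ?_⟩
      · simpa [h0, li] using gi 0 (by norm_num) (by norm_num)
      · exact gI.trans (lI.trans hI)
      · exact (gr 0 (by norm_num)).trans (l0.trans hr0)
      · exact (gr 1 (by norm_num)).trans (l1.trans hr1)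
      · intro b hb
        exact (gR b (.inl hb)).trans (by rw [lR, hR b hb])
      · simp [e9, h90]
      · simp [e9, h91]
      · simp [g12]
      · simp [gn, h22]; omega
      · have : (∃ i, i < a + 1 ∧ SegMeets s.rarr (s.rreg 0) (s.rreg 1) i 0 0) ↔
            (∃ i, i < a ∧ SegMeets s.rarr (s.rreg 0) (s.rreg 1) i 0 0) ∨
              SegMeets s.rarr (s.rreg 0) (s.rreg 1) a 0 0 := by
          constructor
          · rintro ⟨i, hi, hm⟩
            rcases Nat.lt_succ_iff_lt_or_eq.1 hi with hi' | rfl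
            · exact .inl ⟨i, hi', hm⟩
            · exact .inr hm
          · rintro (⟨i, hi, hm⟩ | hm)
            · exact ⟨i, by omega, hm⟩
            · exact ⟨a, by omega, hm⟩
        rw [this, ← hflag]
        simpa [SegMeets] using gf
      · intro i c hi hc
        rcases Nat.lt_succ_iff_lt_or_eq.1 hi with hi' | rfl
        · exact gk _ _ _ _ _ _ (by omega) (hst i c hi' hc)
        · have := gs c hc
          rw [h22, add_right_comm] at this
          exact this)
    (k := n) (s := s₁)
    ⟨by simp [hs₁, hn], rfl, rfl, rfl, fun b hb => by
      have : b ≠ 9 := by omega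
      simp [hs₁, this], by simp [hs₁], by simp [hs₁], 0, by simp [hs₁], by simp, by simp [hs₁],
      by simp [hs₁, h20], by intros; omega⟩
  refine main.mono ?_ ?_
  · simp only [BExpr.cost, IExpr.cost]
    exact Nat.mul_le_mul_right _ (by omega)
  · rintro s' ⟨⟨k, h0, hI, hr0, hr1, hR, h90, h91, a, h12, hk, h22, hflag, hst⟩, hn'⟩
    simp only [BExpr.eval, IExpr.eval, h12, h0] at hn'
    obtain rfl : a = n := by omega
    exact ⟨hI, h22, h90, h91, hflag, hst⟩

/-- Sets register `10` to the least power of two that is at least twice register `22`. -/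
def sizeProg : Prog :=
  (.iset 21 (.reg 22) ;; .iset 10 (.const 1)) ;;
  .loop (.ilt (.reg 10) (.add (.reg 22) (.reg 22))) (.iset 10 (.add (.reg 10) (.reg 10)))

/-- The last doubling starts below `2 * (m + 1)`, so the result is at most `4 * (m + 1)`. The crude
linear bound on the number of rounds is enough. -/
theorem sizeProg_spec (s : State) {m : ℕ} (h22 : s.ireg 22 = m + 1) :
    Tri sizeProg s (50 * (m + 1)) fun s' => s'.rarr = s.rarr ∧ s'.iarr = s.iarr ∧
      s'.ireg 20 = s.ireg 20 ∧ s'.ireg 21 = m + 1 ∧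
      ∃ κ, s'.ireg 10 = 2 ^ κ ∧ 2 * (m + 1) ≤ 2 ^ κ ∧ 2 ^ κ ≤ 4 * (m + 1) := by
  refine Tri.wp_seq (40 * (m + 1)) (by simp [Prog.bound, IExpr.cost]; omega) ?_
  simp only [wp, IExpr.eval]
  have main := Tri.loop_bounded (p := .ilt (.reg 10) (.add (.reg 22) (.reg 22)))
    (c := .iset 10 (.add (.reg 10) (.reg 10))) 4
    (fun k s' => s'.rarr = s.rarr ∧ s'.iarr = s.iarr ∧ s'.ireg 20 = s.ireg 20 ∧
      s'.ireg 21 = m + 1 ∧ s'.ireg 22 = m + 1 ∧ k = 2 * (m + 1) - s'.ireg 10 ∧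
      ∃ κ, s'.ireg 10 = 2 ^ κ ∧ 2 ^ κ ≤ 4 * (m + 1))
    (by
      rintro k s' ⟨hR, hI, h20, h21, h22', hk, κ, h10, hle⟩ hlt
      simp only [BExpr.eval, IExpr.eval, h22', h10] at hlt
      refine Tri.of_wp_le (by simp [Prog.bound, IExpr.cost]) ?_
      simp only [wp, IExpr.eval, h10]
      have hpos : 0 < 2 ^ κ := by positivity
      refine ⟨2 * (m + 1) - (2 ^ κ + 2 ^ κ), by omega, hR, hI, by simpa using h20, by simpa using h21,
        by simpa using h22', by simp, κ + 1, ?_, ?_⟩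
      · simp [pow_succ]; ring
      · rw [pow_succ]; omega)
    (k := 2 * (m + 1) - 1) (s := (s.setIReg 21 (s.ireg 22)).setIReg 10 1)
    ⟨rfl, rfl, by simp, by simp [h22], by simp [h22], by simp, 0, by simp, by simp; omega⟩
  refine main.mono ?_ ?_
  · simp only [BExpr.cost, IExpr.cost]
    have : 2 * (m + 1) - 1 + 1 = 2 * (m + 1) := by omega
    rw [this]
    omega
  · rintro s' ⟨⟨k, hR, hI, h20, h21, h22', hk, κ, h10, hle⟩, hn⟩
    simp only [BExpr.eval, IExpr.eval, h22', h10] at hn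
    exact ⟨hR, hI, h20, h21, κ, h10, by omega, hle⟩

/-- The preprocessing program. -/
def preprocess : Prog :=
  scanProg ;; sizeProg ;; mergeSort ;; buildProg ;;
  .istore 1 (.const 0) (.reg 10) ;; .istore 1 (.const 1) (.reg 20) ;;
  .iset 0 (.add (.add (.add (.reg 10) (.reg 10)) (.add (.reg 10) (.reg 10)))
    (.add (.add (.reg 10) (.reg 10)) (.add (.reg 10) (.reg 10))))

/-- What the preprocessing program leaves in memory. -/
structure Ready (s s' : State) (n κ : ℕ) : Prop where
  lower : 2 * (4 * n + 1) ≤ 2 ^ κ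
  upper : 2 ^ κ ≤ 4 * (4 * n + 1)
  size : s'.ireg 0 = 8 * 2 ^ κ
  keys : s'.iarr 1 0 = 2 ^ κ
  flag : s'.iarr 1 1 ≠ 0 ↔ ∃ i, i < n ∧ SegMeets s.rarr (s.rreg 0) (s.rreg 1) i 0 0
  centre : s'.rarr 9 0 = s.rreg 0 ∧ s'.rarr 9 1 = s.rreg 1
  sorted : ∀ i j, i ≤ j → j < 2 ^ κ → s'.rarr 8 i ≤ s'.rarr 8 j
  tree : TreeOf s'.rarr (2 ^ κ) (2 ^ (κ + 2)) (s'.iarr 0) (4 * n + 1)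
  answer : ∀ c, c < 4 → ∀ u v, InCone c u v →
    ((∃ i, i < n ∧ SegMeets s.rarr (s.rreg 0) (s.rreg 1) i u v) ↔
      (∃ i, i < n ∧ SegMeets s.rarr (s.rreg 0) (s.rreg 1) i 0 0) ∨
      ∃ j, 1 ≤ j ∧ j < 4 * n + 1 ∧ Spans s'.rarr j (turnX c u v / turnY c u v + 4 * c) ∧
        1 / turnY c u v ≤ height s'.rarr j (turnX c u v / turnY c u v + 4 * c))

/-- The exponent `κ` becomes known only after the size has been computed, so the states between the
stages are named explicitly. The time is expressed through `κ` and is translated into `n * log n` by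
`log_bound`. -/
theorem preprocess_spec : ∃ C : ℕ, ∀ (s : State) (n : ℕ), s.ireg 0 = n → s.ireg 20 = 0 →
    (s.iarr 0 = fun _ => 0) →
    (∀ i j, i < n → j < n → i ≠ j → ∀ u v, SegInside s.rarr (s.rreg 0) (s.rreg 1) i u v →
      ¬ SegInside s.rarr (s.rreg 0) (s.rreg 1) j u v) →
    ∃ κ, Tri preprocess s (C * (2 ^ κ * (κ + 2))) fun s' => Ready s s' n κ := by
  obtain ⟨C, hC⟩ := scanProg_spec
  refine ⟨C + 10000, fun s n hn h20 h0 hP => ?_⟩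
  obtain ⟨t₁, s₁, run₁, ht₁, hI₁, h22, h90, h91, hflag, hst⟩ := hC s n hn h20
  obtain ⟨t₂, s₂, run₂, ht₂, hR₂, hI₂, h20₂, h21₂, κ, h10₂, hlo, hup⟩ :=
    sizeProg_spec s₁ (m := 4 * n) h22
  obtain ⟨t₃, s₃, run₃, ht₃, hf, hsort, hcov⟩ := mergeSort_spec s₂ κ h10₂
  have e4 : s₃.rarr 4 = s₁.rarr 4 := by rw [hf.rarr 4 (by norm_num) (by norm_num), hR₂]
  have e5 : s₃.rarr 5 = s₁.rarr 5 := by rw [hf.rarr 5 (by norm_num) (by norm_num), hR₂]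
  have e6 : s₃.rarr 6 = s₁.rarr 6 := by rw [hf.rarr 6 (by norm_num) (by norm_num), hR₂]
  have e7 : s₃.rarr 7 = s₁.rarr 7 := by rw [hf.rarr 7 (by norm_num) (by norm_num), hR₂]
  have e9 : s₃.rarr 9 = s₁.rarr 9 := by rw [hf.rarr 9 (by norm_num) (by norm_num), hR₂]
  have hunc : Uncrossed s₃.rarr (4 * n) := by
    have := uncrossed_of_stored hst hP
    unfold Uncrossed height at this ⊢
    rwa [e4, e5, e6, e7]
  have hkey : ∀ j, 1 ≤ j → j ≤ 4 * n → (∃ x, x < 2 ^ κ ∧ s₃.rarr 8 x = s₃.rarr 4 j) ∧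
      ∃ x, x < 2 ^ κ ∧ s₃.rarr 8 x = s₃.rarr 5 j := by
    intro j h1 h2
    obtain ⟨i, c, hi, hc, rfl⟩ := exists_index h1 h2
    have hs := hst i c hi hc
    rw [e4, e5, ← hs.key_left, ← hs.key_right, ← hR₂]
    -- The endpoints of piece `j` are in cells `2 * j` and `2 * j + 1`, below `2 * (4 * n + 1) ≤ 2 ^
    -- κ`. Any other values that are sorted with them are merely superfluous keys.
    exact ⟨hcov _ (by omega), hcov _ (by omega)⟩
  have h10₃ : s₃.ireg 10 = 2 ^ κ := (hf.ireg 10 (.inl le_rfl)).trans h10₂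
  obtain ⟨t₄, s₄, run₄, ht₄, hR₄, hI₄, h10₄, h20₄, hT⟩ := buildProg_spec s₃ hunc h10₃
    ((hf.ireg 21 (.inr (by norm_num))).trans h21₂) hsort hkey (by rw [hf.iarr, hI₂, hI₁, h0])
  have last := Tri.of_wp (c := .istore 1 (.const 0) (.reg 10) ;; .istore 1 (.const 1) (.reg 20) ;;
    .iset 0 (.add (.add (.add (.reg 10) (.reg 10)) (.add (.reg 10) (.reg 10)))
      (.add (.add (.reg 10) (.reg 10)) (.add (.reg 10) (.reg 10))))) (s := s₄)
    (Q := fun s' => Ready s s' n κ) (by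
      simp only [wp, IExpr.eval]
      refine ⟨hlo, hup, ?_, ?_, ?_, ?_, ?_, ?_, ?_⟩
      · simp [h10₄, h10₃]; ring
      · simp [h10₄, h10₃]
      · simpa [h20₄, hf.ireg 20, h20₂] using hflag
      · simp [hR₄, e9, h90, h91]
      · simpa [hR₄] using hsort
      · simpa [hR₄] using hT
      · intro c hc u v hcone
        rw [segMeets_iff hst hc hcone]
        simp [hR₄, Spans, height, e4, e5, e6, e7])
  refine ⟨κ, Tri.seq t₁ ((C + 10000) * (2 ^ κ * (κ + 2)) - t₁) ?_ ⟨t₁, s₁, run₁, le_rfl,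
    Tri.seq t₂ (t₃ + (t₄ + 50)) ?_ ⟨t₂, s₂, run₂, le_rfl,
    Tri.seq t₃ (t₄ + 50) le_rfl ⟨t₃, s₃, run₃, le_rfl,
    Tri.seq t₄ 50 le_rfl ⟨t₄, s₄, run₄, le_rfl,
    last.mono (by simp [Prog.bound, IExpr.cost]) fun _ h => h⟩⟩⟩⟩⟩
  -- Each stage costs at most a constant times `2 ^ κ * (κ + 2)`, because `n + 1` and `4 * n + 2`
  -- are at most `2 ^ κ`.
  all_goals
    have hpow : 2 ^ κ * 2 ≤ 2 ^ κ * (κ + 2) := Nat.mul_le_mul_left _ (by omega)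
    have b1 : C * (n + 1) ≤ C * (2 ^ κ * (κ + 2)) := Nat.mul_le_mul_left _ (by omega)
    have b3 : 2 ^ κ * (κ + 1) ≤ 2 ^ κ * (κ + 2) := Nat.mul_le_mul_left _ (by omega)
    have b4 : (κ + 2) * (4 * n + 2) ≤ (κ + 2) * 2 ^ κ := Nat.mul_le_mul_left _ (by omega)
    rw [mul_comm (κ + 2) (2 ^ κ)] at b4
    have b5 : 2100 * (κ + 2) * (4 * n + 2) = 2100 * ((κ + 2) * (4 * n + 2)) := by ring
    rw [b5] at ht₄
    rw [add_mul]
    omega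

/-! ### Return to the Euclidean plane and the final bounds. -/

theorem plane_inside {p q t : Plane} {u v : ℝ}
    (h : Inside (p 0 - t 0) (p 1 - t 1) (q 0 - t 0) (q 1 - t 1) u v) :
    !₂[u + t 0, v + t 1] ∈ openSegment ℝ p q := by
  obtain ⟨m, h1, h2, h3, h4⟩ := h
  refine ⟨1 - m, m, by linarith, h1, by ring, ?_⟩
  ext i
  fin_cases i
  · simp [h3]; ring
  · simp [h4]; ring

theorem plane_meets {p q t b : Plane} :
    (segment ℝ t b ∩ segment ℝ p q).Nonempty ↔
      Meets (p 0 - t 0) (p 1 - t 1) (q 0 - t 0) (q 1 - t 1) (b 0 - t 0) (b 1 - t 1) := by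
  constructor
  · rintro ⟨z, ⟨a, l, h1, h2, h3, rfl⟩, ⟨a', m, h4, h5, h6, h7⟩⟩
    have g0 := congrArg (fun w : Plane => w 0) h7
    have g1 := congrArg (fun w : Plane => w 1) h7
    simp at g0 g1
    obtain rfl : a = 1 - l := by linarith
    obtain rfl : a' = 1 - m := by linarith
    exact ⟨l, m, h2, by linarith, h5, by linarith, by linarith, by linarith⟩
  · rintro ⟨l, m, h1, h2, h3, h4, h5, h6⟩
    refine ⟨(1 - l) • t + l • b, ⟨1 - l, l, by linarith, h1, by ring, rfl⟩,
      ⟨1 - m, m, by linarith, h3, by ring, ?_⟩⟩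
    ext i
    fin_cases i
    · simp; linarith
    · simp; linarith

/-- For `n ≥ 2`, `16 * n + 4 ≤ 18 * n ≤ 2 ^ 5 * n`, so `κ * log 2 ≤ 5 * log 2 + log n ≤ 6 * log n`.
With `log 2 ≥ 1 / 2` this gives `κ ≤ 12 * log n` and `2 ≤ 4 * log n`. -/
theorem log_bound {n κ : ℕ} (hn : 2 ≤ n) (h : 2 ^ κ ≤ 4 * (4 * n + 1)) :
    ((2 ^ κ : ℕ) : ℝ) ≤ 18 * n ∧ ((κ + 2 : ℕ) : ℝ) ≤ 16 * Real.log n := by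
  have hn' : (2 : ℝ) ≤ n := by exact_mod_cast hn
  have h1 : ((2 ^ κ : ℕ) : ℝ) ≤ 18 * n := by
    have : 2 ^ κ ≤ 18 * n := by omega
    exact_mod_cast this
  refine ⟨h1, ?_⟩
  have hlog2 : Real.log 2 ≤ Real.log n := Real.log_le_log (by norm_num) hn'
  have h2 : (κ : ℝ) * Real.log 2 ≤ 5 * Real.log 2 + Real.log n := by
    rw [← Real.log_pow, show (5 : ℝ) * Real.log 2 = Real.log (2 ^ 5) by
      rw [Real.log_pow]; norm_num, ← Real.log_mul (by norm_num) (by positivity)]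
    refine Real.log_le_log (by positivity) ?_
    push_cast at h1
    linarith
  have h3 := Real.log_two_gt_d9
  push_cast
  nlinarith [mul_nonneg (Nat.cast_nonneg (α := ℝ) κ) (by linarith : (0 : ℝ) ≤ Real.log 2 - 1 / 2)]

theorem noncrossing_segInside {n : ℕ} {t : Plane} {P : Fin n → Plane × Plane} (hP : NonCrossing P)
    (i j : ℕ) (hi : i < n) (hj : j < n) (hij : i ≠ j) (u v : ℝ)
    (h : SegInside (inputState t P).rarr (t 0) (t 1) i u v) :
    ¬ SegInside (inputState t P).rarr (t 0) (t 1) j u v := by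
  intro h'
  simp only [SegInside, inputState, hi, hj, dif_pos] at h h'
  simp at h h'
  have hne : (⟨i, hi⟩ : Fin n) ≠ ⟨j, hj⟩ := by simpa using hij
  exact Set.disjoint_left.1 (hP hne) (plane_inside h) (plane_inside h')

theorem radiusMeets_iff {n : ℕ} {t b : Plane} {P : Fin n → Plane × Plane} :
    RadiusMeets t b P ↔ ∃ i, i < n ∧
      SegMeets (inputState t P).rarr (t 0) (t 1) i (b 0 - t 0) (b 1 - t 1) := by
  unfold RadiusMeets
  constructor
  · rintro ⟨⟨i, hi⟩, h⟩
    refine ⟨i, hi, ?_⟩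
    simp only [SegMeets, inputState, hi, dif_pos]
    simpa using plane_meets.1 h
  · rintro ⟨i, hi, h⟩
    refine ⟨⟨i, hi⟩, plane_meets.2 ?_⟩
    simp only [SegMeets, inputState, hi, dif_pos] at h
    simpa using h

/-- Every cell the query depends on has array name below `10` and index below `8 * 2 ^ κ`, which is
twice the number `2 ^ (κ + 2)` of the first leaf. So truncating the memory does not change the
answer. -/
theorem Ready.query_spec {n κ : ℕ} {t b : Plane} {P : Fin n → Plane × Plane} {s : State}
    (h : Ready (inputState t P) s n κ) (hb : b ≠ t) :
    Tri query (queryState (s.keep 10 (s.ireg 0)) b) (300 * (κ + 2)) fun s' =>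
      (s'.ireg 0 ≠ 0 ↔ RadiusMeets t b P) := by
  have hpos : 0 < 2 ^ κ := by positivity
  have hup := h.lower
  have hN : 2 ^ (κ + 2) = 4 * 2 ^ κ := by rw [pow_add]; ring
  set D := queryState (s.keep 10 (s.ireg 0)) b with hD
  have hR : ∀ a i, a < 10 → i < 8 * 2 ^ κ → D.rarr a i = s.rarr a i := fun a i h1 h2 => by
    simp [hD, queryState, State.keep, h1, h2, h.size]
  have hI : ∀ a i, a < 10 → i < 8 * 2 ^ κ → D.iarr a i = s.iarr a i := fun a i h1 h2 => by
    simp [hD, queryState, State.keep, h1, h2, h.size]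
  have t0 : (inputState t P).rreg 0 = t 0 := by simp [inputState]
  have t1 : (inputState t P).rreg 1 = t 1 := by simp [inputState]
  have hxy : b 0 - t 0 ≠ 0 ∨ b 1 - t 1 ≠ 0 := by
    by_contra hc
    rw [not_or, not_not, not_not] at hc
    refine hb ?_
    ext i
    fin_cases i
    · exact sub_eq_zero.1 hc.1
    · exact sub_eq_zero.1 hc.2
  refine (RealRAM.query_spec D (κ := κ) (x := b 0 - t 0) (y := b 1 - t 1) ?_ ?_ ?_ ?_ hxy).mono
    le_rfl ?_
  · rw [hI 1 0 (by norm_num) (by omega), h.keys]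
  · intro i j hij hj
    rw [hR 8 i (by norm_num) (by omega), hR 8 j (by norm_num) (by omega)]
    exact h.sorted i j hij hj
  · rw [hR 9 0 (by norm_num) (by omega), h.centre.1, t0]
    simp [hD, queryState]
  · rw [hR 9 1 (by norm_num) (by omega), h.centre.2, t1]
    simp [hD, queryState]
  · rintro s' ⟨c, hc, hcone, hs'⟩
    have hlt : ∀ v, s.iarr 0 v < 4 * n + 1 := fun v => by
      by_cases h0 : s.iarr 0 v = 0
      · omega
      · exact (h.tree.valid v h0).1
    have hans := h.answer c hc _ _ hcone
    rw [t0, t1] at hans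
    rw [hs', hI 1 1 (by norm_num) (by omega), h.flag, ← sees_congr (R := s.rarr) (T := s.iarr 0)
      (by omega) (fun j hj => (hR 8 j (by norm_num) (by omega)).symm)
      (fun v hv => (hI 0 v (by norm_num) (by omega)).symm) hlt
      (fun j hj => (hR 6 j (by norm_num) (by omega)).symm)
      (fun j hj => (hR 7 j (by norm_num) (by omega)).symm), h.tree.sees_iff, radiusMeets_iff,
      t0, t1, hans]

end RealRAM

theorem mainTheorem11 :
    ∃ (pre query : RealRAM.Prog) (k : ℕ) (C : ℝ),
      ∀ (n : ℕ) (P : Fin n → Plane × Plane) (t : Plane), NonCrossing P →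
        ∃ (T : ℕ) (s : RealRAM.State),
          RealRAM.Run pre (inputState t P) T s ∧
          -- the data structure consists of `k` integer arrays and `k` real arrays, each of the
          -- length that the preprocessing program leaves in integer register `0`
          (2 ≤ n →
            (T : ℝ) ≤ C * (n * Real.log n) ∧
            ((2 * k * s.ireg 0 : ℕ) : ℝ) ≤ C * n) ∧
          ∀ b : Plane, b ≠ t →
            ∃ (T' : ℕ) (s' : RealRAM.State),
              RealRAM.Run query (queryState (s.keep k (s.ireg 0)) b) T' s' ∧
              (2 ≤ n → (T' : ℝ) ≤ C * Real.log n) ∧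
              (s'.ireg 0 ≠ 0 ↔ RadiusMeets t b P) := by
  obtain ⟨C, hC⟩ := RealRAM.preprocess_spec
  -- Array `10` is only scratch space for merging and is dropped. By `log_bound`, `288 = 18 * 16`
  -- covers the preprocessing time, `4800 = 300 * 16` covers the query time, and `4800` also exceeds
  -- `160 * 18`, the factor for the size.
  refine ⟨RealRAM.preprocess, RealRAM.query, 10, 288 * C + 4800, fun n P t hP => ?_⟩
  obtain ⟨κ, T, s, hrun, hT, hready⟩ := hC (inputState t P) n (by simp [inputState])
    (by simp [inputState]) rfl (by simpa [inputState] using RealRAM.noncrossing_segInside hP)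
  refine ⟨T, s, hrun, fun hn => ?_, fun b hb => ?_⟩
  · obtain ⟨h1, h2⟩ := RealRAM.log_bound hn hready.upper
    have hlog : 0 ≤ Real.log n := Real.log_natCast_nonneg n
    have hnn : (0 : ℝ) ≤ n := Nat.cast_nonneg n
    have hCC : (0 : ℝ) ≤ C := Nat.cast_nonneg C
    constructor
    · calc (T : ℝ) ≤ ((C * (2 ^ κ * (κ + 2)) : ℕ) : ℝ) := by exact_mod_cast hT
        _ = C * (((2 ^ κ : ℕ) : ℝ) * ((κ + 2 : ℕ) : ℝ)) := by push_cast; ring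
        _ ≤ C * (18 * n * (16 * Real.log n)) := by gcongr
        _ ≤ (288 * C + 4800) * (n * Real.log n) := by
          have := mul_nonneg hnn hlog
          nlinarith
    · rw [hready.size]
      have : ((2 * 10 * (8 * 2 ^ κ) : ℕ) : ℝ) = 160 * ((2 ^ κ : ℕ) : ℝ) := by push_cast; ring
      rw [this]
      nlinarith [mul_nonneg hCC hnn]
  · obtain ⟨T', s', hrun', hT', hans⟩ := hready.query_spec hb
    refine ⟨T', s', hrun', fun hn => ?_, hans⟩
    obtain ⟨-, h2⟩ := RealRAM.log_bound hn hready.upper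
    have hlog : 0 ≤ Real.log n := Real.log_natCast_nonneg n
    calc (T' : ℝ) ≤ ((300 * (κ + 2) : ℕ) : ℝ) := by exact_mod_cast hT'
      _ = 300 * ((κ + 2 : ℕ) : ℝ) := by push_cast; ring
      _ ≤ 300 * (16 * Real.log n) := by gcongr
      _ ≤ (288 * C + 4800) * Real.log n := by
        have : (0 : ℝ) ≤ C * Real.log n := mul_nonneg (Nat.cast_nonneg C) hlog
        nlinarith
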